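/- Let $k$ be any field, let $d\ge 0$, and let $g\in\operatorname{Bir}(\mathbb P^d_k)$ be a birational transformation of $\mathbb P^d_k$ over $k$. The degree $\deg(g)$ is the integer $n$ such that $g=[g_0:\dots:g_d]$ for homogeneous polynomials $g_0,\dots,g_d\in k[x_0,\dots,x_d]$ of degree $n$ without non-constant common factor. A variety over $k$ is an integral separated scheme of finite type over $k$. The exceptional locus of a birational map $f\colon X\dashrightarrow Y$ of varieties is the closed set of points of $X$ at which $f$ is not a local isomorphism, and a pseudo-automorphism of a variety $Y$ is an $h\in\operatorname{Bir}(Y)$ such that the exceptional loci of $h$ and of $h^{-1}$ have codimension $>1$ in $Y$. One says that $g$ is pseudo-regularizable if there are a variety $Y$ over $k$ and a birational map $f\colon\mathbb P^d_k\dashrightarrow Y$ over $k$ such that every element of $f\langle g\rangle f^{-1}$ is a pseudo-automorphism of $Y$. If $g$ is not pseudo-regularizable, then $\deg(g^n)$ grows asymptotically at least like $\frac{1}{d+1}\,n$, that is, $$\liminf_{n\to\infty}\frac{\deg(g^n)}{n}\;\ge\;\frac{1}{d+1}.$$ -/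

import Mathlib

open AlgebraicGeometry CategoryTheory

universe u

noncomputable section

namespace Cremona

/-- A variety over a field `k`: an integral and separated scheme of finite type over `k`. -/
structure Variety (k : Type u) [Field k] where
  /-- The underlying scheme. -/
  X : Scheme.{u}
  /-- The structure morphism. -/
  str : X ⟶ Spec (CommRingCat.of k)
  isIntegral : IsIntegral X
  isSeparated : IsSeparated str
  locallyOfFiniteType : LocallyOfFiniteType str
  quasiCompact : QuasiCompact str

attribute [instance] Variety.isIntegral Variety.isSeparated Variety.locallyOfFiniteType
  Variety.quasiCompact

section Birational

variable {k : Type u} [Field k]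

/-- A birational map `X ⇢ Y` of varieties over `k`: a dominant rational map over `k` together with
its (unique) inverse, a dominant rational map `Y ⇢ X` over `k`. Mathlib's `f.comp g` is
"first `f`, then `g`". -/
@[ext]
structure BirMap (X Y : Variety k) where
  /-- The rational map. -/
  map : X.X ⤏ Y.X
  /-- The inverse rational map. -/
  inv : Y.X ⤏ X.X
  map_dominant : map.IsDominant
  inv_dominant : inv.IsDominant
  map_over : map.compHom Y.str = X.str.toRationalMap
  inv_over : inv.compHom X.str = Y.str.toRationalMap
  map_inv : map.comp inv = Scheme.RationalMap.id X.X
  inv_map : inv.comp map = Scheme.RationalMap.id Y.X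

attribute [instance] BirMap.map_dominant BirMap.inv_dominant

namespace BirMap

variable {X Y Z W : Variety k}

/-- The identity. -/
def refl (X : Variety k) : BirMap X X where
  map := Scheme.RationalMap.id X.X
  inv := Scheme.RationalMap.id X.X
  map_dominant := inferInstance
  inv_dominant := inferInstance
  map_over := by simp
  inv_over := by simp
  map_inv := by simp
  inv_map := by simp

/-- The inverse birational map. -/
def symm (f : BirMap X Y) : BirMap Y X where
  map := f.inv
  inv := f.map
  map_dominant := f.inv_dominant
  inv_dominant := f.map_dominant
  map_over := f.inv_over
  inv_over := f.map_over
  map_inv := f.inv_map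
  inv_map := f.map_inv

lemma comp_over (f : BirMap X Y) (g : BirMap Y Z) :
    (f.map.comp g.map).compHom Z.str = X.str.toRationalMap := by
  rw [← Scheme.RationalMap.comp_toRationalMap, Scheme.RationalMap.comp_assoc,
    Scheme.RationalMap.comp_toRationalMap, g.map_over, Scheme.RationalMap.comp_toRationalMap,
    f.map_over]

lemma comp_inv (f : BirMap X Y) (g : BirMap Y Z) :
    (f.map.comp g.map).comp (g.inv.comp f.inv) = Scheme.RationalMap.id X.X := by
  have h : g.map.comp (g.inv.comp f.inv) = f.inv := by
    rw [← Scheme.RationalMap.comp_assoc]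
    simp only [g.map_inv, Scheme.RationalMap.id_comp]
  rw [Scheme.RationalMap.comp_assoc, h, f.map_inv]

/-- Composition: first `f`, then `g`. -/
def trans (f : BirMap X Y) (g : BirMap Y Z) : BirMap X Z where
  map := f.map.comp g.map
  inv := g.inv.comp f.inv
  map_dominant := inferInstance
  inv_dominant := inferInstance
  map_over := comp_over f g
  inv_over := comp_over g.symm f.symm
  map_inv := comp_inv f g
  inv_map := comp_inv g.symm f.symm

end BirMap

/-- `Bir(X)`: the birational transformations of `X`. -/
abbrev Bir (X : Variety k) : Type u := BirMap X X

/-- `Bir(X)` is a group; `f * g` is "first `g`, then `f`". -/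
instance (X : Variety k) : Group (Bir X) where
  mul f g := BirMap.trans g f
  one := BirMap.refl X
  inv f := BirMap.symm f
  mul_assoc f g h := BirMap.ext (Scheme.RationalMap.comp_assoc _ _ _).symm
    (Scheme.RationalMap.comp_assoc _ _ _)
  one_mul f := BirMap.ext (Scheme.RationalMap.comp_id _) (Scheme.RationalMap.id_comp _)
  mul_one f := BirMap.ext (Scheme.RationalMap.id_comp _) (Scheme.RationalMap.comp_id _)
  inv_mul_cancel f := BirMap.ext f.map_inv f.map_inv

/-- The exceptional locus of a birational map: the points of `X` at which it is not a local
isomorphism, i.e. which have no open neighbourhood on which the map is defined and restricts to an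
isomorphism onto an open subscheme of `Y`. -/
def BirMap.exc {X Y : Variety k} (f : BirMap X Y) : Set X.X :=
  {x | ¬ ∃ p : X.X.PartialMap Y.X, p.toRationalMap = f.map ∧ x ∈ p.domain ∧ IsOpenImmersion p.hom}

/-- The codimension of a closed subset `Z` of a scheme: the infimum over `x ∈ Z` of the codimension
of the closure of `x` (which is the Krull dimension of the local ring at `x`); the empty set has
codimension `⊤`. -/
def codim {X : Scheme.{u}} (Z : Set X) : ℕ∞ := ⨅ x ∈ Z, Order.coheight x

/-- An isomorphism in codimension `l`: the exceptional loci of `f` and of its inverse have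
codimension `> l`. -/
def BirMap.IsIsoInCodim {X Y : Variety k} (l : ℕ) (f : BirMap X Y) : Prop :=
  (l : ℕ∞) < codim f.exc ∧ (l : ℕ∞) < codim f.symm.exc

/-- A pseudo-automorphism of `Y`: a birational transformation of `Y` that is an isomorphism in
codimension one. -/
def IsPseudoAutomorphism {Y : Variety k} (f : Bir Y) : Prop := BirMap.IsIsoInCodim 1 f

/-- A subgroup `G` of `Bir(X)` is pseudo-regularizable if there are a variety `Y` over `k` and a
birational map `f : X ⇢ Y` such that `f G f⁻¹` consists of pseudo-automorphisms of `Y`. -/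
def IsPseudoRegularizable {X : Variety k} (G : Subgroup (Bir X)) : Prop :=
  ∃ (Y : Variety k) (f : BirMap X Y),
    ∀ g ∈ G, IsPseudoAutomorphism ((f.symm.trans g).trans f)

end Birational

section ProjectiveSpace

variable (k : Type u) [Field k] (d : ℕ)

/-- The standard grading of `k[x₀, …, x_d]`. -/
abbrev grading : ℕ → Submodule k (MvPolynomial (Fin (d + 1)) k) :=
  MvPolynomial.homogeneousSubmodule (Fin (d + 1)) k

attribute [instance] MvPolynomial.gradedAlgebra

/-- The scheme `Proj k[x₀, …, x_d]`. -/
abbrev projScheme : Scheme.{u} := Proj (grading k d)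

/-- The structure morphism of `Proj k[x₀, …, x_d]` over `k`. -/
def projStr : projScheme k d ⟶ Spec (CommRingCat.of k) :=
  Proj.toSpecZero (grading k d) ≫
    Spec.map (CommRingCat.ofHom (algebraMap k (grading k d 0)))

lemma X_mem_irrelevant (i : Fin (d + 1)) :
    MvPolynomial.X i ∈ HomogeneousIdeal.irrelevant (grading k d) :=
  HomogeneousIdeal.mem_irrelevant_of_mem _ Nat.one_pos
    ((MvPolynomial.mem_homogeneousSubmodule _ _).2 (MvPolynomial.isHomogeneous_X k i))

/-- The generic point of `Proj k[x₀, …, x_d]`, i.e. the zero ideal. -/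
def projGeneric : projScheme k d :=
  (⟨⊥, by rw [HomogeneousIdeal.toIdeal_bot]; exact Ideal.isPrime_bot, fun h => by
    have h0 := h (X_mem_irrelevant k d 0)
    rw [← HomogeneousIdeal.mem_iff, HomogeneousIdeal.toIdeal_bot, Ideal.mem_bot] at h0
    exact MvPolynomial.X_ne_zero _ h0⟩ : ProjectiveSpectrum (grading k d))

lemma projGeneric_mem_basicOpen {F : MvPolynomial (Fin (d + 1)) k} (hF : F ≠ 0) :
    projGeneric k d ∈ Proj.basicOpen (grading k d) F := by
  rw [Proj.mem_basicOpen]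
  intro h
  rw [← HomogeneousIdeal.mem_iff] at h
  exact hF ((Ideal.mem_bot).1 h)

lemma eq_bot_of_projGeneric_notMem {U : (projScheme k d).Opens} (hU : projGeneric k d ∉ U) :
    U = ⊥ := by
  rw [eq_bot_iff]
  intro x hx
  obtain ⟨_, ⟨F, rfl⟩, hxF, hFU⟩ :=
    TopologicalSpace.Opens.isBasis_iff_nbhd.1 (Proj.isBasis_basicOpen (grading k d)) hx
  refine absurd (hFU (projGeneric_mem_basicOpen k d (F := F) ?_)) hU
  rintro rfl
  simp at hxF

instance projScheme_irreducible : IrreducibleSpace (projScheme k d) where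
  isPreirreducible_univ := by
    rintro U V hU hV ⟨x, -, hx⟩ ⟨y, -, hy⟩
    have key : ∀ (W : Set (projScheme k d)) (z : projScheme k d), IsOpen W → z ∈ W →
        projGeneric k d ∈ W := by
      intro W z hW hz
      by_contra h
      have := eq_bot_of_projGeneric_notMem k d (U := ⟨W, hW⟩) h
      have hz' : z ∈ (⟨W, hW⟩ : (projScheme k d).Opens) := hz
      rw [this] at hz'
      exact hz'
    exact ⟨projGeneric k d, trivial, key U x hU hx, key V y hV hy⟩
  toNonempty := ⟨projGeneric k d⟩

lemma basicOpen_dense {F : MvPolynomial (Fin (d + 1)) k} (hF : F ≠ 0) :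
    Dense (Proj.basicOpen (grading k d) F : Set (projScheme k d)) :=
  (Proj.basicOpen (grading k d) F).2.dense ⟨_, projGeneric_mem_basicOpen k d hF⟩

instance projScheme_isIntegral : IsIntegral (projScheme k d) := by
  have : IsReduced (projScheme k d) := by
    have (x : projScheme k d) : _root_.IsReduced ((projScheme k d).presheaf.stalk x) := by
      have : x.asHomogeneousIdeal.toIdeal.IsPrime := ProjectiveSpectrum.isPrime x
      let e := (Proj.stalkIso (grading k d) x).commRingCatIsoToRingEquiv
      have h : _root_.IsReduced (HomogeneousLocalization.AtPrime (grading k d)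
          x.asHomogeneousIdeal.toIdeal) := by
        have : IsDomain (Localization x.asHomogeneousIdeal.toIdeal.primeCompl) :=
          IsLocalization.isDomain_localization (Ideal.primeCompl_le_nonZeroDivisors _)
        exact isReduced_of_injective
          (algebraMap (HomogeneousLocalization.AtPrime (grading k d)
            x.asHomogeneousIdeal.toIdeal) (Localization x.asHomogeneousIdeal.toIdeal.primeCompl))
          (HomogeneousLocalization.val_injective _)
      have h' : _root_.IsReduced (CommRingCat.of (HomogeneousLocalization.AtPrime (grading k d)
          x.asHomogeneousIdeal.toIdeal)) := h
      exact isReduced_of_injective e.toRingHom e.injective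
    exact isReduced_of_isReduced_stalk _
  exact isIntegral_of_irreducibleSpace_of_isReduced _

instance : Algebra.FiniteType (grading k d 0) (MvPolynomial (Fin (d + 1)) k) :=
  have : IsScalarTower k (grading k d 0) (MvPolynomial (Fin (d + 1)) k) :=
    IsScalarTower.of_algebraMap_eq (R := k) (S := grading k d 0) fun _ => rfl
  Algebra.FiniteType.of_restrictScalars_finiteType k _ _

/-- Constants are exactly the forms of degree zero. -/
lemma bijective_algebraMap_zero : Function.Bijective (algebraMap k (grading k d 0)) := by
  constructor
  · intro a b h
    have h' := congrArg (fun x : grading k d 0 => (x : MvPolynomial (Fin (d + 1)) k)) h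
    exact MvPolynomial.C_injective _ _ h'
  · rintro ⟨p, hp⟩
    have h := (MvPolynomial.totalDegree_eq_zero_iff_eq_C).1
      (Nat.le_zero.1 ((MvPolynomial.mem_homogeneousSubmodule _ _).1 hp).totalDegree_le)
    exact ⟨p.coeff 0, Subtype.ext h.symm⟩

instance isIso_spec_zero :
    IsIso (Spec.map (CommRingCat.ofHom (algebraMap k (grading k d 0)))) := by
  have : IsIso (CommRingCat.ofHom (algebraMap k (grading k d 0))) :=
    (ConcreteCategory.isIso_iff_bijective _).2 (bijective_algebraMap_zero k d)
  infer_instance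

/-- Projective space `ℙ^d` over `k`. -/
def projSpace : Variety k where
  X := projScheme k d
  str := projStr k d
  isIntegral := inferInstance
  isSeparated := by unfold projStr; infer_instance
  locallyOfFiniteType := by unfold projStr; infer_instance
  quasiCompact := by unfold projStr; infer_instance

variable {k d}

/-- The ring homomorphism `k[x₀, …, x_d] → (k[x₀, …, x_d]_{F_j})₀`, `x_i ↦ F_i / F_j`, for forms
`F₀, …, F_d` of the same degree `n`. -/
def ratioHom {n : ℕ} (F : Fin (d + 1) → MvPolynomial (Fin (d + 1)) k)
    (hF : ∀ i, F i ∈ grading k d n) (j : Fin (d + 1)) :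
    MvPolynomial (Fin (d + 1)) k →+* HomogeneousLocalization.Away (grading k d) (F j) :=
  MvPolynomial.eval₂Hom
    ((algebraMap (grading k d 0) (HomogeneousLocalization.Away (grading k d) (F j))).comp
      (algebraMap k (grading k d 0)))
    (fun i => HomogeneousLocalization.mk
      { deg := n
        num := ⟨F i, hF i⟩
        den := ⟨F j, hF j⟩
        den_mem := Submonoid.mem_powers _ })

/-- The same homomorphism, with values in the regular functions on the open subscheme
`D₊(F_j) = {F_j ≠ 0}` of `ℙ^d`. -/
def ratioSections {n : ℕ} (F : Fin (d + 1) → MvPolynomial (Fin (d + 1)) k)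
    (hF : ∀ i, F i ∈ grading k d n) (j : Fin (d + 1)) :
    MvPolynomial (Fin (d + 1)) k →+* Γ((Proj.basicOpen (grading k d) (F j)).toScheme, ⊤) :=
  ((Proj.awayToSection (grading k d) (F j) ≫
    (Proj.basicOpen (grading k d) (F j)).topIso.inv).hom).comp (ratioHom F hF j)

lemma ratioSections_irrelevant {n : ℕ} (F : Fin (d + 1) → MvPolynomial (Fin (d + 1)) k)
    (hF : ∀ i, F i ∈ grading k d n) (j : Fin (d + 1)) :
    (HomogeneousIdeal.irrelevant (grading k d)).toIdeal.map (ratioSections F hF j) = ⊤ := by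
  have h1 : ratioHom F hF j (MvPolynomial.X j) = 1 := by
    apply HomogeneousLocalization.val_injective
    rw [ratioHom, MvPolynomial.coe_eval₂Hom, MvPolynomial.eval₂_X, HomogeneousLocalization.val_mk,
      HomogeneousLocalization.val_one]
    exact Localization.mk_self (⟨F j, Submonoid.mem_powers _⟩ : Submonoid.powers (F j))
  rw [Ideal.eq_top_iff_one]
  have h2 := Ideal.mem_map_of_mem (ratioSections F hF j) (X_mem_irrelevant k d j)
  rwa [ratioSections, RingHom.comp_apply, h1, map_one] at h2

/-- The morphism `[F₀ : … : F_d] = [F₀/F_j : … : F_d/F_j]` from the dense open subscheme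
`D₊(F_j) = {F_j ≠ 0}` of `ℙ^d` to `ℙ^d`, as a partial map. -/
def polyMap {n : ℕ} (F : Fin (d + 1) → MvPolynomial (Fin (d + 1)) k)
    (hF : ∀ i, F i ∈ grading k d n) (j : Fin (d + 1)) (hj : F j ≠ 0) :
    (projSpace k d).X.PartialMap (projSpace k d).X where
  domain := Proj.basicOpen (grading k d) (F j)
  dense_domain := basicOpen_dense k d hj
  hom := Proj.fromOfGlobalSections (grading k d) (ratioSections F hF j)
    (ratioSections_irrelevant F hF j)

/-- `g` is given by forms of degree `n`: there are homogeneous polynomials `F₀, …, F_d` of degree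
`n` without non-constant common factor such that `g = [F₀ : … : F_d]`. (The `F_i` are then not all
zero.) -/
def IsGivenInDegree (g : Bir (projSpace k d)) (n : ℕ) : Prop :=
  ∃ (F : Fin (d + 1) → MvPolynomial (Fin (d + 1)) k) (hF : ∀ i, F i ∈ grading k d n),
    (∀ q, (∀ i, q ∣ F i) → IsUnit q) ∧
      ∀ (j : Fin (d + 1)) (hj : F j ≠ 0), (polyMap F hF j hj).toRationalMap = g.map

/-- The degree of a birational transformation of `ℙ^d`: the (unique) `n` such that it is given by
forms of degree `n` without non-constant common factor. -/
def deg (g : Bir (projSpace k d)) : ℕ := sInf {n | IsGivenInDegree g n}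

end ProjectiveSpace

end Cremona

end

noncomputable section

/-! ### Sets commensurated by a permutation -/

section

namespace Cremona

section Commensurated

variable {α : Type*} (e : Equiv.Perm α)

/-! Let A = k[x₁, …, x_d], let K be its fraction field, and let σ be the automorphism of K induced
by g. The proof follows the set S = `primeRings A K` of discrete valuation rings A_(p), one for each
prime divisor of the affine chart of ℙ^d, under the action of σ on subrings of K. A ring A_(p) in S
lies outside σ(S) exactly when g does not map the divisor p onto a divisor of the chart: it
contracts it or sends it to infinity. This happens for finitely many p only
(`finite_primeRings_diff`), and likewise for the inverse, so S is commensurated by σ.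

A statement about permutations, `exists_invariant_or_growth`, then leaves two cases. Either S agrees
up to finitely many elements with a σ-invariant set S', or some orbit passes once and for all into
or out of S, and then S \ σⁿ(S) or σⁿ(S) \ S has at least n elements for every n.

In the first case g is pseudo-regularizable. A proper model of K dominating ℙ^d and finitely many of
its twists by powers of σ realizes every element of S' as a local ring, by the valuative criterion.
Removing its finitely many prime divisors whose local rings are not in S' gives Y. By invariance
each prime divisor of Y has a local ring which is the σⁿ-image of another local ring of Y, and
equality of local rings makes the birational map a local isomorphism there (`Model.notMem_exc`,
`Model.isPseudoRegularizable_of_invariant`).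

In the second case the degree must grow. If g = [a₀ : … : a_d] in affine coordinates, a divisor p on
which neither a₀ nor the Jacobian determinant vanishes is not contracted
(`exists_mapSubring_primeRing_eq`). The Jacobian is nonzero of degree at most (d + 1) deg g, and the
divisors sent to infinity cost a constant, so |S \ σ(S)| ≤ (d + 1) deg g + C with C independent of g
(`exists_encard_primeRings_diff_le`). The set σ(S) \ S has the same size, because A is factorial
with units k*, which bounds the rank of a valuation matrix (`encard_primeRings_diff_le`). Applied to
gⁿ this gives n ≤ (d + 1) deg(gⁿ) + C. -/

lemma Int.exists_not_and_of_eventually {f : ℤ → Prop} (hf : ∃ N, ∀ j ≥ N, f j)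
    (hf' : ∃ j, ¬ f j) : ∃ i, ¬ f (i - 1) ∧ f i := by
  by_contra! h
  obtain ⟨N, hN⟩ := hf
  obtain ⟨j, hj⟩ := hf'
  have key : ∀ m : ℕ, f (max N j - m) := by
    intro m
    induction m with
    | zero => exact hN _ (by simp)
    | succ m ih =>
      by_contra hc
      refine h _ ?_ ih
      convert hc using 2
      push_cast
      ring
  refine hj ?_
  convert key (max N j - j).toNat using 1
  rw [Int.toNat_of_nonneg (by simp)]
  ring

lemma perm_zpow_eq_of_periodic {x : α} {m : ℤ} (hm : (e ^ m) x = x) (i : ℤ) :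
    (e ^ (m * i)) x = x := by
  rw [zpow_mul]
  exact Equiv.Perm.zpow_apply_eq_self_of_apply_eq_self hm i

/-- The orbit of `x` splits into n progressions, one for each residue modulo n, and each of them
enters S at some step. The entry points lie in S but not in eⁿ(S), and they are distinct because the
orbit is infinite. -/
lemma natCast_le_encard_of_transition {S : Set α} {x : α}
    (h1 : ∃ N : ℤ, ∀ j ≥ N, (e ^ j) x ∈ S) (h2 : ∃ N : ℤ, ∀ j ≤ N, (e ^ j) x ∉ S) (n : ℕ) :
    (n : ℕ∞) ≤ (S \ (e ^ n) '' S).encard := by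
  obtain ⟨N₁, hN₁⟩ := h1
  obtain ⟨N₂, hN₂⟩ := h2
  -- The orbit has no period m: the exponents used below differ from y by multiples of m, and m² ≥ 1
  -- pushes one of them above N₁ and the other below N₂.
  have hper : ∀ m : ℤ, m ≠ 0 → ∀ y : ℤ, (e ^ m) ((e ^ y) x) ≠ (e ^ y) x := by
    intro m hm y hy
    have h3 := perm_zpow_eq_of_periodic e hy
    have hpos : ∀ i : ℤ, (e ^ (m * i + y)) x = (e ^ y) x := fun i => by
      rw [zpow_add, Equiv.Perm.mul_apply, h3]
    have hmm : 1 ≤ m * m := by nlinarith [mul_self_pos.2 hm]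
    have a1 := hN₁ (m * (m * (|N₁| + |y|)) + y) (by
      have := le_abs_self N₁
      have := neg_abs_le y
      have := abs_nonneg N₁
      have := abs_nonneg y
      nlinarith)
    have a2 := hN₂ (m * (m * (-(|N₂| + |y|))) + y) (by
      have := neg_abs_le N₂
      have := le_abs_self y
      have := abs_nonneg N₂
      have := abs_nonneg y
      nlinarith)
    rw [hpos] at a1 a2
    exact a2 a1
  rcases Nat.eq_zero_or_pos n with rfl | hn
  · simp
  have hn' : (1 : ℤ) ≤ n := by exact_mod_cast hn
  have key : ∀ r : Fin n, ∃ i : ℤ, ¬ (e ^ ((r : ℤ) + n * (i - 1))) x ∈ S ∧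
      (e ^ ((r : ℤ) + n * i)) x ∈ S := by
    intro r
    have hr : (0 : ℤ) ≤ (r : ℕ) := by positivity
    have hr' : ((r : ℕ) : ℤ) < n := by exact_mod_cast r.2
    refine Int.exists_not_and_of_eventually (f := fun i => (e ^ ((r : ℤ) + n * i)) x ∈ S) ?_ ?_
    · refine ⟨|N₁|, fun j hj => hN₁ _ ?_⟩
      have := le_abs_self N₁
      have := abs_nonneg N₁
      nlinarith
    · refine ⟨-(|N₂| + 1), hN₂ _ ?_⟩
      have := neg_abs_le N₂
      have := abs_nonneg N₂
      nlinarith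
  choose i hi using key
  let f : Fin n → α := fun r => (e ^ ((r : ℤ) + n * i r)) x
  have hinj : Function.Injective f := by
    intro r s hrs
    have h0 : ((r : ℕ) : ℤ) + n * i r = s + n * i s := by
      by_contra hne
      refine hper (((r : ℕ) : ℤ) + n * i r - (s + n * i s)) (sub_ne_zero.2 hne)
        (s + n * i s) ?_
      rw [← Equiv.Perm.mul_apply, ← zpow_add, sub_add_cancel]
      exact hrs
    have h1 := congrArg (· % (n : ℤ)) h0
    simp only [Int.add_mul_emod_self_left] at h1
    rw [Int.emod_eq_of_lt (by positivity) (by exact_mod_cast r.2),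
      Int.emod_eq_of_lt (by positivity) (by exact_mod_cast s.2)] at h1
    exact Fin.ext (by exact_mod_cast h1)
  have hsub : Set.range f ⊆ S \ (e ^ n) '' S := by
    rintro _ ⟨r, rfl⟩
    refine ⟨(hi r).2, ?_⟩
    rintro ⟨y, hy, hyx⟩
    refine (hi r).1 ?_
    have : (e ^ ((r : ℤ) + n * (i r - 1))) x = y := by
      apply (e ^ n).injective
      rw [hyx, ← zpow_natCast, ← Equiv.Perm.mul_apply, ← zpow_add]
      simp only [f]
      congr 2
      ring
    rwa [this]
  calc (n : ℕ∞) = (Set.range f).encard := by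
        rw [← Set.image_univ, hinj.encard_image]; simp
    _ ≤ _ := Set.encard_le_encard hsub

/-- A subset commensurated by a permutation `e` is either commensurate to an invariant subset, or
the symmetric differences with its translates grow linearly. -/
theorem exists_invariant_or_growth {S : Set α} (h1 : (S \ e '' S).Finite)
    (h2 : (e '' S \ S).Finite) :
    (∃ S' : Set α, e '' S' = S' ∧ (S \ S').Finite ∧ (S' \ S).Finite ∧
      ∀ x ∈ S', ∃ j : ℤ, (e ^ j) x ∈ S) ∨
    (∀ n : ℕ, (n : ℕ∞) ≤ (S \ (e ^ n) '' S).encard) ∨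
    (∀ n : ℕ, (n : ℕ∞) ≤ ((e ^ n) '' S \ S).encard) := by
  by_cases hA : ∃ x, (∃ N : ℤ, ∀ j ≥ N, (e ^ j) x ∈ S) ∧ (∃ N : ℤ, ∀ j ≤ N, (e ^ j) x ∉ S)
  · obtain ⟨x, hx1, hx2⟩ := hA
    exact Or.inr (Or.inl (natCast_le_encard_of_transition e hx1 hx2))
  by_cases hB : ∃ x, (∃ N : ℤ, ∀ j ≥ N, (e ^ j) x ∉ S) ∧ (∃ N : ℤ, ∀ j ≤ N, (e ^ j) x ∈ S)
  · obtain ⟨x, hx1, hx2⟩ := hB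
    refine Or.inr (Or.inr fun n => ?_)
    have := natCast_le_encard_of_transition (S := Sᶜ) e (x := x) hx1 (by simpa using hx2) n
    rw [Set.image_compl_eq (e ^ n).bijective] at this
    convert this using 2
    ext y
    simp [and_comm]
  refine Or.inl ?_
  -- B is the finite set of places where an orbit crosses the boundary of S; membership in S is
  -- constant along any orbit segment that avoids B.
  set B : Set α := {x | ¬ (x ∈ S ↔ e x ∈ S)} with hBdef
  have hBfin : B.Finite := by
    refine ((h1.union h2).preimage (f := e) e.injective.injOn).subset ?_
    intro x hx
    simp only [Set.mem_preimage, Set.mem_union, Set.mem_sdiff, Set.mem_image,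
      EmbeddingLike.apply_eq_iff_eq, exists_eq_right]
    simp only [hBdef, Set.mem_ofPred_eq] at hx
    tauto
  have hconst : ∀ (x : α) (a : ℤ) (m : ℕ), (∀ i, a ≤ i → i < a + m → (e ^ i) x ∉ B) →
      ((e ^ a) x ∈ S ↔ (e ^ (a + m)) x ∈ S) := by
    intro x a m
    induction m with
    | zero => simp
    | succ m ih =>
      intro h
      rw [ih fun i hi hi' => h i hi (by push_cast; lia)]
      have := h (a + m) (by lia) (by push_cast; lia)
      simp only [hBdef, Set.mem_ofPred_eq, not_not] at this
      rw [this, ← Equiv.Perm.mul_apply, ← zpow_one_add]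
      push_cast
      rw [show (1 : ℤ) + (a + m) = a + (m + 1) by ring]
  have hconst' : ∀ (x : α) (a b : ℤ), a ≤ b → (∀ i, a ≤ i → i < b → (e ^ i) x ∉ B) →
      ((e ^ a) x ∈ S ↔ (e ^ b) x ∈ S) := by
    intro x a b hab h
    have := hconst x a (b - a).toNat (fun i hi hi' => h i hi (by lia))
    rwa [Int.toNat_of_nonneg (by lia), add_sub_cancel] at this
  have hper : ∀ x : α, (∃ m : ℤ, 0 < m ∧ (e ^ m) x = x) ∨
      ((∃ N : ℤ, ∀ j ≥ N, (e ^ j) x ∈ S) ∨ (∃ N : ℤ, ∀ j ≥ N, (e ^ j) x ∉ S)) := by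
    intro x
    by_cases hinj : Function.Injective fun j : ℤ => (e ^ j) x
    · right
      obtain ⟨N, hN⟩ := (hBfin.preimage (f := fun j : ℤ => (e ^ j) x) hinj.injOn).bddAbove
      have hc : ∀ j ≥ N + 1, ((e ^ (N + 1)) x ∈ S ↔ (e ^ j) x ∈ S) := fun j hj =>
        hconst' x _ _ hj fun i hi _ hiB => by
          have := hN (a := i) hiB
          lia
      by_cases hx : (e ^ (N + 1)) x ∈ S
      · exact Or.inl ⟨N + 1, fun j hj => (hc j hj).1 hx⟩
      · exact Or.inr ⟨N + 1, fun j hj hj' => hx ((hc j hj).2 hj')⟩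
    · left
      simp only [Function.Injective, not_forall] at hinj
      obtain ⟨i, j, hij, hne⟩ := hinj
      have : ∀ i j : ℤ, (e ^ i) x = (e ^ j) x → i < j → ∃ m : ℤ, 0 < m ∧ (e ^ m) x = x := by
        intro i j h hlt
        refine ⟨j - i, by lia, ?_⟩
        apply (e ^ i).injective
        rw [← Equiv.Perm.mul_apply, ← zpow_add, add_sub_cancel, h]
      rcases lt_or_gt_of_ne hne with h | h
      · exact this i j hij h
      · exact this j i hij.symm h
  -- The invariant set consists of the points whose forward orbit is eventually in S; shifting N
  -- shows invariance.
  refine ⟨{x | ∃ N : ℤ, ∀ j ≥ N, (e ^ j) x ∈ S}, ?_, ?_⟩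
  · ext x
    simp only [Set.mem_image, Set.mem_ofPred_eq]
    constructor
    · rintro ⟨y, ⟨N, hN⟩, rfl⟩
      refine ⟨N, fun j hj => ?_⟩
      rw [← Equiv.Perm.mul_apply, ← zpow_add_one]
      exact hN _ (by lia)
    · rintro ⟨N, hN⟩
      refine ⟨e⁻¹ x, ⟨N + 1, fun j hj => ?_⟩, by simp⟩
      rw [← Equiv.Perm.mul_apply, ← zpow_sub_one]
      exact hN _ (by lia)
  set S' : Set α := {x | ∃ N : ℤ, ∀ j ≥ N, (e ^ j) x ∈ S} with hS'
  -- The points of an orbit lying between a given earlier point b' and a given later point b are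
  -- finite in number: if b is periodic the whole orbit is finite, and otherwise b is reached from
  -- b' in exactly one number of steps.
  have hT : ∀ b b' : α,
      {x : α | ∃ i i' : ℤ, 0 ≤ i ∧ 0 < i' ∧ (e ^ i) x = b ∧ (e ^ (-i')) x = b'}.Finite := by
    intro b b'
    by_cases hb : ∃ m : ℤ, 0 < m ∧ (e ^ m) b = b
    · obtain ⟨m, hm, hmb⟩ := hb
      refine ((Set.finite_Ico (0 : ℤ) m).image fun j => (e ^ j) b).subset ?_
      rintro x ⟨i, i', -, -, hx, -⟩
      refine ⟨(-i) % m, ⟨Int.emod_nonneg _ hm.ne', Int.emod_lt_of_pos _ hm⟩, ?_⟩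
      have h3 : (e ^ (-i)) b = x := by
        rw [← hx, ← Equiv.Perm.mul_apply, ← zpow_add]
        simp
      have h4 : (e ^ (-i)) b = (e ^ ((-i) % m)) b := by
        conv_lhs => rw [← Int.emod_add_mul_ediv (-i) m, zpow_add, Equiv.Perm.mul_apply,
          perm_zpow_eq_of_periodic e hmb]
      exact h4.symm.trans h3
    · push Not at hb
      have hs : ∀ s t : ℤ, (e ^ s) b' = b → (e ^ t) b' = b → s ≤ t := by
        intro s t hs ht
        by_contra! hlt
        refine hb (s - t) (by lia) ?_
        conv_lhs => rw [← ht]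
        rw [← Equiv.Perm.mul_apply, ← zpow_add, sub_add_cancel, hs]
      by_cases hs0 : ∃ s : ℤ, (e ^ s) b' = b
      · obtain ⟨s, hs0⟩ := hs0
        refine ((Set.finite_Icc (0 : ℤ) s).image fun j => (e ^ (-j)) b).subset ?_
        rintro x ⟨i, i', hi, hi', hx, hx'⟩
        refine ⟨i, ⟨hi, ?_⟩, ?_⟩
        · have := hs (i + i') s (by
            rw [← hx', ← Equiv.Perm.mul_apply, ← zpow_add, add_neg_cancel_right, hx]) hs0
          lia
        · simp only
          rw [← hx, ← Equiv.Perm.mul_apply, ← zpow_add]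
          simp
      · refine Set.finite_empty.subset ?_
        rintro x ⟨i, i', hi, hi', hx, hx'⟩
        exact hs0 ⟨i + i', by
          rw [← hx', ← Equiv.Perm.mul_apply, ← zpow_add, add_neg_cancel_right, hx]⟩
  -- A point where S and S' disagree has elements of B both ahead of it and behind it, so it lies on
  -- one of the finitely many finite segments of `hT`.
  have hfin : {x | ¬ (x ∈ S ↔ x ∈ S')}.Finite := by
    refine (hBfin.biUnion fun b _ => hBfin.biUnion fun b' _ => hT b b').subset ?_
    intro x hx
    simp only [Set.mem_ofPred_eq] at hx
    have hpos : ∃ i : ℤ, 0 ≤ i ∧ (e ^ i) x ∈ B := by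
      by_contra! h
      have hc : ∀ j ≥ (0 : ℤ), (x ∈ S ↔ (e ^ j) x ∈ S) := fun j hj => by
        simpa using hconst' x 0 j hj fun i hi _ => h i hi
      refine hx ⟨fun hxS => ⟨0, fun j hj => (hc j hj).1 hxS⟩, ?_⟩
      rintro ⟨N, hN⟩
      exact (hc _ (le_max_right N 0)).2 (hN _ (le_max_left N 0))
    -- Without a crossing in the past, membership in S is constant backwards. A disagreement with
    -- the future behaviour would then be one of the two transitions already excluded, or would
    -- contradict periodicity.
    have hneg : ∃ i : ℤ, 0 < i ∧ (e ^ (-i)) x ∈ B := by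
      by_contra! h
      have hc : ∀ j ≤ (0 : ℤ), (x ∈ S ↔ (e ^ j) x ∈ S) := fun j hj => by
        have := hconst' x j 0 hj fun i _ hi => by simpa using h (-i) (by lia)
        simpa using this.symm
      by_cases hxS : x ∈ S
      · have hxS' : x ∉ S' := fun h => hx ⟨fun _ => h, fun _ => hxS⟩
        rcases hper x with ⟨m, hm, hmx⟩ | hev | hev
        · refine hxS' ⟨0, fun j hj => ?_⟩
          have : (e ^ j) x = (e ^ (j + m * (-j))) x := by
            rw [zpow_add, Equiv.Perm.mul_apply, perm_zpow_eq_of_periodic e hmx]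
          rw [this]
          exact (hc _ (by nlinarith)).1 hxS
        · exact hxS' hev
        · exact hB ⟨x, hev, 0, fun j hj => (hc j hj).1 hxS⟩
      · have hxS' : x ∈ S' := by
          by_contra h
          exact hx ⟨fun h' => absurd h' hxS, fun h' => absurd h' h⟩
        exact hA ⟨x, hxS', 0, fun j hj hj' => hxS ((hc j hj).2 hj')⟩
    obtain ⟨i, hi, hiB⟩ := hpos
    obtain ⟨i', hi', hiB'⟩ := hneg
    exact Set.mem_biUnion hiB (Set.mem_biUnion hiB' ⟨i, i', hi, hi', rfl, rfl⟩)
  refine ⟨hfin.subset ?_, hfin.subset ?_, fun x ⟨N, hN⟩ => ⟨N, hN N le_rfl⟩⟩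
  · rintro x ⟨h, h'⟩
    simp only [Set.mem_ofPred_eq]
    tauto
  · rintro x ⟨h, h'⟩
    simp only [Set.mem_ofPred_eq]
    tauto

end Commensurated

end Cremona

end

/-! ### Transcendence degree of hypersurfaces -/

section

open Cardinal

namespace Cremona

section Transcendence

variable {k : Type u} [Field k] {d : ℕ}

local notation "A" => MvPolynomial (Fin d) k

/-- A prime quotient of a polynomial ring in `d` variables has transcendence degree less than `d`
if it is a proper quotient. -/
lemma trdeg_quotient_lt {q : MvPolynomial (Fin d) k} (hq : Prime q) :
    Algebra.trdeg k (A ⧸ Ideal.span {q}) < (d : Cardinal.{u}) := by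
  have : (Ideal.span {q}).IsPrime := (Ideal.span_singleton_prime hq.ne_zero).2 hq
  by_contra! h
  let y : Fin d → A ⧸ Ideal.span {q} := fun i => Ideal.Quotient.mk _ (MvPolynomial.X i)
  have hy : MvPolynomial.aeval y = Ideal.Quotient.mkₐ k (Ideal.span {q}) := by
    ext i; simp [y]
  have htop : Algebra.adjoin k (Set.range y) = ⊤ := by
    rw [Algebra.adjoin_range_eq_range_aeval, hy, AlgHom.range_eq_top]
    exact Ideal.Quotient.mkₐ_surjective _ _
  have halg : Algebra.IsAlgebraic (Algebra.adjoin k (Set.range y)) (A ⧸ Ideal.span {q}) := by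
    constructor
    intro x
    have hx : x ∈ Algebra.adjoin k (Set.range y) := htop ▸ Algebra.mem_top
    exact isAlgebraic_algebraMap (⟨x, hx⟩ : Algebra.adjoin k (Set.range y))
  -- If the transcendence degree were at least d, the d generators would be algebraically
  -- independent, but they satisfy the relation q = 0.
  have hbas := Algebra.IsAlgebraic.isTranscendenceBasis_of_lift_le_trdeg_of_finite k y
    (by simpa using h)
  have hinj := hbas.1
  rw [AlgebraicIndependent, hy] at hinj
  refine hq.ne_zero (hinj ?_)
  rw [map_zero]
  exact Ideal.Quotient.eq_zero_iff_mem.2 (Ideal.mem_span_singleton_self q)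

lemma exists_degreeOf_pos {p : MvPolynomial (Fin d) k} (hp : Prime p) :
    ∃ i, 0 < p.degreeOf i := by
  by_contra! h
  have h0 : p.totalDegree = 0 := by
    rw [MvPolynomial.totalDegree_eq_zero_iff]
    intro m hm i
    exact Nat.le_zero.1 ((MvPolynomial.le_degreeOf_of_mem_support i hm).trans (h i))
  rw [MvPolynomial.totalDegree_eq_zero_iff_eq_C] at h0
  refine hp.not_isUnit ?_
  rw [h0]
  refine (IsUnit.mk0 _ fun hc => hp.ne_zero ?_).map MvPolynomial.C
  rw [h0, hc, map_zero]

/-- A hypersurface has transcendence degree at least `d - 1`. -/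
lemma le_trdeg_fractionRing_quotient {p : MvPolynomial (Fin d) k} (hp : Prime p)
    [(Ideal.span {p}).IsPrime] :
    (d : Cardinal.{u}) ≤ Algebra.trdeg k (FractionRing (A ⧸ Ideal.span {p})) + 1 := by
  obtain ⟨i, hi⟩ := exists_degreeOf_pos hp
  -- The variables other than a variable xᵢ occurring in p stay independent modulo p, since a
  -- nonzero multiple of p has positive degree in xᵢ.
  let y : {j // j ≠ i} → FractionRing (A ⧸ Ideal.span {p}) := fun j =>
    algebraMap (A ⧸ Ideal.span {p}) _ (Ideal.Quotient.mk _ (MvPolynomial.X j.1))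
  have hy : AlgebraicIndependent k y := by
    rw [algebraicIndependent_iff]
    intro h hh
    have h1 : MvPolynomial.aeval y h = algebraMap (A ⧸ Ideal.span {p}) _
        (Ideal.Quotient.mk _ (MvPolynomial.rename Subtype.val h)) := by
      have : MvPolynomial.aeval y = (IsScalarTower.toAlgHom k (A ⧸ Ideal.span {p})
          (FractionRing (A ⧸ Ideal.span {p}))).comp ((Ideal.Quotient.mkₐ k _).comp
          (MvPolynomial.rename Subtype.val)) := by
        ext j; simp [y]
      rw [this]
      simp
    rw [h1, map_eq_zero_iff _ (IsFractionRing.injective _ _), Ideal.Quotient.eq_zero_iff_mem,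
      Ideal.mem_span_singleton] at hh
    obtain ⟨c, hc⟩ := hh
    by_contra h0
    have hr : MvPolynomial.rename Subtype.val h ≠ (0 : MvPolynomial (Fin d) k) := fun hr =>
      h0 (MvPolynomial.rename_injective _ Subtype.val_injective (by rw [hr, map_zero]))
    have hc0 : c ≠ 0 := by rintro rfl; simp at hc; exact h0 hc
    have h2 : (MvPolynomial.rename Subtype.val h).degreeOf i = 0 := by
      rw [← Nat.le_zero, MvPolynomial.degreeOf_le_iff]
      classical
      intro m hm
      rw [MvPolynomial.support_rename_of_injective Subtype.val_injective, Finset.mem_image] at hm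
      obtain ⟨m', -, rfl⟩ := hm
      exact (Finsupp.mapDomain_of_notMem_range _ _ (by simp)).le
    rw [hc, MvPolynomial.degreeOf_mul_eq hp.ne_zero hc0] at h2
    lia
  have := hy.lift_cardinalMk_le_trdeg
  have hcard : (#{j // j ≠ i}) + 1 = d := by
    have := Fintype.card_subtype_compl (fun j => j = i)
    rw [Cardinal.mk_fintype, this]
    simp only [Fintype.card_fin, Fintype.card_unique]
    have := i.pos
    norm_cast
    lia
  have h3 : lift.{u} (#{j // j ≠ i}) ≤ Algebra.trdeg k (FractionRing (A ⧸ Ideal.span {p})) := by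
    simpa using this
  have h4 : (d : Cardinal.{u}) = lift.{u} (#{j // j ≠ i}) + 1 := by
    have := congrArg lift.{u} hcard
    simpa using this.symm
  rw [h4]
  gcongr

/-- If a field `κ` of transcendence degree at least `d - 1` is algebraic over the image of
`k[y₁, …, y_d]`, then the kernel of `k[y₁, …, y_d] → κ` has height at most one. -/
lemma exists_ker_aeval_eq_span {κ : Type u} [Field κ] [Algebra k κ] (f : Fin d → κ)
    (hκ : (d : Cardinal.{u}) ≤ Algebra.trdeg k κ + 1)
    [Algebra.IsAlgebraic (Algebra.adjoin k (Set.range f)) κ]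
    {q : MvPolynomial (Fin d) k} (hq : Prime q) (hqf : MvPolynomial.aeval f q = 0) :
    RingHom.ker (MvPolynomial.aeval (R := k) f) = Ideal.span {q} := by
  have : (Ideal.span {q}).IsPrime := (Ideal.span_singleton_prime hq.ne_zero).2 hq
  let ψ : (A ⧸ Ideal.span {q}) →ₐ[k] κ := Ideal.Quotient.liftₐ (Ideal.span {q})
    (MvPolynomial.aeval f) (fun a ha => by
      obtain ⟨c, rfl⟩ := Ideal.mem_span_singleton.1 ha
      rw [map_mul, hqf, zero_mul])
  have hψ : ∀ a, ψ (Ideal.Quotient.mk _ a) = MvPolynomial.aeval f a := fun a => rfl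
  -- A transcendence basis of κ chosen among the f's lifts to variables in A/(q). The lifts are
  -- independent, and by the two degree bounds they already form a transcendence basis of A/(q).
  obtain ⟨t, hts, ht⟩ := exists_isTranscendenceBasis_subset (R := k) (Set.range f)
  choose s hs using fun x : t => hts x.2
  let y : t → A ⧸ Ideal.span {q} := fun x => Ideal.Quotient.mk _ (MvPolynomial.X (s x))
  have hy : ψ ∘ y = ((↑) : t → κ) := by
    ext x
    simp [y, hψ, hs]
  have hind : AlgebraicIndependent k y := AlgebraicIndependent.of_comp ψ (by rw [hy]; exact ht.1)
  have hle : Algebra.trdeg k (A ⧸ Ideal.span {q}) ≤ #t := by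
    rw [ht.cardinalMk_eq_trdeg, ← Cardinal.add_one_le_add_one_iff]
    refine le_trans ?_ hκ
    have hlt := trdeg_quotient_lt hq
    obtain ⟨n, hn⟩ := Cardinal.lt_aleph0.1 (hlt.trans Cardinal.natCast_lt_aleph0)
    rw [hn] at hlt ⊢
    have : n < d := by exact_mod_cast hlt
    exact_mod_cast this
  have hbas := hind.isTranscendenceBasis_of_trdeg_le ((trdeg_quotient_lt hq).trans
    (Cardinal.natCast_lt_aleph0)) hle
  have halg := hbas.isAlgebraic
  apply le_antisymm
  · intro h hh
    by_contra hne
    have hne' : Ideal.Quotient.mk (Ideal.span {q}) h ≠ 0 := fun h0 =>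
      hne (Ideal.Quotient.eq_zero_iff_mem.1 h0)
    -- By algebraicity a nonzero class h divides a nonzero polynomial in the lifted basis. If h died
    -- in κ, so would that polynomial, against the independence of the basis.
    obtain ⟨r, hr, hdvd⟩ := (halg.isAlgebraic (Ideal.Quotient.mk (Ideal.span {q}) h)).exists_nonzero_dvd
      (mem_nonZeroDivisors_of_ne_zero hne')
    have hr' : (r : A ⧸ Ideal.span {q}) ∈ (MvPolynomial.aeval (R := k) y).range := by
      rw [← Algebra.adjoin_range_eq_range_aeval]; exact r.2
    obtain ⟨P, hP⟩ := hr'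
    have hP0 : P ≠ 0 := by
      rintro rfl
      exact hr (Subtype.ext (by simpa using hP.symm))
    have h1 : MvPolynomial.aeval ((↑) : t → κ) P = 0 := by
      rw [← hy]
      have h2 : MvPolynomial.aeval (ψ ∘ y) P = ψ (MvPolynomial.aeval y P) := by
        rw [← AlgHom.comp_apply]
        congr 1
        ext i; simp
      obtain ⟨c, hc⟩ := hdvd
      have hP' : MvPolynomial.aeval y P = (r : A ⧸ Ideal.span {q}) := hP
      have hc' : (r : A ⧸ Ideal.span {q}) = Ideal.Quotient.mk (Ideal.span {q}) h * c := hc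
      rw [h2, hP', hc', map_mul, hψ]
      rw [RingHom.mem_ker] at hh
      rw [show (MvPolynomial.aeval f) h = 0 from hh, zero_mul]
    exact hP0 (ht.1 (by rw [map_zero]; exact h1))
  · rw [Ideal.span_singleton_le_iff_mem]
    exact hqf

end Transcendence

end Cremona

end

/-! ### Valuation rings attached to prime elements -/

section

open Cardinal

namespace Cremona

section LocalSubring

variable {A : Type*} [CommRing A] [IsDomain A] (K : Type*) [Field K] [Algebra A K]
  [IsFractionRing A K]

/-- The localization of a domain at a prime ideal, as a subring of the field of fractions. -/
def localSubring (P : Ideal A) [P.IsPrime] : Subring K :=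
  (Localization.subalgebra.ofField K P.primeCompl P.primeCompl_le_nonZeroDivisors).toSubring

variable {K}

lemma mem_localSubring {P : Ideal A} [P.IsPrime] {z : K} :
    z ∈ localSubring K P ↔ ∃ a b, b ∉ P ∧ z = algebraMap A K a / algebraMap A K b := by
  change (∃ (a s : A) (_ : s ∈ P.primeCompl), _) ↔ _
  simp [div_eq_mul_inv, Ideal.mem_primeCompl_iff]

variable (K) in
/-- The discrete valuation ring of the field of fractions attached to a prime element. -/
def primeRing (p : A) (hp : Prime p) : Subring K :=
  have : (Ideal.span {p}).IsPrime := (Ideal.span_singleton_prime hp.ne_zero).2 hp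
  localSubring K (Ideal.span {p})

lemma mem_primeRing {p : A} {hp : Prime p} {z : K} :
    z ∈ primeRing K p hp ↔ ∃ a b, ¬ p ∣ b ∧ z = algebraMap A K a / algebraMap A K b := by
  have : (Ideal.span {p}).IsPrime := (Ideal.span_singleton_prime hp.ne_zero).2 hp
  rw [primeRing, mem_localSubring]
  simp [Ideal.mem_span_singleton]

lemma div_mem_primeRing {p : A} (hp : Prime p) (a : A) {b : A} (hb : ¬ p ∣ b) :
    algebraMap A K a / algebraMap A K b ∈ primeRing K p hp := mem_primeRing.2 ⟨a, b, hb, rfl⟩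

lemma algebraMap_mem_primeRing {p : A} (hp : Prime p) (a : A) :
    algebraMap A K a ∈ primeRing K p hp := by
  have := div_mem_primeRing (K := K) hp a (b := 1) (fun h => hp.not_isUnit (isUnit_of_dvd_one h))
  simpa using this

lemma algebraMap_ne_zero' {a : A} (ha : a ≠ 0) : algebraMap A K a ≠ 0 :=
  (map_ne_zero_iff _ (IsFractionRing.injective A K)).2 ha

lemma inv_notMem_primeRing {p : A} (hp : Prime p) :
    (algebraMap A K p)⁻¹ ∉ primeRing K p hp := by
  rw [mem_primeRing]
  rintro ⟨a, b, hb, h⟩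
  have hb0 : b ≠ 0 := by rintro rfl; simp at hb
  rw [eq_div_iff (algebraMap_ne_zero' hb0), inv_mul_eq_iff_eq_mul₀
    (algebraMap_ne_zero' hp.ne_zero), ← map_mul] at h
  exact hb ⟨a, IsFractionRing.injective A K h⟩

lemma primeRing_ne_top {p : A} (hp : Prime p) : primeRing K p hp ≠ ⊤ := fun h =>
  inv_notMem_primeRing (K := K) hp (h ▸ Subring.mem_top _)

variable [WfDvdMonoid A]

/-- Every nonzero element of the field of fractions is a power of `p` times a unit. -/
lemma exists_eq_pow_mul_unit {p : A} (hp : Prime p) {z : K} (hz : z ≠ 0) :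
    ∃ (i j : ℕ) (a b : A), ¬ p ∣ a ∧ ¬ p ∣ b ∧
      z = algebraMap A K p ^ i / algebraMap A K p ^ j * (algebraMap A K a / algebraMap A K b) := by
  obtain ⟨x, y, hy, rfl⟩ := IsFractionRing.div_surjective (A := A) z
  have hy0 : y ≠ 0 := nonZeroDivisors.ne_zero hy
  have hx0 : x ≠ 0 := by rintro rfl; simp at hz
  obtain ⟨i, a, ha, rfl⟩ := WfDvdMonoid.max_power_factor hx0 hp.irreducible
  obtain ⟨j, b, hb, rfl⟩ := WfDvdMonoid.max_power_factor hy0 hp.irreducible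
  refine ⟨i, j, a, b, ha, hb, ?_⟩
  rw [map_mul, map_mul, map_pow, map_pow, mul_div_mul_comm]

lemma mem_or_inv_mem_primeRing {p : A} (hp : Prime p) (z : K) :
    z ∈ primeRing K p hp ∨ z⁻¹ ∈ primeRing K p hp := by
  rcases eq_or_ne z 0 with rfl | hz
  · exact Or.inl (zero_mem _)
  obtain ⟨i, j, a, b, ha, hb, rfl⟩ := exists_eq_pow_mul_unit hp hz
  have hp0 := algebraMap_ne_zero' (K := K) hp.ne_zero
  have hpow : ∀ n, algebraMap A K p ^ n ∈ primeRing K p hp := fun n =>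
    pow_mem (algebraMap_mem_primeRing hp p) n
  rcases le_total j i with h | h
  · left
    rw [div_eq_mul_inv (algebraMap A K p ^ i), ← pow_sub₀ _ hp0 h]
    exact mul_mem (hpow _) (div_mem_primeRing hp a hb)
  · right
    rw [mul_inv, inv_div, inv_div, div_eq_mul_inv (algebraMap A K p ^ j), ← pow_sub₀ _ hp0 h]
    exact mul_mem (hpow _) (div_mem_primeRing hp b ha)

/-- A discrete valuation ring is a maximal proper subring. -/
lemma eq_of_primeRing_le {p : A} (hp : Prime p) {T : Subring K} (hT : primeRing K p hp ≤ T)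
    (hT' : T ≠ ⊤) : T = primeRing K p hp := by
  refine le_antisymm (fun z hz => ?_) hT
  by_contra hzn
  refine hT' (eq_top_iff.2 fun w _ => ?_)
  have hp0 := algebraMap_ne_zero' (K := K) hp.ne_zero
  -- An element outside the valuation ring is a unit times a negative power of p, so T contains p⁻¹
  -- and with it all of K.
  have hinv : (algebraMap A K p)⁻¹ ∈ T := by
    rcases eq_or_ne z 0 with rfl | hz0
    · exact absurd (zero_mem _) hzn
    obtain ⟨i, j, a, b, ha, hb, rfl⟩ := exists_eq_pow_mul_unit hp hz0
    have hpow : ∀ n, algebraMap A K p ^ n ∈ primeRing K p hp := fun n =>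
      pow_mem (algebraMap_mem_primeRing hp p) n
    have hij : i < j := by
      by_contra! h
      refine hzn ?_
      rw [div_eq_mul_inv (algebraMap A K p ^ i), ← pow_sub₀ _ hp0 h]
      exact mul_mem (hpow _) (div_mem_primeRing hp a hb)
    have h1 : (algebraMap A K p)⁻¹ = (algebraMap A K p ^ i / algebraMap A K p ^ j *
        (algebraMap A K a / algebraMap A K b)) * ((algebraMap A K b / algebraMap A K a) *
        algebraMap A K p ^ (j - i - 1)) := by
      have ha0 := algebraMap_ne_zero' (K := K) (a := a) (by rintro rfl; simp at ha)
      have hb0 := algebraMap_ne_zero' (K := K) (a := b) (by rintro rfl; simp at hb)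
      obtain ⟨m, rfl⟩ : ∃ m, j = i + m + 1 := ⟨j - i - 1, by lia⟩
      rw [show i + m + 1 - i - 1 = m by lia]
      field_simp
      ring
    rw [h1]
    exact mul_mem hz (mul_mem (hT (div_mem_primeRing hp b ha)) (hT (hpow _)))
  rcases eq_or_ne w 0 with rfl | hw0
  · exact zero_mem _
  obtain ⟨i, j, a, b, ha, hb, rfl⟩ := exists_eq_pow_mul_unit hp hw0
  rw [div_eq_mul_inv, ← inv_pow]
  exact mul_mem (mul_mem (pow_mem (hT (algebraMap_mem_primeRing hp p)) _) (pow_mem hinv _))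
    (hT (div_mem_primeRing hp a hb))

lemma primeRing_eq_of_associated {p q : A} (hp : Prime p) (hq : Prime q) (h : Associated p q) :
    primeRing K p hp = primeRing K q hq := by
  ext z
  simp only [mem_primeRing, h.dvd_iff_dvd_left]

variable (A K) in
/-- The set of discrete valuation rings of `K` attached to the prime elements of `A`. -/
def primeRings : Set (Subring K) := Set.range fun p : {p : A // Prime p} => primeRing K p.1 p.2

end LocalSubring

end Cremona

end

/-! ### The Jacobian criterion -/

section

open Cardinal

namespace Cremona

section Jacobian

variable {k : Type u} [Field k] {d : ℕ}

/-- The Jacobian determinant of a rational map `[a₀ : … : a_d]` in affine coordinates: the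
determinant of the matrix with rows `(a_r, ∂₁ a_r, …, ∂_d a_r)`. -/
def jacobian (a : Fin (d + 1) → MvPolynomial (Fin d) k) : MvPolynomial (Fin d) k :=
  Matrix.det (Matrix.of fun r c : Fin (d + 1) =>
    (Fin.cons (a r) (fun j => MvPolynomial.pderiv j (a r)) : Fin (d + 1) → _) c)

lemma derivation_algebraMap_eq_sum {κ M : Type*} [CommRing κ] [Algebra k κ]
    [Algebra (MvPolynomial (Fin d) k) κ] [IsScalarTower k (MvPolynomial (Fin d) k) κ]
    [AddCommGroup M] [Module k M] [Module κ M] (D : Derivation k κ M)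
    (p : MvPolynomial (Fin d) k) :
    D (algebraMap _ κ p) =
      ∑ j, algebraMap _ κ (MvPolynomial.pderiv j p) • D (algebraMap (MvPolynomial (Fin d) k) κ (MvPolynomial.X j)) := by
  induction p using MvPolynomial.induction_on with
  | C r =>
    rw [← MvPolynomial.algebraMap_eq, ← IsScalarTower.algebraMap_apply, D.map_algebraMap]
    simp [MvPolynomial.algebraMap_eq]
  | add p q hp hq => simp only [map_add, add_smul, Finset.sum_add_distrib, hp, hq]
  | mul_X p i hp =>
    classical
    rw [map_mul, Derivation.leibniz, hp]
    simp only [MvPolynomial.pderiv_mul, map_add, map_mul, add_smul, Finset.sum_add_distrib,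
      Finset.smul_sum, MvPolynomial.pderiv_X, Pi.single_apply]
    rw [add_comm]
    congr 1
    · refine Finset.sum_congr rfl fun j _ => ?_
      rw [smul_smul, mul_comm]
    · rw [Finset.sum_eq_single i]
      · simp
      · intro j _ hj
        simp [hj.symm]
      · simp

lemma eq_zero_of_det_ne_zero {κ V n : Type*} [Field κ] [AddCommGroup V] [Module κ V] [Fintype n]
    [DecidableEq n] {M : Matrix n n κ} (hM : M.det ≠ 0) {w : n → V}
    (h : ∀ r, ∑ c, M r c • w c = 0) : w = 0 := by
  ext c'
  have h1 : ∑ r, M⁻¹ c' r • ∑ c, M r c • w c = w c' := by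
    simp only [Finset.smul_sum, smul_smul]
    rw [Finset.sum_comm]
    simp only [← Finset.sum_smul]
    have h2 : ∀ c, ∑ r, M⁻¹ c' r * M r c = (1 : Matrix n n κ) c' c := fun c => by
      rw [← Matrix.nonsing_inv_mul M (Ne.isUnit hM), Matrix.mul_apply]
    simp [h2, Matrix.one_apply]
  rw [← h1]
  simp [h]

lemma jacobian_map {κ : Type*} [CommRing κ] [Algebra (MvPolynomial (Fin d) k) κ]
    (a : Fin (d + 1) → MvPolynomial (Fin d) k) :
    algebraMap _ κ (jacobian a) = Matrix.det (Matrix.of fun r c : Fin (d + 1) =>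
      (Fin.cons (algebraMap _ κ (a r)) (fun j => algebraMap _ κ (MvPolynomial.pderiv j (a r))) :
        Fin (d + 1) → κ) c) := by
  rw [jacobian, RingHom.map_det]
  congr 1
  ext r c
  refine Fin.cases ?_ (fun j => ?_) c <;> simp

/-- If the Jacobian of `[a₀ : … : a_d]` does not vanish in `κ`, then `κ` is algebraic over the
subalgebra generated by the ratios `a_i / a₀`. -/
lemma isAlgebraic_of_jacobian_ne_zero {κ : Type u} [Field κ] [Algebra k κ]
    [Algebra (MvPolynomial (Fin d) k) κ] [IsScalarTower k (MvPolynomial (Fin d) k) κ]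
    [Algebra.EssFiniteType k κ] (hgen : ∀ z : κ, ∃ x y : MvPolynomial (Fin d) k, algebraMap _ κ y ≠ 0 ∧
      z * algebraMap _ κ y = algebraMap _ κ x)
    (a : Fin (d + 1) → MvPolynomial (Fin d) k) (h0 : algebraMap _ κ (a 0) ≠ 0)
    (hJ : algebraMap _ κ (jacobian a) ≠ 0) (f : Fin d → κ)
    (hf : ∀ i, f i * algebraMap _ κ (a 0) = algebraMap _ κ (a i.succ)) :
    Algebra.IsAlgebraic (Algebra.adjoin k (Set.range f)) κ := by
  let M := IntermediateField.adjoin k (Set.range f)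
  have hfM : ∀ i, f i ∈ M := fun i => IntermediateField.subset_adjoin k _ ⟨i, rfl⟩
  let D : Derivation k κ (Ω[κ⁄M]) := (KaehlerDifferential.D M κ).restrictScalars k
  have hDM : ∀ z ∈ M, D z = 0 := fun z hz =>
    (KaehlerDifferential.D M κ).map_algebraMap (⟨z, hz⟩ : M)
  have hDa := derivation_algebraMap_eq_sum (d := d) D
  set b := algebraMap _ κ (a 0) with hb
  -- D kills each ratio fᵢ = aᵢ/a₀, so D aᵣ = aᵣ · (D a₀ / a₀) for every r. Expanding D aᵣ by the
  -- chain rule, this says that the Jacobian matrix annihilates w.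
  let w : Fin (d + 1) → Ω[κ⁄M] :=
    Fin.cons (-(b⁻¹ • D b)) fun j => D (algebraMap (MvPolynomial (Fin d) k) κ (MvPolynomial.X j))
  have hw : w = 0 := by
    rw [jacobian_map] at hJ
    refine eq_zero_of_det_ne_zero hJ fun r => ?_
    rw [Fin.sum_univ_succ]
    simp only [Matrix.of_apply, Fin.cons_zero, Fin.cons_succ, w]
    rw [← hDa]
    refine Fin.cases ?_ (fun i => ?_) r
    · rw [← hb, smul_neg, smul_smul, mul_inv_cancel₀ h0, one_smul, neg_add_cancel]
    · rw [← hf i, Derivation.leibniz, hDM _ (hfM i), smul_zero, add_zero, smul_neg, smul_smul,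
        mul_assoc, mul_inv_cancel₀ h0, mul_one, neg_add_cancel]
  have hDX : ∀ j, D (algebraMap (MvPolynomial (Fin d) k) κ (MvPolynomial.X j)) = 0 := fun j => congrFun hw j.succ
  have hDp : ∀ p : MvPolynomial (Fin d) k, D (algebraMap _ κ p) = 0 := fun p => by
    rw [hDa]; simp [hDX]
  have hD : ∀ z : κ, KaehlerDifferential.D M κ z = 0 := fun z => by
    obtain ⟨x, y, hy, hz⟩ := hgen z
    have h1 := congrArg D hz
    rw [Derivation.leibniz, hDp, hDp, smul_zero, zero_add] at h1
    exact (smul_eq_zero.1 h1).resolve_left hy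
  have hsub : Subsingleton (Ω[κ⁄M]) := by
    have := KaehlerDifferential.span_range_derivation M κ
    have h2 : Set.range (KaehlerDifferential.D M κ) ⊆ {0} := by
      rintro _ ⟨z, rfl⟩
      exact hD z
    have h3 := Submodule.span_mono (R := κ) h2
    rw [this, Submodule.span_zero_singleton] at h3
    exact (Submodule.subsingleton_iff κ).1 (subsingleton_of_top_le_bot h3) |> fun h => h
  -- Vanishing differentials together with essential finiteness make κ separable algebraic over M,
  -- in every characteristic.
  have hunr : Algebra.FormallyUnramified M κ := ⟨hsub⟩
  have hess' : Algebra.EssFiniteType M κ := Algebra.EssFiniteType.of_comp k M κ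
  have hsep := Algebra.FormallyUnramified.isSeparable M κ
  have halg : Algebra.IsAlgebraic M κ := inferInstance
  open IntermediateField.algebraAdjoinAdjoin in
  exact (IsFractionRing.comap_isAlgebraic_iff (A := Algebra.adjoin k (Set.range f))
    (K := M) (C := κ)).2 halg

end Jacobian

end Cremona

end

/-! ### Divisors that are not contracted -/

section

open Cardinal

namespace Cremona

section Contracted

variable {k : Type u} [Field k] {d : ℕ} {K : Type u} [Field K] [Algebra (MvPolynomial (Fin d) k) K]
  [IsFractionRing (MvPolynomial (Fin d) k) K] [Algebra k K]
  [IsScalarTower k (MvPolynomial (Fin d) k) K]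

local notation "𝔸" => MvPolynomial (Fin d) k

/-- The birational map attached to the automorphism `σ` of the field of rational functions is
given by `[a₀ : … : a_d]`. -/
def IsGivenBy (σ : K ≃ₐ[k] K) (a : Fin (d + 1) → MvPolynomial (Fin d) k) : Prop :=
  a 0 ≠ 0 ∧ ∀ i : Fin d,
    σ (algebraMap (MvPolynomial (Fin d) k) K (MvPolynomial.X i)) *
      algebraMap (MvPolynomial (Fin d) k) K (a 0) = algebraMap _ K (a i.succ)

/-- The image of a subring under a field automorphism. -/
abbrev mapSubring (σ : K ≃ₐ[k] K) (R : Subring K) : Subring K := R.map (σ : K →+* K)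

/-- A prime divisor in the complement of `{a₀ = 0}` at which the Jacobian of `[a₀ : … : a_d]` does
not vanish is not contracted. -/
theorem exists_mapSubring_primeRing_eq {σ : K ≃ₐ[k] K} {a : Fin (d + 1) → 𝔸}
    (hσ : IsGivenBy σ a) {p : 𝔸} (hp : Prime p) (h0 : ¬ p ∣ a 0) (hJ : ¬ p ∣ jacobian a) :
    ∃ (q : 𝔸) (hq : Prime q), mapSubring σ (primeRing K q hq) = primeRing K p hp := by
  have hP : (Ideal.span {p}).IsPrime := (Ideal.span_singleton_prime hp.ne_zero).2 hp
  set P : Ideal 𝔸 := Ideal.span {p} with hPdef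
  have hmemP : ∀ x : 𝔸, x ∈ P ↔ p ∣ x := fun x => Ideal.mem_span_singleton
  let L := Localization.AtPrime P
  let κ := FractionRing (𝔸 ⧸ P)
  have hker : ∀ x : 𝔸, algebraMap 𝔸 κ x = 0 ↔ p ∣ x := fun x => by
    rw [IsScalarTower.algebraMap_apply 𝔸 (𝔸 ⧸ P) κ, map_eq_zero_iff _ (IsFractionRing.injective _ _),
      Ideal.Quotient.algebraMap_eq, Ideal.Quotient.eq_zero_iff_mem, hmemP]
  let s0 : P.primeCompl := ⟨a 0, fun h => h0 ((hmemP _).1 h)⟩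
  -- Since p does not divide a₀, the substitution xᵢ ↦ aᵢ/a₀ takes values in the local ring L at p.
  -- `lam` embeds L in K, where φ becomes σ, and π reduces L to the residue field κ of the divisor.
  let φ : 𝔸 →ₐ[k] L := MvPolynomial.aeval fun i => IsLocalization.mk' L (a i.succ) s0
  let lam : L →+* K := IsLocalization.lift (M := P.primeCompl) (g := algebraMap 𝔸 K) fun y =>
    (algebraMap_ne_zero' fun h : (y : 𝔸) = 0 => y.2 (h ▸ zero_mem P)).isUnit
  let π : L →+* κ := IsLocalization.lift (M := P.primeCompl) (g := algebraMap 𝔸 κ) fun y =>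
    IsUnit.mk0 _ fun h => y.2 ((hmemP _).2 ((hker _).1 h))
  have hlam : ∀ (x : 𝔸) (y : P.primeCompl), lam (IsLocalization.mk' L x y) =
      algebraMap 𝔸 K x / algebraMap 𝔸 K y := fun x y => by
    have hy0 : algebraMap 𝔸 K y ≠ 0 := algebraMap_ne_zero' fun h => y.2 (h ▸ zero_mem P)
    rw [eq_div_iff hy0]
    have h1 := congrArg lam (IsLocalization.mk'_spec L x y)
    rw [map_mul, IsLocalization.lift_eq, IsLocalization.lift_eq] at h1
    exact h1
  have hlamφ : ∀ x, lam (φ x) = σ (algebraMap 𝔸 K x) := by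
    have : lam.comp (φ : 𝔸 →+* L) = (σ : K →+* K).comp (algebraMap 𝔸 K) := by
      apply MvPolynomial.ringHom_ext
      · intro r
        simp only [RingHom.comp_apply, RingHom.coe_coe]
        rw [← MvPolynomial.algebraMap_eq, AlgHom.commutes, ← IsScalarTower.algebraMap_apply k 𝔸 K,
          AlgEquiv.commutes, IsScalarTower.algebraMap_apply k 𝔸 L, IsLocalization.lift_eq,
          ← IsScalarTower.algebraMap_apply k 𝔸 K]
      · intro i
        simp only [RingHom.comp_apply, RingHom.coe_coe, φ, MvPolynomial.aeval_X]
        rw [hlam, eq_comm, eq_div_iff (algebraMap_ne_zero' hσ.1)]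
        exact hσ.2 i
    exact fun x => congrArg (fun f => f x) this
  have hlam_mem : ∀ z, lam z ∈ primeRing K p hp := fun z => by
    obtain ⟨⟨x, y⟩, rfl⟩ := IsLocalization.mk'_surjective P.primeCompl z
    rw [hlam]
    exact div_mem_primeRing hp x fun h => y.2 ((hmemP _).2 h)
  have hunit : ∀ z, π z ≠ 0 → IsUnit z := fun z hz => by
    obtain ⟨⟨x, y⟩, rfl⟩ := IsLocalization.mk'_surjective P.primeCompl z
    rw [IsLocalization.AtPrime.isUnit_mk'_iff L P]
    intro hx
    refine hz ?_
    have h1 := congrArg π (IsLocalization.mk'_spec L x y)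
    rw [map_mul, IsLocalization.lift_eq, IsLocalization.lift_eq, (hker x).2 ((hmemP x).1 hx)] at h1
    exact (mul_eq_zero.1 h1).resolve_right fun h => y.2 ((hmemP _).2 ((hker _).1 h))
  let f : Fin d → κ := fun i => π (IsLocalization.mk' L (a i.succ) s0)
  have hf : ∀ i, f i * algebraMap 𝔸 κ (a 0) = algebraMap 𝔸 κ (a i.succ) := fun i => by
    have h1 := congrArg π (IsLocalization.mk'_spec L (a i.succ) s0)
    rw [map_mul, IsLocalization.lift_eq, IsLocalization.lift_eq] at h1
    exact h1
  have hψ : ∀ x, MvPolynomial.aeval f x = π (φ x) := by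
    have : (MvPolynomial.aeval (R := k) f : 𝔸 →+* κ) = π.comp (φ : 𝔸 →+* L) := by
      apply MvPolynomial.ringHom_ext
      · intro r
        simp only [RingHom.comp_apply, RingHom.coe_coe]
        rw [← MvPolynomial.algebraMap_eq, AlgHom.commutes, AlgHom.commutes,
          IsScalarTower.algebraMap_apply k 𝔸 L, IsLocalization.lift_eq,
          ← IsScalarTower.algebraMap_apply k 𝔸 κ]
      · intro i
        simp [φ, f]
    exact fun x => congrArg (fun f => f x) this
  have halg : Algebra.IsAlgebraic (Algebra.adjoin k (Set.range f)) κ := by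
    refine isAlgebraic_of_jacobian_ne_zero (d := d) (fun z => ?_) a
      (fun h => h0 ((hker _).1 h)) (fun h => hJ ((hker _).1 h)) f hf
    obtain ⟨x, y, hy, rfl⟩ := IsFractionRing.div_surjective (A := 𝔸 ⧸ P) z
    obtain ⟨x, rfl⟩ := Ideal.Quotient.mk_surjective x
    obtain ⟨y, rfl⟩ := Ideal.Quotient.mk_surjective y
    have hy' : algebraMap (𝔸 ⧸ P) κ (Ideal.Quotient.mk P y) ≠ 0 :=
      algebraMap_ne_zero' (nonZeroDivisors.ne_zero hy)
    exact ⟨x, y, hy', div_mul_cancel₀ _ hy'⟩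
  have hdiv : ∀ x y : 𝔸, MvPolynomial.aeval f y ≠ 0 →
      σ (algebraMap 𝔸 K x / algebraMap 𝔸 K y) ∈ primeRing K p hp := fun x y hy => by
    have hy0 : y ≠ 0 := by rintro rfl; simp at hy
    obtain ⟨c, hc⟩ := hunit (φ y) (by rwa [← hψ])
    have h1 : σ (algebraMap 𝔸 K x / algebraMap 𝔸 K y) = lam (φ x * ↑c⁻¹) := by
      have h2 : lam (φ x * ↑c⁻¹) * σ (algebraMap 𝔸 K y) = σ (algebraMap 𝔸 K x) := by
        rw [← hlamφ, ← map_mul, mul_assoc, ← hc, Units.inv_mul, mul_one, hlamφ]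
      have h3 : σ (algebraMap 𝔸 K y) ≠ 0 := by
        rw [Ne, map_eq_zero]; exact algebraMap_ne_zero' hy0
      rw [eq_div_of_mul_eq h3 h2, map_div₀]
    rw [h1]
    exact hlam_mem _
  -- If A embedded into κ, every nonzero polynomial would become a unit of L, and σ(K) = K would be
  -- contained in the valuation ring of p.
  have hker_ne : RingHom.ker (MvPolynomial.aeval (R := k) f) ≠ ⊥ := by
    intro hbot
    refine primeRing_ne_top (K := K) hp (eq_top_iff.2 fun z _ => ?_)
    obtain ⟨x, y, hy, hz⟩ := IsFractionRing.div_surjective (A := 𝔸) (σ.symm z)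
    rw [← AlgEquiv.apply_symm_apply σ z, ← hz]
    refine hdiv x y fun h => nonZeroDivisors.ne_zero hy ?_
    have h1 : y ∈ RingHom.ker (MvPolynomial.aeval (R := k) f) := h
    rw [hbot] at h1
    exact (Ideal.mem_bot).1 h1
  have hkp : (RingHom.ker (MvPolynomial.aeval (R := k) f)).IsPrime := RingHom.ker_isPrime _
  obtain ⟨q, hqmem, hq⟩ := hkp.exists_mem_prime_of_ne_bot hker_ne
  -- The kernel is the ideal of the image of the divisor p. As κ is algebraic over the image
  -- function field, the image is again a hypersurface q = 0.
  have hkq := exists_ker_aeval_eq_span f (le_trdeg_fractionRing_quotient hp) hq hqmem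
  refine ⟨q, hq, ?_⟩
  have hle : primeRing K q hq ≤ (primeRing K p hp).comap (σ : K →+* K) := by
    intro z hz
    obtain ⟨x, y, hy, rfl⟩ := mem_primeRing.1 hz
    refine hdiv x y fun h => hy ?_
    have h1 : y ∈ RingHom.ker (MvPolynomial.aeval (R := k) f) := h
    rwa [hkq, Ideal.mem_span_singleton] at h1
  have hne : (primeRing K p hp).comap (σ : K →+* K) ≠ ⊤ := by
    intro htop
    refine primeRing_ne_top (K := K) hp (eq_top_iff.2 fun z _ => ?_)
    have h1 : σ.symm z ∈ (primeRing K p hp).comap (σ : K →+* K) := htop ▸ Subring.mem_top _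
    simpa using h1
  -- The inclusion of σ(A_(q)) in A_(p) is an equality because discrete valuation rings are maximal
  -- proper subrings.
  have heq := eq_of_primeRing_le hq hle hne
  rw [← heq]
  ext z
  simp only [Subring.mem_map, Subring.mem_comap]
  exact ⟨fun ⟨w, hw, hwz⟩ => hwz ▸ hw, fun hz => ⟨σ.symm z, by simpa using hz, by simp⟩⟩

/-- The Jacobian of a birational map does not vanish identically. -/
lemma jacobian_ne_zero {σ : K ≃ₐ[k] K} {a : Fin (d + 1) → 𝔸} (hσ : IsGivenBy σ a) :
    jacobian a ≠ 0 := by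
  intro h
  have h0 : algebraMap 𝔸 K (jacobian a) = 0 := by rw [h, map_zero]
  rw [jacobian_map, ← Matrix.exists_mulVec_eq_zero_iff] at h0
  obtain ⟨v, hv, hv0⟩ := h0
  have hv1 : ∀ r, v 0 * algebraMap 𝔸 K (a r) +
      ∑ j : Fin d, v j.succ * algebraMap 𝔸 K (MvPolynomial.pderiv j (a r)) = 0 := fun r => by
    have := congrFun hv0 r
    simp only [Matrix.mulVec, dotProduct, Fin.sum_univ_succ, Matrix.of_apply, Fin.cons_zero,
      Fin.cons_succ, Pi.zero_apply] at this
    simpa only [mul_comm] using this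
  -- A kernel vector v of the Jacobian matrix is read as a tangent direction, moving xⱼ to xⱼ + vⱼε.
  let θ₀ : 𝔸 →ₐ[k] DualNumber K := MvPolynomial.aeval fun j =>
    TrivSqZeroExt.inl (algebraMap 𝔸 K (MvPolynomial.X j)) + TrivSqZeroExt.inr (v j.succ)
  have hθ₀ : ∀ p, θ₀ p = TrivSqZeroExt.inl (algebraMap 𝔸 K p) + TrivSqZeroExt.inr
      (∑ j : Fin d, v j.succ * algebraMap 𝔸 K (MvPolynomial.pderiv j p)) := fun p => by
    induction p using MvPolynomial.induction_on with
    | C r =>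
      rw [← MvPolynomial.algebraMap_eq, AlgHom.commutes, ← IsScalarTower.algebraMap_apply k 𝔸 K]
      simp [MvPolynomial.algebraMap_eq, TrivSqZeroExt.algebraMap_eq_inl']
    | add p q hp hq =>
      rw [map_add, hp, hq]
      ext
      · simp
      · simp [mul_add, Finset.sum_add_distrib]
    | mul_X p i hp =>
      classical
      have hsum : ∑ j : Fin d, v j.succ * algebraMap 𝔸 K (MvPolynomial.pderiv j
          (p * MvPolynomial.X i)) = (∑ j : Fin d, v j.succ * algebraMap 𝔸 K
          (MvPolynomial.pderiv j p)) * algebraMap 𝔸 K (MvPolynomial.X i) +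
          algebraMap 𝔸 K p * v i.succ := by
        simp only [MvPolynomial.pderiv_mul, map_add, map_mul, mul_add, Finset.sum_add_distrib,
          Finset.sum_mul, mul_assoc]
        congr 1
        rw [Finset.sum_eq_single i]
        · simp [mul_comm]
        · intro j _ hj
          rw [MvPolynomial.pderiv_X_of_ne hj.symm]
          simp
        · simp
      rw [map_mul, hp, MvPolynomial.aeval_X, hsum]
      ext
      · simp
      · simp
        ring
  have hunit : ∀ x : DualNumber K, TrivSqZeroExt.fst x ≠ 0 → IsUnit x := fun x hx =>
    TrivSqZeroExt.isUnit_iff_isUnit_fst.2 (IsUnit.mk0 _ hx)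
  have hfst₀ : ∀ p, TrivSqZeroExt.fst (θ₀ p) = algebraMap 𝔸 K p := fun p => by simp [hθ₀]
  let θ : K →+* DualNumber K := IsLocalization.lift (M := nonZeroDivisors 𝔸) (g := (θ₀ : 𝔸 →+* _))
    fun y => hunit _ (by
      rw [RingHom.coe_coe, hfst₀]
      exact algebraMap_ne_zero' (nonZeroDivisors.ne_zero y.2))
  have hθ : ∀ p, θ (algebraMap 𝔸 K p) = θ₀ p := fun p => IsLocalization.lift_eq _ p
  -- All aᵣ are scaled by the same factor 1 − v₀ε, so θ fixes their ratios, in particular every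
  -- σ(xᵢ). As σ is surjective, θ is the constant embedding and v vanishes.
  have hθa : ∀ r, θ (algebraMap 𝔸 K (a r)) =
      TrivSqZeroExt.inl (algebraMap 𝔸 K (a r)) * (1 - TrivSqZeroExt.inr (v 0)) := fun r => by
    rw [hθ, hθ₀, eq_neg_of_add_eq_zero_right (hv1 r), mul_sub, mul_one,
      TrivSqZeroExt.inl_mul_inr, sub_eq_add_neg, TrivSqZeroExt.inr_neg, smul_eq_mul, mul_comm]
  have hu : IsUnit (TrivSqZeroExt.inl (algebraMap 𝔸 K (a 0)) *
      (1 - TrivSqZeroExt.inr (v 0)) : DualNumber K) := hunit _ (by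
    simpa using hσ.1)
  have hcomp : θ.comp (σ : K →+* K) =
      (TrivSqZeroExt.inlHom K K : K →+* DualNumber K).comp (σ : K →+* K) := by
    apply IsLocalization.ringHom_ext (nonZeroDivisors 𝔸)
    apply MvPolynomial.ringHom_ext
    · intro r
      simp only [RingHom.comp_apply, RingHom.coe_coe]
      rw [← MvPolynomial.algebraMap_eq, ← IsScalarTower.algebraMap_apply k 𝔸 K, AlgEquiv.commutes,
        IsScalarTower.algebraMap_apply k 𝔸 K, hθ, AlgHom.commutes,
        ← IsScalarTower.algebraMap_apply k 𝔸 K]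
      simp [TrivSqZeroExt.algebraMap_eq_inl']
    · intro i
      simp only [RingHom.comp_apply, RingHom.coe_coe]
      apply hu.mul_right_cancel
      rw [← hθa 0, ← map_mul, hσ.2, hθa, hθa, ← hσ.2]
      simp [TrivSqZeroExt.inl_mul, mul_assoc]
  have hθinl : ∀ z, θ z = TrivSqZeroExt.inl z := fun z => by
    have := congrArg (fun f => f (σ.symm z)) hcomp
    simpa using this
  have hvs : ∀ j : Fin d, v j.succ = 0 := fun j => by
    have h1 := hθinl (algebraMap 𝔸 K (MvPolynomial.X j))
    rw [hθ, MvPolynomial.aeval_X] at h1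
    simpa using congrArg TrivSqZeroExt.snd h1
  have hv00 : v 0 = 0 := by
    have h1 := hv1 0
    simp only [hvs, zero_mul, Finset.sum_const_zero, add_zero] at h1
    exact (mul_eq_zero.1 h1).resolve_right (algebraMap_ne_zero' hσ.1)
  exact hv (funext fun c => Fin.cases hv00 hvs c)

lemma totalDegree_pderiv_le (i : Fin d) (p : 𝔸) :
    (MvPolynomial.pderiv i p).totalDegree ≤ p.totalDegree := by
  refine Finset.sup_le fun m hm => ?_
  rw [MvPolynomial.mem_support_iff, MvPolynomial.coeff_pderiv] at hm
  have h1 := MvPolynomial.le_totalDegree (p := p) (s := m + Finsupp.single i 1)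
    (MvPolynomial.mem_support_iff.2 (left_ne_zero_of_mul hm))
  refine le_trans ?_ h1
  rw [Finsupp.sum_add_index' (fun _ => rfl) (fun _ _ _ => rfl)]
  exact Nat.le_add_right _ _

/-- Degree bound for the Jacobian. -/
lemma totalDegree_jacobian_le {a : Fin (d + 1) → 𝔸} {m : ℕ} (h : ∀ r, (a r).totalDegree ≤ m) :
    (jacobian a).totalDegree ≤ (d + 1) * m := by
  rw [jacobian, Matrix.det_apply]
  refine MvPolynomial.totalDegree_finsetSum_le fun σ _ => ?_
  refine (MvPolynomial.totalDegree_smul_le _ _).trans ?_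
  refine (MvPolynomial.totalDegree_finsetProd _ _).trans ?_
  refine (Finset.sum_le_card_nsmul _ _ m fun i _ => ?_).trans (by simp)
  simp only [Matrix.of_apply]
  refine Fin.cases ?_ (fun j => ?_) i
  · simpa using h _
  · simp only [Fin.cons_succ]
    exact (totalDegree_pderiv_le _ _).trans (h _)

end Contracted

end Cremona

end

/-! ### Equality of the two defects via units and factoriality -/

section

open Cardinal

namespace Cremona

section UnitSubgroup

variable {K : Type*} [Field K]

lemma prod_zpow_eq {ι G : Type*} [CommGroup G] (s : Finset ι) (a : G) (c : ι → ℤ) :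
    ∏ i ∈ s, a ^ c i = a ^ ∑ i ∈ s, c i := by
  classical
  induction s using Finset.induction_on with
  | empty => simp
  | insert i s hi ih => rw [Finset.prod_insert hi, Finset.sum_insert hi, ih, zpow_add]

/-- The units of a subring of a field, as a subgroup of the units of the field. -/
def unitSubgroup (R : Subring K) : Subgroup Kˣ where
  carrier := {z | (z : K) ∈ R ∧ ((z⁻¹ : Kˣ) : K) ∈ R}
  mul_mem' := by
    rintro a b ⟨ha, ha'⟩ ⟨hb, hb'⟩
    refine ⟨by rw [Units.val_mul]; exact mul_mem ha hb, ?_⟩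
    rw [mul_inv, Units.val_mul]
    exact mul_mem ha' hb'
  one_mem' := by simp [one_mem]
  inv_mem' := by
    rintro a ⟨ha, ha'⟩
    exact ⟨ha', by simpa using ha⟩

lemma mem_unitSubgroup {R : Subring K} {z : Kˣ} :
    z ∈ unitSubgroup R ↔ (z : K) ∈ R ∧ ((z⁻¹ : Kˣ) : K) ∈ R := Iff.rfl

variable {A : Type*} [CommRing A] [IsDomain A] [Algebra A K] [IsFractionRing A K]

/-- A nonzero element of the base ring as a unit of the field of fractions. -/
def toUnit (a : A) (ha : a ≠ 0) : Kˣ := Units.mk0 (algebraMap A K a) (algebraMap_ne_zero' ha)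

lemma toUnit_mem_unitSubgroup {p a : A} (hp : Prime p) (ha : a ≠ 0) (hpa : ¬ p ∣ a) :
    toUnit a ha ∈ unitSubgroup (primeRing K p hp) := by
  refine ⟨algebraMap_mem_primeRing hp a, ?_⟩
  rw [Units.val_inv_eq_inv_val]
  have := div_mem_primeRing (K := K) hp 1 hpa
  simpa [toUnit] using this

lemma eq_zero_of_zpow_mem_unitSubgroup {p : A} (hp : Prime p) {n : ℤ}
    (h : (toUnit p hp.ne_zero : Kˣ) ^ n ∈ unitSubgroup (primeRing K p hp)) : n = 0 := by
  have key : ∀ m : ℕ, (toUnit p hp.ne_zero : Kˣ) ^ (m + 1) ∉ unitSubgroup (primeRing K p hp) := by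
    rintro m ⟨-, h⟩
    refine inv_notMem_primeRing (K := K) hp ?_
    have h1 : (algebraMap A K p)⁻¹ =
        (((toUnit p hp.ne_zero : Kˣ) ^ (m + 1))⁻¹ : Kˣ) * algebraMap A K p ^ m := by
      have := algebraMap_ne_zero' (K := K) hp.ne_zero
      rw [Units.val_inv_eq_inv_val, Units.val_pow_eq_pow_val, toUnit, Units.val_mk0]
      field_simp
      rw [pow_succ']
    rw [h1]
    exact mul_mem h (pow_mem (algebraMap_mem_primeRing hp p) m)
  by_contra hn
  obtain ⟨m, hm⟩ : ∃ m : ℕ, n.natAbs = m + 1 := ⟨n.natAbs - 1, by lia⟩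
  rcases Int.natAbs_eq n with h1 | h1
  · rw [h1, zpow_natCast, hm] at h
    exact key m h
  · rw [h1, zpow_neg, inv_mem_iff, zpow_natCast, hm] at h
    exact key m h

lemma exists_zpow_mul_unit [WfDvdMonoid A] {p : A} (hp : Prime p) (z : Kˣ) :
    ∃ (n : ℤ), ∃ w ∈ unitSubgroup (primeRing K p hp), z = toUnit p hp.ne_zero ^ n * w := by
  obtain ⟨i, j, a, b, ha, hb, h⟩ := exists_eq_pow_mul_unit hp z.ne_zero
  have ha0 : a ≠ 0 := by rintro rfl; simp at ha
  have hb0 : b ≠ 0 := by rintro rfl; simp at hb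
  refine ⟨i - j, toUnit a ha0 / toUnit b hb0, ?_, ?_⟩
  · exact div_mem (toUnit_mem_unitSubgroup hp ha0 ha) (toUnit_mem_unitSubgroup hp hb0 hb)
  · ext
    rw [h, zpow_sub]
    simp [toUnit, div_eq_mul_inv]

/-- In a reduced fraction, a prime factor of the denominator would be a pole. -/
lemma exists_algebraMap_eq_of_forall_mem_primeRing [UniqueFactorizationMonoid A] {z : K}
    (h : ∀ (q : A) (hq : Prime q), z ∈ primeRing K q hq) : ∃ a, algebraMap A K a = z := by
  obtain ⟨a, b, hab, rfl⟩ := IsFractionRing.exists_reduced_fraction (A := A) z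
  have hb0 : (b : A) ≠ 0 := nonZeroDivisors.ne_zero b.2
  by_cases hb : IsUnit (b : A)
  · obtain ⟨c, hc⟩ := hb.exists_right_inv
    refine ⟨a * c, ?_⟩
    rw [IsLocalization.eq_mk'_iff_mul_eq, ← map_mul, mul_assoc, mul_comm c, hc, mul_one]
  · obtain ⟨q, hq, hqb⟩ := WfDvdMonoid.exists_irreducible_factor hb hb0
    obtain ⟨x, y, hy, hxy⟩ := mem_primeRing.1 (h q hq.prime)
    have hy0 : y ≠ 0 := by rintro rfl; simp at hy
    exfalso
    rw [eq_div_iff (algebraMap_ne_zero' hy0)] at hxy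
    have h1 : algebraMap A K (a * y) = algebraMap A K (x * b) := by
      rw [map_mul, map_mul, ← hxy, mul_right_comm, IsLocalization.mk'_spec]
    have h2 : q ∣ a * y := by
      rw [IsFractionRing.injective A K h1]
      exact hqb.mul_left _
    exact hq.not_isUnit (hab ((hq.prime.dvd_or_dvd h2).resolve_right hy) hqb)

end UnitSubgroup

section Counting

variable {k : Type u} [Field k] {d : ℕ} {K : Type u} [Field K] [Algebra (MvPolynomial (Fin d) k) K]
  [IsFractionRing (MvPolynomial (Fin d) k) K] [Algebra k K]
  [IsScalarTower k (MvPolynomial (Fin d) k) K]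

local notation "𝔸" => MvPolynomial (Fin d) k

lemma mapSubring_injective (σ : K ≃ₐ[k] K) : Function.Injective (mapSubring σ) := by
  intro R R' h
  ext z
  have := SetLike.ext_iff.1 h (σ z)
  simpa [mapSubring, Subring.mem_map] using this

lemma mapSubring_mul (σ τ : K ≃ₐ[k] K) (R : Subring K) :
    mapSubring (σ * τ) R = mapSubring σ (mapSubring τ R) := by
  simp only [mapSubring, Subring.map_map]
  rfl

lemma mapSubring_one (R : Subring K) : mapSubring (1 : K ≃ₐ[k] K) R = R := by
  ext z
  simp [mapSubring, Subring.mem_map]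

/-- The number of prime divisors contracted by a birational map is at most the number of prime
divisors contracted by its inverse. -/
theorem encard_primeRings_diff_le (σ : K ≃ₐ[k] K) :
    (primeRings 𝔸 K \ mapSubring σ '' primeRings 𝔸 K).encard ≤
      (mapSubring σ '' primeRings 𝔸 K \ primeRings 𝔸 K).encard := by
  by_cases hJ : (mapSubring σ '' primeRings 𝔸 K \ primeRings 𝔸 K).Finite
  swap
  · rw [Set.Infinite.encard_eq hJ]
    exact le_top
  by_contra! hlt
  -- It suffices to work with finitely many members of S \ σ(S), one more than there are in J = σ(S)
  -- \ S; this keeps the rank comparison finite.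
  obtain ⟨I, hIsub, hIcard⟩ := Set.exists_subset_encard_eq (Order.add_one_le_of_lt hlt)
  have hI : I.Finite := Set.finite_of_encard_eq_coe (k := hJ.toFinset.card + 1) (by
    rw [hIcard, hJ.encard_eq_coe_toFinset_card]; rfl)
  have := hI.fintype
  have := hJ.fintype
  choose p hp using fun i : I => (hIsub i.2).1
  choose q hq using fun j : (mapSubring σ '' primeRings 𝔸 K \ primeRings 𝔸 K : Set (Subring K)) =>
    j.2.1
  choose q' hq' using fun j => (hq j).1
  let P : I → Kˣ := fun i => toUnit (p i).1 (p i).2.ne_zero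
  let P' : I → Kˣ := fun i => Units.map (σ.symm : K →* K) (P i)
  -- n is the integer matrix of the orders of the functions σ⁻¹(pᵢ) at the primes q'ⱼ with
  -- σ(A_(q'ⱼ)) in J. The claim is that it has trivial kernel, which forces |I| ≤ |J|.
  choose n w hw hPn using fun (j : (mapSubring σ '' primeRings 𝔸 K \ primeRings 𝔸 K :
    Set (Subring K))) (i : I) => exists_zpow_mul_unit (q' j).2 (P' i)
  let f : (I → ℤ) →ₗ[ℤ] (_ → ℤ) := (Matrix.of n).mulVecLin
  have hinj : Function.Injective f := by
    rw [← LinearMap.ker_eq_bot, LinearMap.ker_eq_bot']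
    intro c hc
    have hcj : ∀ j, ∑ i, n j i * c i = 0 := fun j => congrFun hc j
    have hall : ∀ (r : 𝔸) (hr : Prime r), ∏ i, P' i ^ c i ∈ unitSubgroup (primeRing K r hr) := by
      intro r hr
      -- The order of σ⁻¹(pᵢ) at r is the order of pᵢ along σ(A_(r)). If that ring is A_(s) in S,
      -- then s is not associated to pᵢ, because A_(pᵢ) is not in σ(S), and the order is zero.
      -- Otherwise it belongs to J and the kernel relation applies.
      by_cases hmem : mapSubring σ (primeRing K r hr) ∈ primeRings 𝔸 K
      · obtain ⟨⟨s, hs⟩, hsr⟩ := hmem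
        refine prod_mem fun i _ => zpow_mem ?_ _
        have h1 : P i ∈ unitSubgroup (primeRing K s hs) := by
          refine toUnit_mem_unitSubgroup hs _ fun hdvd => (hIsub i.2).2 ?_
          refine ⟨primeRing K r hr, ⟨⟨r, hr⟩, rfl⟩, ?_⟩
          rw [← hsr, ← hp i]
          exact primeRing_eq_of_associated _ _ (hs.irreducible.associated_of_dvd
            (p i).2.irreducible hdvd)
        simp only at hsr
        rw [hsr] at h1
        simpa [mem_unitSubgroup, mapSubring, Subring.mem_map, P', AlgEquiv.symm_apply_eq,
          ← AlgEquiv.eq_symm_apply] using h1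
      · let j : (mapSubring σ '' primeRings 𝔸 K \ primeRings 𝔸 K : Set (Subring K)) :=
          ⟨mapSubring σ (primeRing K r hr), ⟨_, ⟨⟨r, hr⟩, rfl⟩, rfl⟩, hmem⟩
        have hjr : primeRing K (q' j).1 (q' j).2 = primeRing K r hr := by
          exact (hq' j).trans (mapSubring_injective σ (hq j).2)
        rw [← hjr]
        have h1 : ∏ i, P' i ^ c i = ∏ i, w j i ^ c i := by
          have h2 : ∀ i, P' i ^ c i =
              toUnit (q' j).1 (q' j).2.ne_zero ^ (n j i * c i) * w j i ^ c i := fun i => by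
            conv_lhs => rw [hPn j i, mul_zpow, ← zpow_mul]
          simp only [h2, Finset.prod_mul_distrib]
          rw [prod_zpow_eq, hcj j, zpow_zero, one_mul]
        rw [h1]
        exact prod_mem fun i _ => zpow_mem (hw j i) _
    obtain ⟨a, ha⟩ := exists_algebraMap_eq_of_forall_mem_primeRing fun r hr => (hall r hr).1
    obtain ⟨a', ha'⟩ := exists_algebraMap_eq_of_forall_mem_primeRing fun r hr => (hall r hr).2
    -- For c in the kernel, the product of the σ⁻¹(pᵢ)^cᵢ and its inverse are both polynomials,
    -- hence constants. So σ does not change the product, and the pᵢ being pairwise non-associated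
    -- yields c = 0.
    have haa : a * a' = 1 := by
      apply IsFractionRing.injective 𝔸 K
      rw [map_mul, ha, ha', ← Units.val_mul, mul_inv_cancel, map_one, Units.val_one]
    obtain ⟨t, ht⟩ : ∃ t, MvPolynomial.C t = a := by
      have := MvPolynomial.isUnit_iff_eq_C_of_isReduced.1 (IsUnit.of_mul_eq_one a' haa)
      obtain ⟨t, -, ht⟩ := this
      exact ⟨t, ht.symm⟩
    have hPP : (∏ i, P i ^ c i : Kˣ) = ∏ i, P' i ^ c i := by
      have h1 : Units.map (σ : K →* K) (∏ i, P' i ^ c i) = ∏ i, P i ^ c i := by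
        rw [map_prod]
        refine Finset.prod_congr rfl fun i _ => ?_
        rw [map_zpow]
        congr 1
        ext
        simp [P']
      rw [← h1]
      ext
      rw [Units.coe_map, ← ha, ← ht, ← MvPolynomial.algebraMap_eq,
        ← IsScalarTower.algebraMap_apply]
      simp
    funext i
    refine eq_zero_of_zpow_mem_unitSubgroup (K := K) (p i).2 ?_
    have h1 := hall (p i).1 (p i).2
    classical
    rw [← hPP, ← Finset.mul_prod_erase _ _ (Finset.mem_univ i)] at h1
    refine (Subgroup.mul_mem_cancel_right _ (prod_mem fun i' hi' => zpow_mem ?_ _)).1 h1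
    refine toUnit_mem_unitSubgroup _ _ fun hdvd => (Finset.mem_erase.1 hi').1 ?_
    apply Subtype.ext
    rw [← hp i, ← hp i']
    exact (primeRing_eq_of_associated _ _ ((p i).2.irreducible.associated_of_dvd
      (p i').2.irreducible hdvd)).symm
  have hcard := card_le_of_injective ℤ f hinj
  have h1 : I.encard = Fintype.card I := by rw [Set.encard_eq_coe_toFinset_card, Set.toFinset_card]
  have h2 : (mapSubring σ '' primeRings 𝔸 K \ primeRings 𝔸 K).encard =
      Fintype.card ↥(mapSubring σ '' primeRings 𝔸 K \ primeRings 𝔸 K : Set (Subring K)) := by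
    rw [Set.encard_eq_coe_toFinset_card, Set.toFinset_card]
  rw [h1, h2] at hIcard
  have h3 : Fintype.card I =
    Fintype.card ↥(mapSubring σ '' primeRings 𝔸 K \ primeRings 𝔸 K : Set (Subring K)) + 1 := by
    exact_mod_cast hIcard
  lia

end Counting

end Cremona

end

/-! ### Models of a function field and their rational maps -/

section

open AlgebraicGeometry CategoryTheory

namespace Cremona

/-- A variety over `k` together with an identification of its function field with `K`. -/
structure Model (k K : Type u) [Field k] [Field K] [Algebra k K] where
  /-- The variety. -/
  V : Variety k
  /-- The identification of the function field. -/
  e : V.X.functionField ≅ CommRingCat.of K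
  map_e_str : (Spec.map e.hom ≫ V.X.fromSpecStalk (genericPoint V.X)) ≫ V.str =
    Spec.map (CommRingCat.ofHom (algebraMap k K))

namespace Model

variable {k K : Type u} [Field k] [Field K] [Algebra k K]

/-- The generic point, as a `K`-valued point. -/
def ξ (M : Model k K) : Spec (CommRingCat.of K) ⟶ M.V.X :=
  Spec.map M.e.hom ≫ M.V.X.fromSpecStalk (genericPoint M.V.X)

lemma ξ_str (M : Model k K) : M.ξ ≫ M.V.str = Spec.map (CommRingCat.ofHom (algebraMap k K)) :=
  M.map_e_str

/-- The local ring at `x`, mapped into `K`. -/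
def germ (M : Model k K) (x : M.V.X) : M.V.X.presheaf.stalk x ⟶ CommRingCat.of K :=
  M.V.X.presheaf.stalkSpecializes (genericPoint_specializes x) ≫ M.e.hom

@[simp]
lemma map_germ_fromSpecStalk (M : Model k K) (x : M.V.X) :
    Spec.map (M.germ x) ≫ M.V.X.fromSpecStalk x = M.ξ := by
  rw [germ, Spec.map_comp, Category.assoc, Scheme.SpecMap_stalkSpecializes_fromSpecStalk, ξ]

/-- The canonical map from the spectrum of a stalk is a monomorphism, so the embedding of a local
ring in K is determined by compatibility with the generic point. Identifications of local rings
below go through this uniqueness. -/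
lemma eq_germ (M : Model k K) (x : M.V.X) (r : M.V.X.presheaf.stalk x ⟶ CommRingCat.of K)
    (h : Spec.map r ≫ M.V.X.fromSpecStalk x = M.ξ) : r = M.germ x := by
  apply Spec.map_injective
  rw [← cancel_mono (M.V.X.fromSpecStalk x), h, map_germ_fromSpecStalk]

lemma germ_injective (M : Model k K) (x : M.V.X) : Function.Injective (M.germ x).hom := by
  have h1 : Function.Injective (M.V.X.presheaf.stalkSpecializes (genericPoint_specializes x)).hom :=
    IsFractionRing.injective (M.V.X.presheaf.stalk x) M.V.X.functionField
  have h2 : Function.Injective M.e.hom.hom :=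
    ((ConcreteCategory.isIso_iff_bijective M.e.hom).1 inferInstance).1
  exact h2.comp h1

/-- The local ring at `x` as a subring of `K`. -/
def localRing (M : Model k K) (x : M.V.X) : Subring K := (M.germ x).hom.range

/-- The image of the rational map `F` at the generic point is `η`. -/
def Sends (M : Model k K) {Y : Scheme.{u}} (F : M.V.X ⤏ Y) (η : Spec (CommRingCat.of K) ⟶ Y) :
    Prop := Spec.map M.e.hom ≫ F.fromFunctionField = η

/-- A rational map is determined by its value at the generic point, so identities between birational
maps reduce to identities between K-valued points. -/
lemma sends_injective (M : Model k K) {Y : Scheme.{u}} {F G : M.V.X ⤏ Y}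
    {η : Spec (CommRingCat.of K) ⟶ Y} (hF : M.Sends F η) (hG : M.Sends G η) : F = G := by
  apply Scheme.RationalMap.eq_of_fromFunctionField_eq
  rw [← cancel_epi (Spec.map M.e.hom)]
  exact hF.trans hG.symm

lemma exists_lift (M : Model k K) {Y : Scheme.{u}} {F : M.V.X ⤏ Y}
    {η : Spec (CommRingCat.of K) ⟶ Y} (hF : M.Sends F η) (f : M.V.X.PartialMap Y)
    (hf : f.toRationalMap = F) :
    ∃ l : Spec (CommRingCat.of K) ⟶ f.domain, l ≫ f.domain.ι = M.ξ ∧ l ≫ f.hom = η := by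
  subst hf
  refine ⟨Spec.map M.e.hom ≫ f.domain.fromSpecStalkOfMem (genericPoint M.V.X)
    ((genericPoint_specializes _).mem_open f.domain.2 f.dense_domain.nonempty.choose_spec),
    ?_, ?_⟩
  · rw [Category.assoc, Scheme.Opens.fromSpecStalkOfMem_ι, ξ]
  · rw [Category.assoc]
    exact hF

lemma sends_of_lift (M : Model k K) {Y : Scheme.{u}} (f : M.V.X.PartialMap Y)
    (l : Spec (CommRingCat.of K) ⟶ f.domain) (hl : l ≫ f.domain.ι = M.ξ) :
    M.Sends f.toRationalMap (l ≫ f.hom) := by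
  obtain ⟨l', h1, h2⟩ := M.exists_lift (F := f.toRationalMap) rfl f rfl
  have : l' = l := by rw [← cancel_mono f.domain.ι, h1, hl]
  subst this
  exact h2.symm

lemma sends_toRationalMap (M : Model k K) {Y : Scheme.{u}} (f : M.V.X ⟶ Y) :
    M.Sends f.toRationalMap (M.ξ ≫ f) := by
  obtain ⟨l, h1, h2⟩ := M.exists_lift (F := f.toRationalMap) rfl f.toPartialMap rfl
  rw [Sends, ← h2, ← h1]
  simp only [Scheme.Hom.toPartialMap_hom, Scheme.topIso_hom, Category.assoc]
  rfl

lemma sends_id (M : Model k K) : M.Sends (Scheme.RationalMap.id M.V.X) M.ξ := by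
  simpa using M.sends_toRationalMap (𝟙 M.V.X)

lemma sends_compHom (M : Model k K) {Y Z : Scheme.{u}} {F : M.V.X ⤏ Y}
    {η : Spec (CommRingCat.of K) ⟶ Y} (hF : M.Sends F η) (g : Y ⟶ Z) :
    M.Sends (F.compHom g) (η ≫ g) := by
  obtain ⟨f, rfl⟩ := F.exists_rep
  obtain ⟨l, h1, h2⟩ := M.exists_lift hF f rfl
  rw [← h2, Category.assoc]
  exact M.sends_of_lift (f.compHom g) l h1

lemma exists_sends (M : Model k K) (N : Variety k) (η : Spec (CommRingCat.of K) ⟶ N.X)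
    (h : η ≫ N.str = Spec.map (CommRingCat.ofHom (algebraMap k K))) :
    ∃ F : M.V.X ⤏ N.X, M.Sends F η ∧ F.compHom N.str = M.V.str.toRationalMap := by
  let f : { f : Spec M.V.X.functionField ⟶ N.X // f ≫ N.str = M.V.X.fromSpecStalk _ ≫ M.V.str } :=
    ⟨Spec.map M.e.inv ≫ η, by
      rw [Category.assoc, h, ← M.map_e_str, Category.assoc, ← Spec.map_comp_assoc, Iso.hom_inv_id,
        Spec.map_id, Category.id_comp]⟩
  refine ⟨Scheme.RationalMap.ofFunctionField M.V.str N.str f.1 f.2, ?_,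
    (Scheme.RationalMap.equivFunctionField M.V.str N.str f).2⟩
  rw [Sends, Scheme.RationalMap.fromFunctionField_ofFunctionField, ← Spec.map_comp_assoc,
    Iso.inv_hom_id, Spec.map_id, Category.id_comp]

/-- A point which is contained in every nonempty open set. -/
lemma ξ_mem (M : Model k K) (t : Spec (CommRingCat.of K)) {U : M.V.X.Opens} (hU : (U : Set M.V.X).Nonempty) :
    M.ξ t ∈ U := by
  have h1 : M.ξ t ⤳ genericPoint M.V.X := by
    rw [ξ, Scheme.Hom.comp_apply]
    have := Set.mem_range_self (f := M.V.X.fromSpecStalk (genericPoint M.V.X)) (Spec.map M.e.hom t)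
    rwa [Scheme.range_fromSpecStalk] at this
  have h2 : genericPoint M.V.X ∈ U := (genericPoint_specializes hU.choose).mem_open U.2 hU.choose_spec
  exact h1.mem_open U.2 h2

instance (M : Model k K) : IsDominant M.ξ := by
  constructor
  rw [DenseRange, dense_iff_inter_open]
  intro U hU hne
  exact ⟨M.ξ (IsLocalRing.closedPoint K), M.ξ_mem _ (U := ⟨U, hU⟩) hne, ⟨_, rfl⟩⟩

/-- A rational map sending the generic point to a dominant point is dominant. -/
lemma isDominant_of_sends (M : Model k K) {Y : Scheme.{u}} {F : M.V.X ⤏ Y}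
    {η : Spec (CommRingCat.of K) ⟶ Y} [IsDominant η] (hF : M.Sends F η) : F.IsDominant := by
  obtain ⟨f, rfl⟩ := F.exists_rep
  obtain ⟨l, h1, rfl⟩ := M.exists_lift hF f rfl
  have : IsDominant f.hom := IsDominant.of_comp l f.hom
  infer_instance

lemma sends_comp_map (M N : Model k K) {Z : Scheme.{u}} {F : M.V.X ⤏ N.V.X} [F.IsDominant]
    {G : N.V.X ⤏ Z} {η : Spec (CommRingCat.of K) ⟶ Z} {a : CommRingCat.of K ⟶ CommRingCat.of K}
    (hF : M.Sends F (Spec.map a ≫ N.ξ)) (hG : N.Sends G η) :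
    M.Sends (F.comp G) (Spec.map a ≫ η) := by
  obtain ⟨f, rfl⟩ := F.exists_rep
  obtain ⟨g, rfl⟩ := G.exists_rep
  obtain ⟨l, h1, h2⟩ := M.exists_lift hF f rfl
  obtain ⟨m', h3', rfl⟩ := N.exists_lift hG g rfl
  have h3 : (Spec.map a ≫ m') ≫ g.domain.ι = Spec.map a ≫ N.ξ := by rw [Category.assoc, h3']
  rw [← Category.assoc]
  set m := Spec.map a ≫ m'
  have : IsDominant f.hom := f.isDominant_toRationalMap_iff.1 inferInstance
  rw [Scheme.RationalMap.toRationalMap_comp]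
  let l' : Spec (CommRingCat.of K) ⟶ f.hom ⁻¹ᵁ g.domain :=
    IsOpenImmersion.lift (f.hom ⁻¹ᵁ g.domain).ι l (by
      rintro _ ⟨t, rfl⟩
      rw [Scheme.Opens.range_ι]
      change f.hom (l t) ∈ g.domain
      rw [← Scheme.Hom.comp_apply, h2, ← h3, Scheme.Hom.comp_apply]
      exact (m t).2)
  have hl' : l' ≫ (f.hom ⁻¹ᵁ g.domain).ι = l := IsOpenImmersion.lift_fac _ _ _
  have hm : l' ≫ f.hom ∣_ g.domain = m := by
    rw [← cancel_mono g.domain.ι, Category.assoc, morphismRestrict_ι, ← Category.assoc, hl', h2, h3]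
  let i : (f.hom ⁻¹ᵁ g.domain : Scheme.Opens _).toScheme ⟶ (f.comp g).domain :=
    (f.domain.ι.isoImage (f.hom ⁻¹ᵁ g.domain)).hom
  have hi : i ≫ (f.comp g).domain.ι = (f.hom ⁻¹ᵁ g.domain).ι ≫ f.domain.ι :=
    Scheme.Hom.isoImage_hom_ι _ _
  have hi' : i ≫ (f.comp g).hom = f.hom ∣_ g.domain ≫ g.hom := by
    rw [Scheme.PartialMap.comp_hom]
    exact Iso.hom_inv_id_assoc _ _
  have := M.sends_of_lift (f.comp g) (l' ≫ i) (by
    rw [← h1, ← hl', Category.assoc, Category.assoc, hi])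
  rwa [Category.assoc, hi', ← Category.assoc, hm] at this

lemma sends_comp (M N : Model k K) {Z : Scheme.{u}} {F : M.V.X ⤏ N.V.X} [F.IsDominant]
    {G : N.V.X ⤏ Z} {η : Spec (CommRingCat.of K) ⟶ Z} (hF : M.Sends F N.ξ) (hG : N.Sends G η) :
    M.Sends (F.comp G) η := by
  have h := M.sends_comp_map N (a := 𝟙 _) (F := F) (G := G) (η := η)
  simp only [Spec.map_id, Category.id_comp] at h
  exact h hF hG

/-- Changing the identification of the function field by an automorphism. -/
def twist (M : Model k K) (σ : K ≃ₐ[k] K) : Model k K where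
  V := M.V
  e := M.e ≪≫ (σ : K ≃+* K).toCommRingCatIso
  map_e_str := by
    rw [Iso.trans_hom, Spec.map_comp, Category.assoc, Category.assoc]
    have := M.map_e_str
    rw [Category.assoc] at this
    rw [this, ← Spec.map_comp]
    congr 1
    ext x
    simp

lemma twist_ξ (M : Model k K) (σ : K ≃ₐ[k] K) :
    (M.twist σ).ξ = Spec.map (CommRingCat.ofHom (σ : K →+* K)) ≫ M.ξ := by
  change Spec.map (M.e.hom ≫ CommRingCat.ofHom (σ : K →+* K)) ≫ _ = _
  rw [Spec.map_comp]
  exact Category.assoc _ _ _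

lemma twist_localRing (M : Model k K) (σ : K ≃ₐ[k] K) (x : M.V.X) :
    (M.twist σ).localRing x = (M.localRing x).map (σ : K →+* K) := by
  change (M.germ x ≫ CommRingCat.ofHom (σ : K →+* K)).hom.range = _
  rw [localRing, RingHom.map_range]
  rfl

lemma twist_one_ξ (M : Model k K) : (M.twist (1 : K ≃ₐ[k] K)).ξ = M.ξ := by
  rw [twist_ξ]
  exact (congrArg (· ≫ M.ξ) (Spec.map_id _)).trans (Category.id_comp _)

/-- Every model of `K` is birational to every other one. -/
lemma exists_birMap (M N : Model k K) : ∃ φ : BirMap M.V N.V, M.Sends φ.map N.ξ ∧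
    N.Sends φ.inv M.ξ := by
  obtain ⟨F, hF, hF'⟩ := M.exists_sends N.V N.ξ N.ξ_str
  obtain ⟨G, hG, hG'⟩ := N.exists_sends M.V M.ξ M.ξ_str
  have h1 := M.isDominant_of_sends hF
  have h2 := N.isDominant_of_sends hG
  exact ⟨⟨F, G, h1, h2, hF', hG', M.sends_injective (M.sends_comp N hF hG) M.sends_id,
    N.sends_injective (N.sends_comp M hG hF) N.sends_id⟩, hF, hG⟩

instance (M : Model k K) : Mono M.ξ := by
  unfold ξ
  infer_instance

lemma exists_eq_map_comp_fromSpecStalk (X : Scheme.{u}) [IrreducibleSpace X]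
    (η : Spec (CommRingCat.of K) ⟶ X) [IsDominant η] :
    ∃ τ : X.functionField ⟶ CommRingCat.of K,
      Spec.map τ ≫ X.fromSpecStalk (genericPoint X) = η := by
  have h1 : η (IsLocalRing.closedPoint K) = genericPoint X := by
    have h2 : IsGenericPoint (η (IsLocalRing.closedPoint K)) Set.univ := by
      have h3 : Set.range η = {η (IsLocalRing.closedPoint K)} := by
        ext x
        constructor
        · rintro ⟨t, rfl⟩
          rw [Set.mem_singleton_iff]
          congr 1
          exact Subsingleton.elim (α := PrimeSpectrum K) _ _
        · rintro rfl
          exact ⟨_, rfl⟩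
      rw [isGenericPoint_def, ← h3]
      exact η.denseRange.closure_range
    exact h2.eq (genericPoint_spec X)
  have h4 : ∃ τ : X.presheaf.stalk (η (IsLocalRing.closedPoint K)) ⟶ CommRingCat.of K,
      Spec.map τ ≫ X.fromSpecStalk _ = η :=
    ⟨Scheme.stalkClosedPointTo η, Scheme.Spec_stalkClosedPointTo_fromSpecStalk η⟩
  have h5 : ∀ x : X, x = genericPoint X → (∃ τ : X.presheaf.stalk x ⟶ CommRingCat.of K,
      Spec.map τ ≫ X.fromSpecStalk _ = η) → ∃ τ : X.functionField ⟶ CommRingCat.of K,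
      Spec.map τ ≫ X.fromSpecStalk (genericPoint X) = η := by
    rintro x rfl h
    exact h
  exact h5 _ h1 h4

/-- A model from a dominant `K`-valued point, inducing a surjection onto `K`. -/
lemma exists_iso_functionField (X : Scheme.{u}) [IsIntegral X]
    (η : Spec (CommRingCat.of K) ⟶ X) [IsDominant η]
    (hsurj : ∀ τ : X.functionField ⟶ CommRingCat.of K,
      Spec.map τ ≫ X.fromSpecStalk (genericPoint X) = η → Function.Surjective τ.hom) :
    ∃ e : X.functionField ≅ CommRingCat.of K,
      Spec.map e.hom ≫ X.fromSpecStalk (genericPoint X) = η := by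
  obtain ⟨τ, hτ⟩ := exists_eq_map_comp_fromSpecStalk X η
  have : IsIso τ := (ConcreteCategory.isIso_iff_bijective τ).2
    ⟨RingHom.injective (R := X.functionField) (S := K) τ.hom, hsurj τ hτ⟩
  exact ⟨asIso τ, hτ⟩

lemma isDominant_of_sends_of_isDominant (M : Model k K) {Y : Scheme.{u}} {F : M.V.X ⤏ Y}
    [F.IsDominant] {η : Spec (CommRingCat.of K) ⟶ Y} (hF : M.Sends F η) : IsDominant η := by
  obtain ⟨f, rfl⟩ := F.exists_rep
  obtain ⟨l, h1, rfl⟩ := M.exists_lift hF f rfl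
  have : IsDominant f.hom := f.isDominant_toRationalMap_iff.1 inferInstance
  have : IsDominant l := by
    constructor
    rw [DenseRange, dense_iff_inter_open]
    intro U hU hne
    let t : Spec (CommRingCat.of K) := IsLocalRing.closedPoint K
    refine ⟨l t, ?_, ⟨_, rfl⟩⟩
    have h2 := M.ξ_mem t (U := f.domain.ι ''ᵁ ⟨U, hU⟩) (by
      obtain ⟨x, hx⟩ := hne
      exact ⟨f.domain.ι x, x, hx, rfl⟩)
    rw [← h1, Scheme.Hom.comp_apply] at h2
    obtain ⟨y, hy, hyx⟩ := h2
    rwa [f.domain.ι.injective hyx] at hy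
  infer_instance

/-- The action of a dominant rational self-map over `k` on the field of rational functions. -/
lemma exists_algHom (M : Model k K) {F : M.V.X ⤏ M.V.X} [F.IsDominant]
    (hF : F.compHom M.V.str = M.V.str.toRationalMap) :
    ∃ a : K →ₐ[k] K, M.Sends F (Spec.map (CommRingCat.ofHom (a : K →+* K)) ≫ M.ξ) := by
  obtain ⟨η, hη⟩ : ∃ η, M.Sends F η := ⟨_, rfl⟩
  have := M.isDominant_of_sends_of_isDominant hη
  obtain ⟨τ, hτ⟩ := exists_eq_map_comp_fromSpecStalk M.V.X η
  have h1 : η = Spec.map (M.e.inv ≫ τ) ≫ M.ξ := by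
    rw [ξ, ← Spec.map_comp_assoc, Iso.hom_inv_id_assoc, hτ]
  have h2 : η ≫ M.V.str = M.ξ ≫ M.V.str := by
    have h3 := M.sends_compHom hη M.V.str
    rw [hF] at h3
    exact h3.symm.trans (M.sends_toRationalMap M.V.str)
  rw [h1, Category.assoc, M.ξ_str, ← Spec.map_comp] at h2
  have h3 := Spec.map_injective h2
  refine ⟨{ (M.e.inv ≫ τ).hom with commutes' := fun r => ?_ }, ?_⟩
  · exact congrArg (fun f => f.hom r) h3
  · rw [h1] at hη
    exact hη

/-- The automorphism of `K` attached to a birational transformation. -/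
theorem exists_algEquiv_sends (M : Model k K) (g : Bir M.V) :
    ∃ σ : K ≃ₐ[k] K, M.Sends g.map (M.twist σ).ξ ∧ M.Sends g.inv (M.twist σ⁻¹).ξ := by
  obtain ⟨a, ha⟩ := M.exists_algHom g.map_over
  obtain ⟨b, hb⟩ := M.exists_algHom g.inv_over
  have h1 := M.sends_comp_map M ha hb
  have h2 := M.sends_comp_map M hb ha
  rw [g.map_inv, ← Category.assoc, ← Spec.map_comp] at h1
  rw [g.inv_map, ← Category.assoc, ← Spec.map_comp] at h2
  -- The generic point is a monomorphism, so an endomorphism of K inducing the identity rational map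
  -- is the identity.
  have key : ∀ c : CommRingCat.of K ⟶ CommRingCat.of K,
      M.Sends (Scheme.RationalMap.id M.V.X) (Spec.map c ≫ M.ξ) → c = 𝟙 _ := fun c hc => by
    apply Spec.map_injective
    rw [← cancel_mono M.ξ, Spec.map_id, Category.id_comp]
    exact hc.symm.trans M.sends_id
  have h3 := key _ h1
  have h4 := key _ h2
  refine ⟨AlgEquiv.ofAlgHom a b ?_ ?_, ?_, ?_⟩
  · ext x
    exact congrArg (fun f => f.hom x) h3
  · ext x
    exact congrArg (fun f => f.hom x) h4
  · rw [twist_ξ]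
    exact ha
  · rw [twist_ξ]
    exact hb

/-- Pullback reverses composition: in `f * g` the map g is applied first, so its automorphism σ
stands on the left. For powers of one element the reversal disappears. -/
lemma sends_mul (M : Model k K) {f g : Bir M.V} {σ τ : K ≃ₐ[k] K}
    (hf : M.Sends f.map (M.twist τ).ξ) (hg : M.Sends g.map (M.twist σ).ξ) :
    M.Sends (f * g).map (M.twist (σ * τ)).ξ := by
  rw [twist_ξ] at hf hg
  have h := M.sends_comp_map M hg hf
  rw [← Category.assoc, ← Spec.map_comp] at h
  rw [twist_ξ]
  exact h

lemma sends_pow (M : Model k K) {g : Bir M.V} {σ : K ≃ₐ[k] K}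
    (hg : M.Sends g.map (M.twist σ).ξ) (n : ℕ) : M.Sends (g ^ n).map (M.twist (σ ^ n)).ξ := by
  induction n with
  | zero =>
    rw [pow_zero, pow_zero, twist_one_ξ]
    exact M.sends_id
  | succ n ih =>
    rw [pow_succ', pow_succ]
    exact M.sends_mul hg ih

lemma sends_zpow (M : Model k K) {g : Bir M.V} {σ : K ≃ₐ[k] K}
    (hg : M.Sends g.map (M.twist σ).ξ) (hg' : M.Sends g⁻¹.map (M.twist σ⁻¹).ξ) (n : ℤ) :
    M.Sends (g ^ n).map (M.twist (σ ^ n)).ξ := by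
  rcases Int.eq_nat_or_neg n with ⟨m, rfl | rfl⟩
  · rw [zpow_natCast, zpow_natCast]
    exact M.sends_pow hg m
  · rw [zpow_neg, zpow_natCast, ← inv_pow, zpow_neg, zpow_natCast, ← inv_pow]
    exact M.sends_pow hg' m

end Model

end Cremona

end

/-! ### Equal local rings give local isomorphisms -/

section

open AlgebraicGeometry CategoryTheory

namespace Cremona

lemma exists_ringEquiv_of_range_eq {A B K : Type*} [CommRing A] [CommRing B] [CommRing K]
    {f : A →+* K} {g : B →+* K} (hf : Function.Injective f) (hg : Function.Injective g)
    (h : f.range = g.range) : ∃ e : B ≃+* A, ∀ b, f (e b) = g b := by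
  let e1 : A ≃+* f.range := RingEquiv.ofBijective f.rangeRestrict
    ⟨fun x y hxy => hf (congrArg Subtype.val hxy), f.rangeRestrict_surjective⟩
  let e2 : B ≃+* g.range := RingEquiv.ofBijective g.rangeRestrict
    ⟨fun x y hxy => hg (congrArg Subtype.val hxy), g.rangeRestrict_surjective⟩
  refine ⟨(e2.trans (RingEquiv.subringCongr h.symm)).trans e1.symm, fun b => ?_⟩
  have : e1 (((e2.trans (RingEquiv.subringCongr h.symm)).trans e1.symm) b) =
      RingEquiv.subringCongr h.symm (e2 b) := by
    simp
  exact congrArg Subtype.val this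

namespace Model

variable {k K : Type u} [Field k] [Field K] [Algebra k K]

lemma isDominant_of_comp_eq_ξ (M : Model k K) {W : Scheme.{u}} (i : W ⟶ M.V.X) [IsOpenImmersion i]
    (l : Spec (CommRingCat.of K) ⟶ W) (hl : l ≫ i = M.ξ) : IsDominant l := by
  constructor
  rw [DenseRange, dense_iff_inter_open]
  intro U hU hne
  let t : Spec (CommRingCat.of K) := IsLocalRing.closedPoint K
  refine ⟨l t, ?_, ⟨_, rfl⟩⟩
  have h2 := M.ξ_mem t (U := i ''ᵁ ⟨U, hU⟩) (by
    obtain ⟨x, hx⟩ := hne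
    exact ⟨i x, x, hx, rfl⟩)
  rw [← hl, Scheme.Hom.comp_apply] at h2
  obtain ⟨y, hy, hyx⟩ := h2
  rwa [i.injective hyx] at hy

lemma isDominant_map_germ (M : Model k K) (x : M.V.X) : IsDominant (Spec.map (M.germ x)) := by
  constructor
  change DenseRange (PrimeSpectrum.comap (M.germ x).hom)
  exact PrimeSpectrum.denseRange_comap_iff_ker_le_nilRadical _ |>.2
    (by rw [(RingHom.injective_iff_ker_eq_bot _).1 (M.germ_injective x)]; exact bot_le)

/-- If the local rings at `x` and `y` coincide, then the identification of the fields of rational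
functions is defined as a partial map at `x`, with value `y`. -/
lemma exists_partialMap (M N : Model k K) {x : M.V.X} {y : N.V.X}
    (h : M.localRing x = N.localRing y) :
    ∃ (p : M.V.X.PartialMap N.V.X) (hx : x ∈ p.domain), M.Sends p.toRationalMap N.ξ ∧
      p.hom ≫ N.V.str = p.domain.ι ≫ M.V.str ∧ p.hom ⟨x, hx⟩ = y := by
  obtain ⟨e, he⟩ := exists_ringEquiv_of_range_eq (M.germ_injective x) (N.germ_injective y) h
  let θ : N.V.X.presheaf.stalk y ⟶ M.V.X.presheaf.stalk x := e.toCommRingCatIso.hom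
  have hθ : θ ≫ M.germ x = N.germ y := by
    ext b
    exact he b
  have hover : (Spec.map θ ≫ N.V.X.fromSpecStalk y) ≫ N.V.str =
      M.V.X.fromSpecStalk x ≫ M.V.str := by
    have := M.isDominant_map_germ x
    refine ext_of_isDominant (Spec.map (M.germ x)) ?_
    rw [← Category.assoc, ← Category.assoc, ← Category.assoc, ← Spec.map_comp, hθ,
      map_germ_fromSpecStalk, map_germ_fromSpecStalk, M.ξ_str, N.ξ_str]
  -- The identification of the local rings spreads out to an open neighbourhood of x because the
  -- target is of finite type.
  let p := Scheme.PartialMap.ofFromSpecStalk M.V.str N.V.str _ hover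
  have hx : x ∈ p.domain := Scheme.PartialMap.mem_domain_ofFromSpecStalk M.V.str N.V.str _ hover
  have hp : p.domain.fromSpecStalkOfMem x hx ≫ p.hom = Spec.map θ ≫ N.V.X.fromSpecStalk y :=
    Scheme.PartialMap.fromSpecStalkOfMem_ofFromSpecStalk M.V.str N.V.str _ hover
  refine ⟨p, hx, ?_, Scheme.PartialMap.ofFromSpecStalk_comp M.V.str N.V.str _ hover, ?_⟩
  · have h1 := M.sends_of_lift p (Spec.map (M.germ x) ≫ p.domain.fromSpecStalkOfMem x hx) (by
      rw [Category.assoc, Scheme.Opens.fromSpecStalkOfMem_ι, map_germ_fromSpecStalk])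
    rwa [Category.assoc, hp, ← Category.assoc, ← Spec.map_comp, hθ, map_germ_fromSpecStalk] at h1
  · let c : Spec (M.V.X.presheaf.stalk x) := IsLocalRing.closedPoint (M.V.X.presheaf.stalk x)
    have h1 : p.domain.fromSpecStalkOfMem x hx c = ⟨x, hx⟩ := by
      apply p.domain.ι.injective
      rw [← Scheme.Hom.comp_apply, Scheme.Opens.fromSpecStalkOfMem_ι]
      exact Scheme.fromSpecStalk_closedPoint
    rw [← h1, ← Scheme.Hom.comp_apply, hp, Scheme.Hom.comp_apply]
    have h2 : Spec.map θ c =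
        IsLocalRing.closedPoint (N.V.X.presheaf.stalk y) := by
      have : IsIso θ := inferInstanceAs (IsIso e.toCommRingCatIso.hom)
      have : IsLocalHom θ.hom := inferInstance
      exact IsLocalRing.comap_closedPoint θ.hom
    rw [h2]
    exact Scheme.fromSpecStalk_closedPoint

/-- The composition of two mutually inverse partial maps is the identity where it is defined. -/
lemma morphismRestrict_comp_hom (M N : Model k K) {p : M.V.X.PartialMap N.V.X}
    {q : N.V.X.PartialMap M.V.X} (hp : M.Sends p.toRationalMap N.ξ)
    (hq : N.Sends q.toRationalMap M.ξ) (hp' : p.hom ≫ N.V.str = p.domain.ι ≫ M.V.str)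
    (hq' : q.hom ≫ M.V.str = q.domain.ι ≫ N.V.str) :
    (p.hom ∣_ q.domain) ≫ q.hom = (p.hom ⁻¹ᵁ q.domain).ι ≫ p.domain.ι := by
  obtain ⟨l, h1, h2⟩ := M.exists_lift hp p rfl
  obtain ⟨m, h3, h4⟩ := N.exists_lift hq q rfl
  let l' : Spec (CommRingCat.of K) ⟶ p.hom ⁻¹ᵁ q.domain :=
    IsOpenImmersion.lift (p.hom ⁻¹ᵁ q.domain).ι l (by
      rintro _ ⟨t, rfl⟩
      rw [Scheme.Opens.range_ι]
      change p.hom (l t) ∈ q.domain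
      rw [← Scheme.Hom.comp_apply, h2]
      exact N.ξ_mem t q.dense_domain.nonempty)
  have hl' : l' ≫ (p.hom ⁻¹ᵁ q.domain).ι = l := IsOpenImmersion.lift_fac _ _ _
  have hm : l' ≫ p.hom ∣_ q.domain = m := by
    rw [← cancel_mono q.domain.ι, Category.assoc, morphismRestrict_ι, ← Category.assoc, hl', h2, h3]
  have : IsDominant l' := M.isDominant_of_comp_eq_ξ ((p.hom ⁻¹ᵁ q.domain).ι ≫ p.domain.ι) l' (by
    rw [← Category.assoc, hl', h1])
  refine ext_of_isDominant_of_isSeparated M.V.str ?_ l' ?_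
  · rw [Category.assoc, Category.assoc, hq', ← hp', ← Category.assoc, morphismRestrict_ι,
      Category.assoc]
  · rw [← Category.assoc, ← Category.assoc, hm, hl', h4, h1]

/-- A birational map is a local isomorphism at `x` if the local ring at `x` is the local ring at
some point of the target. -/
theorem notMem_exc (M N : Model k K) (φ : BirMap M.V N.V) (hφ : M.Sends φ.map N.ξ) {x : M.V.X}
    {y : N.V.X} (h : M.localRing x = N.localRing y) : x ∉ φ.exc := by
  obtain ⟨p, hx, hp, hp', hpx⟩ := M.exists_partialMap N h
  obtain ⟨q, hy, hq, hq', hqy⟩ := N.exists_partialMap M h.symm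
  have hpq := M.morphismRestrict_comp_hom N hp hq hp' hq'
  have hqp := N.morphismRestrict_comp_hom M hq hp hq' hp'
  -- The partial maps p and q restrict to mutually inverse isomorphisms between the places where
  -- each lands in the domain of the other; the first of these open sets contains x because p(x) =
  -- y.
  let P : (p.hom ⁻¹ᵁ q.domain : Scheme.Opens _).toScheme ⟶ q.hom ⁻¹ᵁ p.domain :=
    IsOpenImmersion.lift (q.hom ⁻¹ᵁ p.domain).ι (p.hom ∣_ q.domain) (by
      rintro _ ⟨t, rfl⟩
      rw [Scheme.Opens.range_ι]
      change q.hom ((p.hom ∣_ q.domain) t) ∈ p.domain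
      rw [← Scheme.Hom.comp_apply, hpq]
      exact t.1.2)
  let Q : (q.hom ⁻¹ᵁ p.domain : Scheme.Opens _).toScheme ⟶ p.hom ⁻¹ᵁ q.domain :=
    IsOpenImmersion.lift (p.hom ⁻¹ᵁ q.domain).ι (q.hom ∣_ p.domain) (by
      rintro _ ⟨t, rfl⟩
      rw [Scheme.Opens.range_ι]
      change p.hom ((q.hom ∣_ p.domain) t) ∈ q.domain
      rw [← Scheme.Hom.comp_apply, hqp]
      exact t.1.2)
  have hP : P ≫ (q.hom ⁻¹ᵁ p.domain).ι = p.hom ∣_ q.domain := IsOpenImmersion.lift_fac _ _ _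
  have hQ : Q ≫ (p.hom ⁻¹ᵁ q.domain).ι = q.hom ∣_ p.domain := IsOpenImmersion.lift_fac _ _ _
  have hPQ : P ≫ Q = 𝟙 _ := by
    rw [← cancel_mono (p.hom ⁻¹ᵁ q.domain).ι, ← cancel_mono p.domain.ι, Category.id_comp, ← hpq, ← hP]
    rw [Category.assoc P Q, hQ, Category.assoc, morphismRestrict_ι, Category.assoc]
  have hQP : Q ≫ P = 𝟙 _ := by
    rw [← cancel_mono (q.hom ⁻¹ᵁ p.domain).ι, ← cancel_mono q.domain.ι, Category.id_comp, ← hqp, ← hQ]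
    rw [Category.assoc Q P, hP, Category.assoc, morphismRestrict_ι, Category.assoc]
  have hiso : IsIso P := ⟨Q, hPQ, hQP⟩
  have hopen : IsOpenImmersion ((p.hom ⁻¹ᵁ q.domain).ι ≫ p.hom) := by
    rw [← morphismRestrict_ι, ← hP]
    infer_instance
  rw [BirMap.exc, Set.mem_ofPred_eq, not_not]
  have hx' : x ∈ p.domain.ι ''ᵁ (p.hom ⁻¹ᵁ q.domain) :=
    ⟨⟨x, hx⟩, by change p.hom ⟨x, hx⟩ ∈ q.domain; rwa [hpx], rfl⟩
  have hle : p.domain.ι ''ᵁ (p.hom ⁻¹ᵁ q.domain) ≤ p.domain := by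
    rintro _ ⟨t, -, rfl⟩
    exact t.2
  have h1 : M.V.X.homOfLE hle =
      (p.domain.ι.isoImage (p.hom ⁻¹ᵁ q.domain)).inv ≫ (p.hom ⁻¹ᵁ q.domain).ι := by
    rw [← cancel_mono p.domain.ι, Category.assoc, Scheme.homOfLE_ι]
    exact (Scheme.Hom.isoImage_inv_ι _ _).symm
  have h2 : IsOpenImmersion (M.V.X.homOfLE hle ≫ p.hom) := by
    rw [h1, Category.assoc]
    exact MorphismProperty.comp_mem @IsOpenImmersion
      (p.domain.ι.isoImage (p.hom ⁻¹ᵁ q.domain)).inv ((p.hom ⁻¹ᵁ q.domain).ι ≫ p.hom)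
      (IsOpenImmersion.of_isIso _) hopen
  refine ⟨p.restrict (p.domain.ι ''ᵁ (p.hom ⁻¹ᵁ q.domain))
    ((p.domain.ι ''ᵁ (p.hom ⁻¹ᵁ q.domain)).2.dense ⟨x, hx'⟩) hle, ?_, hx', h2⟩
  rw [Scheme.PartialMap.restrict_toRationalMap]
  exact M.sends_injective hp hφ

end Model

end Cremona

end

/-! ### Domination by proper models -/

section

open AlgebraicGeometry CategoryTheory Limits

namespace Cremona

/-- The scheme-theoretic image of an integral scheme is integral. -/
lemma isIntegral_image {X Y : Scheme.{u}} (f : X ⟶ Y) [QuasiCompact f] [IsIntegral X] :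
    IsIntegral f.image := by
  have : IrreducibleSpace f.image := by
    have h1 : IsIrreducible (Set.univ : Set f.image) := by
      rw [← f.toImage.denseRange.closure_range, ← Set.image_univ]
      exact (IrreducibleSpace.isIrreducible_univ X).image _ f.toImage.continuous.continuousOn |>.closure
    have := (irreducibleSpace_def _).2 h1
    exact this
  have : IsReduced f.image := by
    have (x : f.image) : _root_.IsReduced (f.image.presheaf.stalk x) := by
      constructor
      rintro a ⟨n, ha⟩
      obtain ⟨U, hxU, s, rfl⟩ := f.image.presheaf.exists_germ_eq a
      rw [← map_pow, ← map_zero (f.image.presheaf.germ U x hxU).hom] at ha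
      obtain ⟨W, hxW, i, j, hW⟩ := f.image.presheaf.germ_eq x hxU hxU _ _ ha
      obtain ⟨_, ⟨_, ⟨V, hV, rfl⟩, rfl⟩, hxV, hVW⟩ :=
        (Y.isBasis_affineOpens.of_isInducing f.imageι.isEmbedding.isInducing).exists_subset_of_mem_open
          hxW W.2
      have hVU : f.imageι ⁻¹ᵁ V ≤ U := le_trans hVW i.le
      -- On affine opens, functions on the scheme-theoretic image inject into functions on X, which
      -- is reduced.
      have h2 : f.image.presheaf.map (homOfLE hVU).op s = 0 := by
        apply f.toImage_app_injective ⟨V, hV⟩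
        rw [map_zero]
        refine IsNilpotent.eq_zero ⟨n, ?_⟩
        have h3 : f.image.presheaf.map (homOfLE hVU).op (s ^ n) = 0 := by
          have h4 := congrArg (f.image.presheaf.map (homOfLE hVW : f.imageι ⁻¹ᵁ V ⟶ W).op) hW
          rw [map_zero, map_zero, ← ConcreteCategory.comp_apply, ← Functor.map_comp] at h4
          exact h4
        rw [← map_pow, ← map_pow]
        exact (congrArg _ h3).trans (map_zero _)
      rw [← f.image.presheaf.germ_res_apply (homOfLE hVU) x hxV, h2, map_zero]
    exact isReduced_of_isReduced_stalk _
  exact isIntegral_of_irreducibleSpace_of_isReduced _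

namespace Model

variable {k K : Type u} [Field k] [Field K] [Algebra k K]

lemma germ_map (M N : Model k K) (π : M.V.X ⟶ N.V.X) (hπ : M.ξ ≫ π = N.ξ) (z : M.V.X) :
    π.stalkMap z ≫ M.germ z = N.germ (π z) := by
  apply N.eq_germ
  rw [Spec.map_comp, Category.assoc, Scheme.SpecMap_stalkMap_fromSpecStalk, ← Category.assoc,
    map_germ_fromSpecStalk, hπ]

lemma localRing_map_le (M N : Model k K) (π : M.V.X ⟶ N.V.X) (hπ : M.ξ ≫ π = N.ξ) (z : M.V.X) :
    N.localRing (π z) ≤ M.localRing z := by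
  rw [localRing, localRing, ← M.germ_map N π hπ z]
  rintro _ ⟨s, rfl⟩
  exact ⟨π.stalkMap z s, rfl⟩

lemma exists_lift_of_valuationRing (M : Model k K) [IsProper M.V.str] (R : Type u) [CommRing R]
    [IsDomain R] (j : R →+* K) (hj : Function.Injective j)
    (hR : ∀ z : K, z ∈ j.range ∨ z⁻¹ ∈ j.range)
    (i : Spec (CommRingCat.of R) ⟶ Spec (CommRingCat.of k))
    (hi : Spec.map (CommRingCat.ofHom j) ≫ i = Spec.map (CommRingCat.ofHom (algebraMap k K))) :
    ∃ c : Spec (CommRingCat.of R) ⟶ M.V.X, Spec.map (CommRingCat.ofHom j) ≫ c = M.ξ ∧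
      c ≫ M.V.str = i := by
  let : Algebra R K := j.toAlgebra
  have : FaithfulSMul R K := (faithfulSMul_iff_algebraMap_injective R K).2 hj
  have : IsFractionRing R K := IsFractionRing.of_field R K fun z => by
    rcases hR z with ⟨a, ha⟩ | ⟨a, ha⟩
    · exact ⟨a, 1, by rw [map_one, div_one]; exact ha.symm⟩
    · refine ⟨1, a, ?_⟩
      rw [map_one, one_div, eq_comm, inv_eq_iff_eq_inv]
      exact ha
  have : ValuationRing R := (ValuationRing.iff_isInteger_or_isInteger R K).2 hR
  have hval : ValuativeCriterion.Existence M.V.str := by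
    have : UniversallyClosed M.V.str := inferInstance
    rw [UniversallyClosed.eq_valuativeCriterion] at this
    exact this.1
  obtain ⟨⟨l⟩⟩ := hval ⟨R, K, M.ξ, i, ⟨by rw [M.ξ_str]; exact hi.symm⟩⟩
  exact ⟨l.l, l.fac_left, l.fac_right⟩

/-- If `M` is proper and maps to `N`, then every valuation ring among the local rings of `N` is a
local ring of `M`. -/
theorem exists_localRing_eq (M N : Model k K) [IsProper M.V.str] (π : M.V.X ⟶ N.V.X)
    (hπ : M.ξ ≫ π = N.ξ) (hπ' : π ≫ N.V.str = M.V.str) (x : N.V.X)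
    (hx : ∀ z : K, z ∈ N.localRing x ∨ z⁻¹ ∈ N.localRing x) :
    ∃ z, M.localRing z = N.localRing x := by
  -- The valuative criterion extends the generic point of M over the valuation ring at x. The sought
  -- point z is the image of the closed point.
  obtain ⟨c, hc1, hc2⟩ : ∃ c : Spec (N.V.X.presheaf.stalk x) ⟶ M.V.X,
      Spec.map (N.germ x) ≫ c = M.ξ ∧ c ≫ M.V.str = N.V.X.fromSpecStalk x ≫ N.V.str := by
    refine M.exists_lift_of_valuationRing (N.V.X.presheaf.stalk x) (N.germ x).hom
      (N.germ_injective x) hx (N.V.X.fromSpecStalk x ≫ N.V.str) ?_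
    rw [← Category.assoc, ← N.ξ_str]
    exact congrArg (· ≫ N.V.str) (N.map_germ_fromSpecStalk x)
  have hcπ : c ≫ π = N.V.X.fromSpecStalk x := by
    have := N.isDominant_map_germ x
    refine ext_of_isDominant_of_isSeparated N.V.str ?_ (Spec.map (N.germ x)) ?_
    · rw [Category.assoc, hπ', hc2]
    · rw [← Category.assoc, hc1, hπ, map_germ_fromSpecStalk]
  let t : Spec (N.V.X.presheaf.stalk x) := IsLocalRing.closedPoint (N.V.X.presheaf.stalk x)
  refine ⟨c t, le_antisymm ?_ ?_⟩
  · have h1 : Scheme.stalkClosedPointTo c ≫ N.germ x = M.germ (c t) := by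
      apply M.eq_germ
      rw [Spec.map_comp, Category.assoc]
      rw [Scheme.Spec_stalkClosedPointTo_fromSpecStalk, hc1]
    rw [localRing, localRing, ← h1]
    rintro _ ⟨s, rfl⟩
    exact ⟨Scheme.stalkClosedPointTo c s, rfl⟩
  · have h2 : π (c t) = x := by
      rw [← Scheme.Hom.comp_apply, hcπ]
      exact Scheme.fromSpecStalk_closedPoint
    have h3 := M.localRing_map_le N π hπ (c t)
    rwa [h2] at h3

/-- Two proper models are dominated by a third one. -/
theorem exists_isProper_and_maps (M N : Model k K) [IsProper M.V.str] [IsProper N.V.str] :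
    ∃ (L : Model k K) (_ : IsProper L.V.str) (π : L.V.X ⟶ M.V.X) (ρ : L.V.X ⟶ N.V.X),
      L.ξ ≫ π = M.ξ ∧ π ≫ M.V.str = L.V.str ∧ L.ξ ≫ ρ = N.ξ ∧ ρ ≫ N.V.str = L.V.str := by
  -- The dominating model is the closure of the common generic point in the fibre product, a
  -- birational correspondence between M and N.
  let ζ : Spec (CommRingCat.of K) ⟶ pullback M.V.str N.V.str :=
    pullback.lift M.ξ N.ξ (by rw [M.ξ_str, N.ξ_str])
  have : QuasiCompact (ζ ≫ pullback.fst M.V.str N.V.str ≫ M.V.str) := inferInstance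
  have : QuasiCompact ζ := QuasiCompact.of_comp ζ (pullback.fst M.V.str N.V.str ≫ M.V.str)
  have : IsIntegral ζ.image := isIntegral_image ζ
  have hprop : IsProper (ζ.imageι ≫ pullback.fst M.V.str N.V.str ≫ M.V.str) := inferInstance
  let V : Variety k :=
    { X := ζ.image
      str := ζ.imageι ≫ pullback.fst M.V.str N.V.str ≫ M.V.str
      isIntegral := inferInstance
      isSeparated := inferInstance
      locallyOfFiniteType := inferInstance
      quasiCompact := inferInstance }
  let π : V.X ⟶ M.V.X := ζ.imageι ≫ pullback.fst M.V.str N.V.str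
  let ρ : V.X ⟶ N.V.X := ζ.imageι ≫ pullback.snd M.V.str N.V.str
  have hπ : ζ.toImage ≫ π = M.ξ := by
    rw [← Category.assoc, Scheme.Hom.toImage_imageι]
    exact pullback.lift_fst _ _ _
  have hρ : ζ.toImage ≫ ρ = N.ξ := by
    rw [← Category.assoc, Scheme.Hom.toImage_imageι]
    exact pullback.lift_snd _ _ _
  have hπ' : π ≫ M.V.str = V.str := Category.assoc _ _ _
  have hρ' : ρ ≫ N.V.str = V.str := by
    change (ζ.imageι ≫ pullback.snd M.V.str N.V.str) ≫ N.V.str =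
      ζ.imageι ≫ pullback.fst M.V.str N.V.str ≫ M.V.str
    rw [pullback.condition, Category.assoc]
  have hdom : IsDominant (X := Spec (CommRingCat.of K)) (Y := V.X) ζ.toImage :=
    inferInstanceAs (IsDominant ζ.toImage)
  obtain ⟨e, he⟩ := exists_iso_functionField V.X ζ.toImage (by
    intro τ hτ z
    have hgen : π (genericPoint V.X) = genericPoint M.V.X := by
      have : IsDominant π := by
        have : IsDominant (ζ.toImage ≫ π) := by rw [hπ]; infer_instance
        exact IsDominant.of_comp ζ.toImage π
      refine IsGenericPoint.eq ?_ (genericPoint_spec M.V.X)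
      have h1 := (genericPoint_spec V.X).image π.continuous
      rwa [Set.image_univ, π.denseRange.closure_range] at h1
    have h2 : M.germ (π (genericPoint V.X)) = π.stalkMap (genericPoint V.X) ≫ τ := by
      symm
      apply M.eq_germ
      rw [Spec.map_comp, Category.assoc, Scheme.SpecMap_stalkMap_fromSpecStalk, ← Category.assoc,
        hτ, hπ]
    have h3 : ∀ x : M.V.X, x = genericPoint M.V.X → Function.Surjective (M.germ x).hom := by
      rintro x rfl
      have h4 : M.germ (genericPoint M.V.X) = M.e.hom := by
        rw [germ, TopCat.Presheaf.stalkSpecializes_refl, Category.id_comp]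
      rw [h4]
      exact ((ConcreteCategory.isIso_iff_bijective M.e.hom).1 inferInstance).2
    obtain ⟨s, hs⟩ := h3 _ hgen z
    rw [h2] at hs
    exact ⟨π.stalkMap (genericPoint V.X) s, hs⟩)
  let L : Model k K := ⟨V, e, by rw [he, ← hπ', ← Category.assoc, hπ, M.ξ_str]⟩
  have hL : L.ξ = ζ.toImage := he
  exact ⟨L, hprop, π, ρ, hL ▸ hπ, hπ', hL ▸ hρ, hρ'⟩

end Model

end Cremona

end

/-! ### Prime divisors and codimension -/

section

open AlgebraicGeometry CategoryTheory Limits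

namespace Cremona

/-- A point of codimension one of an irreducible scheme. -/
def IsPrimeDivisor {X : Scheme.{u}} [IrreducibleSpace X] (z : X) : Prop :=
  z ≠ genericPoint X ∧ ∀ y : X, y ⤳ z → y = z ∨ y = genericPoint X

/-- A point that is neither generic nor a prime divisor has a generization strictly between itself
and the generic point, hence coheight at least 2. -/
lemma one_lt_codim {X : Scheme.{u}} [IrreducibleSpace X] {Z : Set X}
    (h0 : genericPoint X ∉ Z) (h1 : ∀ z, IsPrimeDivisor z → z ∉ Z) : ((1 : ℕ) : ℕ∞) < codim Z := by
  have h2 : (2 : ℕ∞) ≤ codim Z := by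
    refine le_iInf₂ fun z hz => ?_
    have hz0 : z ≠ genericPoint X := by rintro rfl; exact h0 hz
    have hlt : ∀ a b : X, b ⤳ a → b ≠ a → a < b := fun a b h hne =>
      lt_of_le_not_ge h fun h' => hne (h.antisymm h').eq
    have h3 : ¬ IsPrimeDivisor z := fun h => h1 z h hz
    simp only [IsPrimeDivisor, not_and, not_forall, not_or] at h3
    obtain ⟨y, hyz, hyz', hy⟩ := h3 hz0
    have h4 := Order.coheight_add_one_le (hlt z y hyz hyz')
    have h5 := Order.coheight_add_one_le (hlt y _ (genericPoint_specializes y) (Ne.symm hy))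
    calc (2 : ℕ∞) = 0 + 1 + 1 := by norm_num
      _ ≤ Order.coheight (genericPoint X) + 1 + 1 := by gcongr; exact zero_le
      _ ≤ Order.coheight y + 1 := by gcongr
      _ ≤ _ := h4
  exact lt_of_lt_of_le (by norm_num) h2

lemma IsPrimeDivisor.of_isOpenImmersion {X Y : Scheme.{u}} [IrreducibleSpace X] [IrreducibleSpace Y]
    (f : X ⟶ Y) [IsOpenImmersion f] {z : X} (hz : IsPrimeDivisor z) : IsPrimeDivisor (f z) := by
  have hgen := genericPoint_eq_of_isOpenImmersion f
  refine ⟨fun h => hz.1 (f.injective (h.trans hgen.symm)), fun y hy => ?_⟩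
  obtain ⟨w, rfl⟩ := hy.mem_open f.opensRange.2 ⟨z, rfl⟩
  rcases hz.2 w ((f.isOpenEmbedding.isInducing.specializes_iff).1 hy) with rfl | rfl
  · exact Or.inl rfl
  · exact Or.inr hgen

lemma IsPrimeDivisor.of_map {X Y : Scheme.{u}} [IrreducibleSpace X] [IrreducibleSpace Y]
    (f : X ⟶ Y) [IsOpenImmersion f] {z : X} (hz : IsPrimeDivisor (f z)) : IsPrimeDivisor z := by
  have hgen := genericPoint_eq_of_isOpenImmersion f
  refine ⟨fun h => hz.1 (h ▸ hgen), fun y hy => ?_⟩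
  rcases hz.2 (f y) (hy.map f.continuous) with h | h
  · exact Or.inl (f.injective h)
  · exact Or.inr (f.injective (h.trans hgen.symm))

/-- A proper closed subset of an integral noetherian scheme contains only finitely many prime
divisors. -/
lemma finite_isPrimeDivisor_of_isClosed {X : Scheme.{u}} [IrreducibleSpace X]
    [TopologicalSpace.NoetherianSpace X] {Z : Set X} (hZ : IsClosed Z) (h : genericPoint X ∉ Z) :
    {z ∈ Z | IsPrimeDivisor z}.Finite := by
  classical
  -- A prime divisor in Z must be the generic point of an irreducible component of Z, since its only
  -- other generization lies outside Z.
  obtain ⟨S, hS, hSc, hSi, rfl⟩ := TopologicalSpace.NoetherianSpace.exists_finite_set_isClosed_irreducible hZ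
  let f : Set X → X := fun t => if ht : IsIrreducible t then ht.genericPoint else genericPoint X
  refine (hS.image f).subset ?_
  rintro z ⟨⟨t, htS, hzt⟩, hz⟩
  refine ⟨t, htS, ?_⟩
  have h1 : f t = (hSi t htS).genericPoint := dif_pos (hSi t htS)
  rw [h1]
  have h2 := (hSi t htS).isGenericPoint_genericPoint (hSc t htS)
  rcases hz.2 _ (h2.specializes hzt) with h3 | h3
  · exact h3
  · exact absurd ⟨t, htS, h3 ▸ h2.mem⟩ h

namespace Model

variable {k K : Type u} [Field k] [Field K] [Algebra k K]

instance (V : Variety k) : IsLocallyNoetherian V.X :=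
  LocallyOfFiniteType.isLocallyNoetherian V.str

instance (V : Variety k) : TopologicalSpace.NoetherianSpace V.X := by
  have : CompactSpace V.X := QuasiCompact.compactSpace_of_compactSpace V.str
  have : IsNoetherian V.X := {}
  infer_instance

lemma localRing_le_of_specializes (M : Model k K) {x y : M.V.X} (h : y ⤳ x) :
    M.localRing x ≤ M.localRing y := by
  have h1 : M.V.X.presheaf.stalkSpecializes h ≫ M.germ y = M.germ x := by
    apply M.eq_germ
    rw [Spec.map_comp, Category.assoc, Scheme.SpecMap_stalkSpecializes_fromSpecStalk,
      map_germ_fromSpecStalk]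
  rw [localRing, localRing, ← h1]
  rintro _ ⟨s, rfl⟩
  exact ⟨_, rfl⟩

lemma localRing_genericPoint (M : Model k K) : M.localRing (genericPoint M.V.X) = ⊤ := by
  have h4 : M.germ (genericPoint M.V.X) = M.e.hom := by
    rw [germ, TopCat.Presheaf.stalkSpecializes_refl, Category.id_comp]
  rw [localRing, h4, eq_top_iff]
  exact fun z _ => ((ConcreteCategory.isIso_iff_bijective M.e.hom).1 inferInstance).2 z

/-- This is where separatedness enters: the partial map identifying the two local rings agrees with
the inclusion at the generic point, hence everywhere on its domain. -/
lemma localRing_injective (M : Model k K) : Function.Injective M.localRing := by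
  intro x y h
  obtain ⟨p, hx, hp, hp', rfl⟩ := M.exists_partialMap M h
  obtain ⟨l, h1, h2⟩ := M.exists_lift hp p rfl
  have := M.isDominant_of_comp_eq_ξ p.domain.ι l h1
  have h3 : p.hom = p.domain.ι :=
    ext_of_isDominant_of_isSeparated M.V.str hp' l (h2.trans h1.symm)
  rw [h3]
  rfl

lemma localRing_map_eq (M N : Model k K) (π : M.V.X ⟶ N.V.X) [IsOpenImmersion π]
    (hπ : M.ξ ≫ π = N.ξ) (z : M.V.X) : N.localRing (π z) = M.localRing z := by
  refine le_antisymm (M.localRing_map_le N π hπ z) ?_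
  have h1 : inv (π.stalkMap z) ≫ N.germ (π z) = M.germ z := by
    rw [← M.germ_map N π hπ z, IsIso.inv_hom_id_assoc]
  rw [localRing, localRing, ← h1]
  rintro _ ⟨s, rfl⟩
  exact ⟨inv (π.stalkMap z) s, rfl⟩

/-- A nonempty open subscheme of a model. -/
lemma exists_open (M : Model k K) (U : M.V.X.Opens) (hU : genericPoint M.V.X ∈ U) :
    ∃ (N : Model k K) (j : N.V.X ≅ U.toScheme), N.ξ ≫ j.hom ≫ U.ι = M.ξ := by
  have : Nonempty U := ⟨⟨_, hU⟩⟩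
  let V : Variety k :=
    { X := U.toScheme
      str := U.ι ≫ M.V.str
      isIntegral := inferInstance
      isSeparated := inferInstance
      locallyOfFiniteType := inferInstance
      quasiCompact := inferInstance }
  let l : Spec (CommRingCat.of K) ⟶ V.X := IsOpenImmersion.lift U.ι M.ξ (by
    rintro _ ⟨t, rfl⟩
    rw [Scheme.Opens.range_ι]
    exact M.ξ_mem t ⟨_, hU⟩)
  have hl : l ≫ U.ι = M.ξ := IsOpenImmersion.lift_fac _ _ _
  have hdom : IsDominant l := M.isDominant_of_comp_eq_ξ U.ι l hl
  obtain ⟨e, he⟩ := exists_iso_functionField V.X l (by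
    intro τ hτ z
    let g : U.toScheme := genericPoint V.X
    have hgen : U.ι g = genericPoint M.V.X := genericPoint_eq_of_isOpenImmersion U.ι
    have h2 : U.ι.stalkMap g ≫ τ = M.germ (U.ι g) := by
      apply M.eq_germ
      rw [Spec.map_comp, Category.assoc, Scheme.SpecMap_stalkMap_fromSpecStalk, ← Category.assoc,
        ← hl, ← hτ]
    have h3 : z ∈ M.localRing (U.ι g) := by
      rw [hgen, localRing_genericPoint]
      trivial
    obtain ⟨s, hs⟩ := h3
    rw [← h2] at hs
    exact ⟨U.ι.stalkMap g s, hs⟩)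
  let N : Model k K := ⟨V, e, by rw [he, ← M.ξ_str, ← hl, Category.assoc]⟩
  have hN : N.ξ = l := he
  exact ⟨N, Iso.refl _, by rw [hN]; simpa using hl⟩

end Model

end Cremona

end

/-! ### Pseudo-regularization from an invariant set of valuation rings -/

section

open AlgebraicGeometry CategoryTheory Limits

namespace Cremona

namespace Model

variable {k K : Type u} [Field k] [Field K] [Algebra k K]

/-- A proper model dominating `M` and finitely many of its twists. -/
lemma exists_isProper_and_maps_twist (M : Model k K) [hM : IsProper M.V.str]
    (T : List (K ≃ₐ[k] K)) :
    ∃ (L : Model k K) (_ : IsProper L.V.str), ∀ τ ∈ 1 :: T, ∃ π : L.V.X ⟶ M.V.X,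
      L.ξ ≫ π = (M.twist τ).ξ ∧ π ≫ M.V.str = L.V.str := by
  induction T with
  | nil =>
    refine ⟨M, hM, fun τ hτ => ⟨𝟙 _, ?_, Category.id_comp _⟩⟩
    rw [List.mem_singleton] at hτ
    rw [hτ, twist_one_ξ, Category.comp_id]
  | cons τ T ih =>
    obtain ⟨L, hL, h⟩ := ih
    have hτ : IsProper (M.twist τ).V.str := hM
    obtain ⟨L', hL', π, ρ, h1, h2, h3, h4⟩ := L.exists_isProper_and_maps (M.twist τ)
    refine ⟨L', hL', fun τ' hτ' => ?_⟩
    by_cases hmem : τ' ∈ 1 :: T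
    · obtain ⟨π', h5, h6⟩ := h τ' hmem
      exact ⟨π ≫ π', by rw [← Category.assoc, h1, h5], by rw [Category.assoc, h6, h2]⟩
    · have : τ' = τ := by
        simp only [List.mem_cons, not_or] at hτ' hmem
        tauto
      subst this
      exact ⟨ρ, h3, h4⟩

/-- Up to finitely many exceptions, the prime divisors of two models have the same local rings. -/
lemma finite_isPrimeDivisor_notMem (L M : Model k K) {S : Set (Subring K)} {U : M.V.X.Opens}
    (hU : genericPoint M.V.X ∈ U) (hS : ∀ x ∈ U, IsPrimeDivisor x → M.localRing x ∈ S)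
    {S' : Set (Subring K)} (hfin : (S \ S').Finite) :
    {z | IsPrimeDivisor z ∧ L.localRing z ∉ S'}.Finite := by
  obtain ⟨φ, hφ, -⟩ := L.exists_birMap M
  have hgen : genericPoint L.V.X ∉ φ.exc :=
    L.notMem_exc M φ hφ (y := genericPoint M.V.X)
      (by rw [localRing_genericPoint, localRing_genericPoint])
  rw [BirMap.exc, Set.mem_ofPred_eq, not_not] at hgen
  obtain ⟨p, hp, hgenp, hopen⟩ := hgen
  obtain ⟨l, hl1, hl2⟩ := L.exists_lift hφ p hp
  obtain ⟨N, j, hN1⟩ := L.exists_open p.domain hgenp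
  let i : N.V.X ⟶ L.V.X := j.hom ≫ p.domain.ι
  let q : N.V.X ⟶ M.V.X := j.hom ≫ p.hom
  have hi : N.ξ ≫ i = L.ξ := hN1
  have hq : N.ξ ≫ q = M.ξ := by
    have h1 : N.ξ ≫ j.hom = l := by
      rw [← cancel_mono p.domain.ι, Category.assoc, hl1]
      exact hi
    rw [← Category.assoc, h1, hl2]
  -- On W the models L and M are isomorphic to open pieces of each other and the divisors have local
  -- rings in S. Only finitely many divisors lie off W, and those in W with ring outside S' inject
  -- into S \ S'.
  let W : L.V.X.Opens := i ''ᵁ (q ⁻¹ᵁ U)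
  have hW : genericPoint L.V.X ∈ W := by
    refine ⟨genericPoint N.V.X, ?_, genericPoint_eq_of_isOpenImmersion i⟩
    change q (genericPoint N.V.X) ∈ U
    rwa [genericPoint_eq_of_isOpenImmersion q]
  have h1 := finite_isPrimeDivisor_of_isClosed (Z := (W : Set L.V.X)ᶜ) W.2.isClosed_compl
    (fun h => h hW)
  have h2 : (L.localRing ⁻¹' (S \ S')).Finite := hfin.preimage L.localRing_injective.injOn
  refine (h1.union h2).subset ?_
  rintro z ⟨hz, hzS⟩
  by_cases hzW : z ∈ W
  · right
    refine ⟨?_, hzS⟩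
    obtain ⟨w, hw, rfl⟩ := hzW
    refine (congrArg (· ∈ S) (N.localRing_map_eq L i hi w)).mpr ?_
    rw [← N.localRing_map_eq M q hq]
    exact hS _ hw ((IsPrimeDivisor.of_map i hz).of_isOpenImmersion q)
  · exact Or.inl ⟨hzW, hz⟩

/-- If the set of local rings of prime divisors of `M` agrees up to a finite set with a set of
valuation rings invariant under `σ`, there is a model whose prime divisors have local
rings in this invariant set, and on which all elements of it occur. -/
theorem exists_model_of_invariant (M : Model k K) [IsProper M.V.str] {S S' : Set (Subring K)}
    (σ : K ≃ₐ[k] K) (hS : ∀ R ∈ S, ∃ x, M.localRing x = R)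
    (hval : ∀ R ∈ S, ∀ z : K, z ∈ R ∨ z⁻¹ ∈ R)
    (hmax : ∀ R ∈ S, ∀ T : Subring K, R ≤ T → T ≠ ⊤ → T = R)
    {U : M.V.X.Opens} (hU : genericPoint M.V.X ∈ U)
    (hUS : ∀ x ∈ U, IsPrimeDivisor x → M.localRing x ∈ S)
    (h1 : (S \ S').Finite) (h2 : (S' \ S).Finite)
    (h3 : ∀ R ∈ S', ∃ j : ℤ, mapSubring (σ ^ j) R ∈ S) :
    ∃ Y : Model k K, (∀ R ∈ S', ∃ y, Y.localRing y = R) ∧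
      ∀ y, IsPrimeDivisor y → Y.localRing y ∈ S' := by
  have hmap : ∀ (τ : K ≃ₐ[k] K) (R : Subring K), mapSubring τ⁻¹ (mapSubring τ R) = R := fun τ R => by
    rw [← mapSubring_mul, inv_mul_cancel, mapSubring_one]
  -- Every R in S' is the image of an element of S under a power of σ, so R inherits maximality, and
  -- a twist of M by that power has R as a local ring.
  choose! j hj using h3
  have hmax' : ∀ R ∈ S', ∀ T : Subring K, R ≤ T → T ≠ ⊤ → T = R := by
    intro R hR T hRT hT
    have h4 := hmax _ (hj R hR) (mapSubring (σ ^ j R) T) (by rintro _ ⟨z, hz, rfl⟩; exact ⟨z, hRT hz, rfl⟩) (fun h => hT (by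
      rw [← hmap (σ ^ j R) T, h, eq_top_iff]
      intro z _
      exact ⟨(σ ^ j R) z, trivial, (σ ^ j R).symm_apply_apply z⟩))
    rw [← hmap (σ ^ j R) T, h4, hmap]
  -- Only the finitely many R in S' \ S require a twist; those in S already occur on M.
  obtain ⟨L, hL, hdom⟩ := M.exists_isProper_and_maps_twist
    (h2.toFinset.toList.map fun R => (σ ^ j R)⁻¹)
  have htw : ∀ τ ∈ (1 : K ≃ₐ[k] K) :: h2.toFinset.toList.map fun R => (σ ^ j R)⁻¹, ∀ R ∈ S,
      ∃ z, L.localRing z = mapSubring τ R := by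
    intro τ hτ R hR
    obtain ⟨π, hπ, hπ'⟩ := hdom τ hτ
    obtain ⟨x, hx⟩ := hS R hR
    have hx' : (M.twist τ).localRing x = mapSubring τ R := by
      rw [← hx]
      exact M.twist_localRing τ x
    rw [← hx']
    refine L.exists_localRing_eq (M.twist τ) π hπ hπ' x fun z => ?_
    rw [hx']
    rcases hval R hR (τ.symm z) with h | h
    · exact Or.inl ⟨_, h, τ.apply_symm_apply z⟩
    · exact Or.inr ⟨_, h, by simp⟩
  have hS'L : ∀ R ∈ S', ∃ z, L.localRing z = R := by
    intro R hR
    by_cases hRS : R ∈ S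
    · obtain ⟨z, hz⟩ := htw 1 List.mem_cons_self R hRS
      exact ⟨z, by rw [hz, mapSubring_one]⟩
    · obtain ⟨z, hz⟩ := htw (σ ^ j R)⁻¹ (List.mem_cons_of_mem _ (List.mem_map_of_mem (by
        rw [Finset.mem_toList, Set.Finite.mem_toFinset]
        exact ⟨hR, hRS⟩))) _ (hj R hR)
      exact ⟨z, by rw [hz, hmap]⟩
  have hB := L.finite_isPrimeDivisor_notMem M hU hUS h1
  set B : Set L.V.X := {z | IsPrimeDivisor z ∧ L.localRing z ∉ S'} with hBdef
  -- W is L with the finitely many unwanted divisors removed.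
  let W : L.V.X.Opens := ⟨(⋃ b ∈ B, closure {b})ᶜ,
    (hB.isClosed_biUnion fun b _ => isClosed_closure).isOpen_compl⟩
  have hWmem : ∀ z, z ∈ W ↔ ∀ b ∈ B, ¬ b ⤳ z := fun z => by
    change z ∈ (⋃ b ∈ B, closure {b})ᶜ ↔ _
    simp only [Set.mem_compl_iff, Set.mem_iUnion, not_exists, specializes_iff_mem_closure]
  have hgenW : genericPoint L.V.X ∈ W := by
    rw [hWmem]
    intro b hb h
    exact hb.1.1 (h.antisymm (genericPoint_specializes b)).eq
  obtain ⟨Y, jY, hY1⟩ := L.exists_open W hgenW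
  let i : Y.V.X ⟶ L.V.X := jY.hom ≫ W.ι
  have hi : Y.ξ ≫ i = L.ξ := hY1
  have hrange : ∀ z ∈ W, ∃ y, i y = z := fun z hz =>
    ⟨jY.inv (⟨z, hz⟩ : W), by
      let w : W.toScheme := ⟨z, hz⟩
      change (jY.inv ≫ jY.hom ≫ W.ι) w = z
      rw [Iso.inv_hom_id_assoc]
      rfl⟩
  have hrange' : ∀ y, i y ∈ W := fun y => (jY.hom y).2
  refine ⟨Y, fun R hR => ?_, fun y hy => ?_⟩
  · obtain ⟨z, rfl⟩ := hS'L R hR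
    obtain ⟨y, rfl⟩ := hrange z (by
      rw [hWmem]
      intro b hb hbz
      -- No point with local ring R in S' is lost: an unwanted divisor b through it would have a
      -- proper local ring containing R, hence equal to R by maximality, contrary to the choice of
      -- b.
      have h5 := hmax' _ hR _ (L.localRing_le_of_specializes hbz) (fun h => by
        exact hb.1.1 (L.localRing_injective (h.trans L.localRing_genericPoint.symm)))
      exact hb.2 (h5 ▸ hR))
    exact ⟨y, (Y.localRing_map_eq L i hi y).symm⟩
  · by_contra hyS
    refine (hWmem _).1 (hrange' y) (i y) ⟨IsPrimeDivisor.of_isOpenImmersion i hy, ?_⟩ specializes_rfl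
    rwa [Y.localRing_map_eq L i hi]

/-- If the set of local rings of prime divisors of `M` agrees up to a finite set with an invariant
set of valuation rings, then `g` is pseudo-regularizable. -/
theorem isPseudoRegularizable_of_invariant (M : Model k K) [IsProper M.V.str]
    {S S' : Set (Subring K)} {σ : K ≃ₐ[k] K} (hS : ∀ R ∈ S, ∃ x, M.localRing x = R)
    (hval : ∀ R ∈ S, ∀ z : K, z ∈ R ∨ z⁻¹ ∈ R)
    (hmax : ∀ R ∈ S, ∀ T : Subring K, R ≤ T → T ≠ ⊤ → T = R)
    {U : M.V.X.Opens} (hU : genericPoint M.V.X ∈ U)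
    (hUS : ∀ x ∈ U, IsPrimeDivisor x → M.localRing x ∈ S)
    (h1 : (S \ S').Finite) (h2 : (S' \ S).Finite)
    (h3 : ∀ R ∈ S', ∃ j : ℤ, mapSubring (σ ^ j) R ∈ S)
    (h4 : ∀ (j : ℤ), ∀ R ∈ S', mapSubring (σ ^ j) R ∈ S')
    {g : Bir M.V} (hg : M.Sends g.map (M.twist σ).ξ) (hg' : M.Sends g⁻¹.map (M.twist σ⁻¹).ξ) :
    IsPseudoRegularizable (Subgroup.zpowers g) := by
  obtain ⟨Y, hY1, hY2⟩ := M.exists_model_of_invariant σ hS hval hmax hU hUS h1 h2 h3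
  obtain ⟨f, hf, hf'⟩ := M.exists_birMap Y
  have hsends : ∀ n : ℤ, Y.Sends ((f.symm.trans (g ^ n)).trans f).map (Y.twist (σ ^ n)).ξ := by
    intro n
    have h5 := M.sends_zpow hg hg' n
    rw [twist_ξ] at h5 ⊢
    exact Y.sends_comp_map M (Y.sends_comp M hf' h5) hf
  have hsends' : ∀ n : ℤ,
      Y.Sends ((f.symm.trans (g ^ n)).trans f).symm.map (Y.twist (σ ^ (-n))).ξ := by
    intro n
    have h5 : ((f.symm.trans (g ^ n)).trans f).symm.map =
        ((f.symm.trans (g ^ (-n))).trans f).map := by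
      rw [zpow_neg]
      exact (Scheme.RationalMap.comp_assoc _ _ _).symm
    rw [h5]
    exact hsends (-n)
  have hcodim : ∀ (n : ℤ) (ψ : Bir Y.V), Y.Sends ψ.map (Y.twist (σ ^ n)).ξ →
      ((1 : ℕ) : ℕ∞) < codim ψ.exc := by
    intro n ψ hψ
    refine one_lt_codim ?_ fun z hz => ?_
    · refine Y.notMem_exc (Y.twist (σ ^ n)) ψ hψ (y := genericPoint Y.V.X) ?_
      rw [localRing_genericPoint]
      exact ((Y.twist (σ ^ n)).localRing_genericPoint).symm
    · obtain ⟨y, hy⟩ := hY1 _ (h4 (-n) _ (hY2 z hz))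
      refine Y.notMem_exc (Y.twist (σ ^ n)) ψ hψ (y := y) ?_
      have h6 := Y.twist_localRing (σ ^ n) y
      refine Eq.trans ?_ h6.symm
      rw [hy]
      change _ = mapSubring (σ ^ n) (mapSubring (σ ^ (-n)) (Y.localRing z))
      rw [← mapSubring_mul, ← zpow_add, add_neg_cancel, zpow_zero, mapSubring_one]
  refine ⟨Y.V, f, ?_⟩
  rintro _ ⟨n, rfl⟩
  exact ⟨hcodim n _ (hsends n), hcodim (-n) _ (hsends' n)⟩

end Model

end Cremona

end

/-! ### Homogeneous polynomials and dehomogenization -/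

section

open MvPolynomial

namespace Cremona

section Homogeneous

variable {R S σ : Type*} [CommSemiring R] [CommSemiring S]

lemma eval₂_mul_of_isHomogeneous {F : MvPolynomial σ R} {n : ℕ} (hF : F.IsHomogeneous n)
    (f : R →+* S) (c : S) (g : σ → S) :
    eval₂ f (fun i => c * g i) F = c ^ n * eval₂ f g F := by
  rw [eval₂_eq, eval₂_eq, Finset.mul_sum]
  refine Finset.sum_congr rfl fun s hs => ?_
  simp only [mul_pow, Finset.prod_mul_distrib]
  rw [Finset.prod_pow_eq_pow_sum, hF.degree_eq_sum_deg_support hs]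
  ring

/-- A factor of a nonzero homogeneous polynomial is homogeneous. -/
lemma exists_isHomogeneous_of_mul {R : Type*} [CommRing R] [IsDomain R]
    {P Q : MvPolynomial σ R} {n : ℕ}
    (h : (P * Q).IsHomogeneous n) (hP : P ≠ 0) (hQ : Q ≠ 0) : ∃ a, P.IsHomogeneous a := by
  let f : R →+* Polynomial (MvPolynomial σ R) := Polynomial.C.comp C
  -- φ substitutes T·xᵢ for xᵢ, so the coefficient of Tᵐ is the component of degree m, and a
  -- polynomial is homogeneous when its image is a monomial in T.
  let φ : MvPolynomial σ R →+* Polynomial (MvPolynomial σ R) :=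
    eval₂Hom f fun i => Polynomial.X * Polynomial.C (X i)
  have hφ : ∀ (F : MvPolynomial σ R) (m : ℕ), F.IsHomogeneous m →
      φ F = Polynomial.X ^ m * Polynomial.C F := fun F m hF => by
    have h2 : eval₂ f (fun i => Polynomial.C (X i)) F = Polynomial.C F := by
      have h3 : (eval₂Hom f fun i => Polynomial.C (X i)) = (Polynomial.C : MvPolynomial σ R →+* _) := by
        apply ringHom_ext
        · intro r
          simp [f]
        · intro i
          simp
      exact congrArg (fun g => g F) h3
    have h1 := eval₂_mul_of_isHomogeneous hF f Polynomial.X (fun i => Polynomial.C (X i))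
    rw [h2] at h1
    exact h1
  have hcoeff : ∀ (F : MvPolynomial σ R) (m : ℕ), (φ F).coeff m = homogeneousComponent m F := by
    intro F m
    conv_lhs => rw [← sum_homogeneousComponent F]
    rw [map_sum, Polynomial.finsetSum_coeff]
    have h1 : ∀ i ∈ Finset.range (F.totalDegree + 1), (φ (homogeneousComponent i F)).coeff m =
        if m = i then homogeneousComponent m F else 0 := fun i _ => by
      rw [hφ _ i (homogeneousComponent_isHomogeneous i F), mul_comm, Polynomial.coeff_C_mul_X_pow]
      split_ifs with hmi
      · rw [hmi]
      · rfl
    rw [Finset.sum_congr rfl h1, Finset.sum_ite_eq]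
    split_ifs with hm
    · rfl
    · rw [homogeneousComponent_eq_zero]
      simpa using hm
  have hinj : ∀ F, φ F = 0 → F = 0 := fun F hF => by
    rw [← sum_homogeneousComponent F]
    refine Finset.sum_eq_zero fun i _ => ?_
    rw [← hcoeff, hF, Polynomial.coeff_zero]
  have hPφ : φ P ≠ 0 := fun h => hP (hinj _ h)
  have hQφ : φ Q ≠ 0 := fun h => hQ (hinj _ h)
  have h1 := hφ _ n h
  rw [map_mul] at h1
  have hPQ : (Polynomial.C (P * Q) : Polynomial (MvPolynomial σ R)) ≠ 0 :=
    Polynomial.C_ne_zero.2 (mul_ne_zero hP hQ)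
  have h2 := congrArg Polynomial.natDegree h1
  have h3 := congrArg Polynomial.natTrailingDegree h1
  rw [Polynomial.natDegree_mul hPφ hQφ, Polynomial.natDegree_mul (pow_ne_zero _ Polynomial.X_ne_zero) hPQ,
    Polynomial.natDegree_X_pow, Polynomial.natDegree_C] at h2
  rw [Polynomial.natTrailingDegree_mul hPφ hQφ,
    Polynomial.natTrailingDegree_mul (pow_ne_zero _ Polynomial.X_ne_zero) hPQ,
    Polynomial.natTrailingDegree_X_pow, Polynomial.natTrailingDegree_C] at h3
  have h4 := Polynomial.natTrailingDegree_le_natDegree (φ P)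
  have h5 := Polynomial.natTrailingDegree_le_natDegree (φ Q)
  -- Degree and trailing degree are additive over a domain. They agree for the product, so they
  -- agree for each factor.
  have h6 : (φ P).natTrailingDegree = (φ P).natDegree := by lia
  refine ⟨(φ P).natDegree, ?_⟩
  have h7 : P = homogeneousComponent (φ P).natDegree P := by
    conv_lhs => rw [← sum_homogeneousComponent P]
    have h8 : ∀ i, i ≠ (φ P).natDegree → homogeneousComponent i P = 0 := fun i hi => by
      rw [← hcoeff]
      rcases lt_or_gt_of_ne hi with hlt | hlt
      · exact Polynomial.coeff_eq_zero_of_lt_natTrailingDegree (h6 ▸ hlt)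
      · exact Polynomial.coeff_eq_zero_of_natDegree_lt hlt
    rw [Finset.sum_eq_single (φ P).natDegree (fun i _ hi => h8 i hi)]
    intro hnot
    apply homogeneousComponent_eq_zero
    simpa using hnot
  have h9 := homogeneousComponent_isHomogeneous (φ P).natDegree P
  rwa [← h7] at h9

end Homogeneous

section Dehomogenization

variable {k : Type u} [Field k] {d : ℕ}

/-- Dehomogenization with respect to the first variable. -/
def dehom (k : Type u) [Field k] (d : ℕ) : MvPolynomial (Fin (d + 1)) k →ₐ[k] MvPolynomial (Fin d) k :=
  aeval (Fin.cons 1 X)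

@[simp] lemma dehom_X_zero : dehom k d (X 0) = 1 := by simp [dehom]

@[simp] lemma dehom_X_succ (i : Fin d) : dehom k d (X i.succ) = X i := by simp [dehom]

lemma totalDegree_dehom_le {F : MvPolynomial (Fin (d + 1)) k} {n : ℕ} (hF : F.IsHomogeneous n) :
    (dehom k d F).totalDegree ≤ n := by
  have h1 : ∀ i, (dehom k d (X i)).totalDegree ≤ 1 := by
    refine Fin.cases ?_ fun j => ?_
    · rw [dehom_X_zero, totalDegree_one]
      exact zero_le
    · rw [dehom_X_succ, totalDegree_X]
  rw [F.as_sum, map_sum]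
  refine totalDegree_finsetSum_le fun s hs => ?_
  rw [monomial_eq, map_mul, Finsupp.prod, map_prod, ← algebraMap_eq, AlgHom.commutes, algebraMap_eq]
  refine (totalDegree_mul _ _).trans ?_
  rw [totalDegree_C, zero_add, hF.degree_eq_sum_deg_support hs]
  refine (totalDegree_finsetProd _ _).trans (Finset.sum_le_sum fun i _ => ?_)
  rw [map_pow]
  exact (totalDegree_pow _ _).trans ((Nat.mul_le_mul_left _ (h1 i)).trans (mul_one _).le)

/-- Substituting xᵢ/x₀ back recovers x₀⁻ⁿ F. -/
lemma dehom_injective {F : MvPolynomial (Fin (d + 1)) k} {n : ℕ} (hF : F.IsHomogeneous n)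
    (h : dehom k d F = 0) : F = 0 := by
  let L := FractionRing (MvPolynomial (Fin (d + 1)) k)
  let x : Fin (d + 1) → L := fun i => algebraMap (MvPolynomial (Fin (d + 1)) k) L (X i)
  have hinj : Function.Injective (algebraMap (MvPolynomial (Fin (d + 1)) k) L) :=
    IsFractionRing.injective _ _
  have hx : x 0 ≠ 0 := fun h0 => X_ne_zero (R := k) (0 : Fin (d + 1)) (hinj (h0.trans (map_zero _).symm))
  let θ : MvPolynomial (Fin d) k →ₐ[k] L := aeval fun i => (x 0)⁻¹ * x i.succ
  have h1 : θ.comp (dehom k d) =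
      (aeval (fun i => (x 0)⁻¹ * x i) : MvPolynomial (Fin (d + 1)) k →ₐ[k] L) := by
    apply algHom_ext
    intro i
    refine Fin.cases ?_ (fun j => ?_) i
    · rw [AlgHom.comp_apply, dehom_X_zero, map_one, aeval_X, inv_mul_cancel₀ hx]
    · rw [AlgHom.comp_apply, dehom_X_succ, aeval_X, aeval_X]
  have h2 : aeval x F = algebraMap _ L F := by
    have h3 : aeval x = (IsScalarTower.toAlgHom k (MvPolynomial (Fin (d + 1)) k) L) := by
      apply algHom_ext
      intro i
      simp [x]
    rw [h3]
    rfl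
  have h4 := congrArg (fun f => f F) h1
  simp only [AlgHom.comp_apply, h, map_zero] at h4
  rw [aeval_def, eval₂_mul_of_isHomogeneous hF, ← aeval_def, h2] at h4
  have h5 := (mul_eq_zero.1 h4.symm).resolve_left (pow_ne_zero _ (inv_ne_zero hx))
  exact hinj (h5.trans (map_zero _).symm)

lemma X_mem_grading (i : Fin (d + 1)) : (X i : MvPolynomial (Fin (d + 1)) k) ∈ grading k d 1 :=
  (mem_homogeneousSubmodule _ _).2 (isHomogeneous_X k i)

/-- Dehomogenization as a ring homomorphism on `(k[x₀, …, x_d]_{x₀})₀`. -/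
def awayDehom (k : Type u) [Field k] (d : ℕ) :
    HomogeneousLocalization.Away (grading k d) (X 0) →+* MvPolynomial (Fin d) k :=
  (IsLocalization.Away.lift (S := Localization.Away (X 0 : MvPolynomial (Fin (d + 1)) k)) (X 0)
    (g := (dehom k d).toRingHom) (by simp)).comp
      (algebraMap (HomogeneousLocalization.Away (grading k d) (X 0)) (Localization.Away (X 0)))

lemma awayDehom_mk (n : ℕ) (F : MvPolynomial (Fin (d + 1)) k) (hF : F ∈ grading k d (n • 1)) :
    awayDehom k d (HomogeneousLocalization.Away.mk _ (X_mem_grading 0) n F hF) = dehom k d F := by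
  rw [awayDehom, RingHom.comp_apply, HomogeneousLocalization.algebraMap_apply,
    HomogeneousLocalization.Away.val_mk, Localization.mk_eq_mk', IsLocalization.Away.lift,
    IsLocalization.lift_mk'_spec]
  simp

lemma awayDehom_bijective : Function.Bijective (awayDehom k d) := by
  constructor
  · rw [injective_iff_map_eq_zero]
    intro z hz
    obtain ⟨n, F, hF, rfl⟩ := HomogeneousLocalization.Away.mk_surjective _ (X_mem_grading 0) z
    rw [awayDehom_mk] at hz
    have h0 : F = 0 := dehom_injective ((mem_homogeneousSubmodule _ _).1 hF) hz
    subst h0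
    apply HomogeneousLocalization.val_injective
    rw [HomogeneousLocalization.Away.val_mk, Localization.mk_zero, HomogeneousLocalization.val_zero]
  · intro a
    induction a using MvPolynomial.induction_on with
    | C r =>
      refine ⟨HomogeneousLocalization.Away.mk _ (X_mem_grading 0) 0 (C r)
        ((mem_homogeneousSubmodule _ _).2 (by simpa using isHomogeneous_C _ r)), ?_⟩
      rw [awayDehom_mk, ← algebraMap_eq, AlgHom.commutes, algebraMap_eq]
    | add p q hp hq =>
      obtain ⟨a, ha⟩ := hp
      obtain ⟨b, hb⟩ := hq
      exact ⟨a + b, by rw [map_add, ha, hb]⟩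
    | mul_X p i hp =>
      obtain ⟨a, ha⟩ := hp
      refine ⟨a * HomogeneousLocalization.Away.mk _ (X_mem_grading 0) 1 (X i.succ)
        (X_mem_grading _), ?_⟩
      rw [map_mul, ha, awayDehom_mk, dehom_X_succ]

lemma exists_homogenization (a : Fin (d + 1) → MvPolynomial (Fin d) k) :
    ∃ (n : ℕ) (F : Fin (d + 1) → MvPolynomial (Fin (d + 1)) k),
      (∀ i, (F i).IsHomogeneous n) ∧ ∀ i, dehom k d (F i) = a i := by
  have h1 : ∀ i, ∃ (n : ℕ) (F : MvPolynomial (Fin (d + 1)) k), F.IsHomogeneous n ∧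
      dehom k d F = a i := fun i => by
    obtain ⟨z, hz⟩ := awayDehom_bijective.2 (a i)
    obtain ⟨n, F, hF, rfl⟩ := HomogeneousLocalization.Away.mk_surjective _ (X_mem_grading 0) z
    rw [awayDehom_mk] at hz
    exact ⟨n, F, by simpa using (mem_homogeneousSubmodule _ _).1 hF, hz⟩
  choose n F hF hFa using h1
  -- Powers of x₀, invisible after dehomogenization, bring all forms to the common degree ∑ nᵢ.
  refine ⟨∑ i, n i, fun i => F i * X 0 ^ (∑ j ∈ Finset.univ.erase i, n j), fun i => ?_, fun i => ?_⟩
  · rw [← Finset.add_sum_erase _ _ (Finset.mem_univ i)]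
    refine (hF i).mul ?_
    simpa using (isHomogeneous_X k (0 : Fin (d + 1))).pow (∑ j ∈ Finset.univ.erase i, n j)
  · rw [map_mul, map_pow, dehom_X_zero, one_pow, mul_one, hFa]

end Dehomogenization

end Cremona

end

/-! ### Affine and projective space as models -/

section

open AlgebraicGeometry CategoryTheory

namespace Cremona

section Affine

variable {k A : Type u} (K : Type u) [Field k] [Field K] [Algebra k K] [CommRing A] [IsDomain A]
  [Algebra k A] [Algebra A K] [IsScalarTower k A K] [IsFractionRing A K] [Algebra.FiniteType k A]

lemma range_eq_localSubring_of_isLocalization {P : Ideal A} [P.IsPrime] {S : Type*} [CommRing S]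
    [Algebra A S] [IsLocalization.AtPrime S P] (r : S →+* K)
    (h1 : ∀ a, r (algebraMap A S a) = algebraMap A K a) : r.range = localSubring K P := by
  ext z
  rw [mem_localSubring]
  constructor
  · rintro ⟨s, rfl⟩
    obtain ⟨a, ⟨b, hb⟩, hab⟩ := IsLocalization.exists_mk'_eq P.primeCompl s
    refine ⟨a, b, hb, ?_⟩
    have h3 : s * algebraMap A S b = algebraMap A S a := by
      rw [← hab]
      exact IsLocalization.mk'_spec _ a (⟨b, hb⟩ : P.primeCompl)
    have hb0 : b ≠ 0 := by rintro rfl; exact hb (zero_mem _)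
    rw [eq_div_iff (algebraMap_ne_zero' hb0), ← h1, ← h1, ← h3, map_mul]
  · rintro ⟨a, b, hb, rfl⟩
    have hb0 : b ≠ 0 := by rintro rfl; exact hb (zero_mem _)
    refine ⟨IsLocalization.mk' S a (⟨b, hb⟩ : P.primeCompl), ?_⟩
    rw [eq_div_iff (algebraMap_ne_zero' hb0), ← h1, ← h1, ← map_mul,
      IsLocalization.mk'_spec S a (⟨b, hb⟩ : P.primeCompl)]

lemma range_eq_localSubring (x : PrimeSpectrum A)
    (r : (Spec (CommRingCat.of A)).presheaf.stalk x ⟶ CommRingCat.of K)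
    (h : Spec.map r ≫ (Spec (CommRingCat.of A)).fromSpecStalk x =
      Spec.map (CommRingCat.ofHom (algebraMap A K))) :
    r.hom.range = localSubring K x.asIdeal := by
  let y : Spec (CommRingCat.of A) := x
  have hγ : (Spec (CommRingCat.of A)).fromSpecStalk y =
    Spec.map (StructureSheaf.toStalk A y) := Spec.fromSpecStalk_eq' (CommRingCat.of A) y
  let _ := (StructureSheaf.toStalk A y).hom.toAlgebra
  have : IsLocalization.AtPrime ((structurePresheafInCommRingCat A).stalk (x : PrimeSpectrum.Top A))
      x.asIdeal :=
    inferInstanceAs (IsLocalization.AtPrime ((Spec.structureSheaf A).presheaf.stalk y) x.asIdeal)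
  refine range_eq_localSubring_of_isLocalization K
    (S := (structurePresheafInCommRingCat A).stalk (x : PrimeSpectrum.Top A)) r.hom fun a => ?_
  have h2 : Spec.map (StructureSheaf.toStalk A y ≫ r) =
      Spec.map (CommRingCat.ofHom (algebraMap A K)) :=
    (Spec.map_comp _ _).trans ((congrArg (Spec.map r ≫ ·) hγ.symm).trans h)
  exact congrArg (fun f => f.hom a) (Spec.map_injective h2)

variable (k A) in
/-- An integral domain of finite type over `k` as an affine variety. -/
def affineVariety : Variety k where
  X := Spec (CommRingCat.of A)
  str := Spec.map (CommRingCat.ofHom (algebraMap k A))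
  isIntegral := inferInstance
  isSeparated := inferInstance
  locallyOfFiniteType := by
    rw [HasRingHomProperty.Spec_iff (P := @LocallyOfFiniteType)]
    exact (RingHom.finiteType_algebraMap).2 inferInstance
  quasiCompact := inferInstance

instance isDominant_algebraMap : IsDominant (X := Spec (CommRingCat.of K)) (Y := Spec (CommRingCat.of A))
    (Spec.map (CommRingCat.ofHom (algebraMap A K))) := by
  constructor
  change DenseRange (PrimeSpectrum.comap (algebraMap A K))
  exact PrimeSpectrum.denseRange_comap_iff_ker_le_nilRadical _ |>.2
    (by rw [(RingHom.injective_iff_ker_eq_bot _).1 (IsFractionRing.injective A K)]; exact bot_le)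

variable (k A) in
lemma exists_iso_functionField_affine :
    ∃ e : (affineVariety k A).X.functionField ≅ CommRingCat.of K,
      Spec.map e.hom ≫ (affineVariety k A).X.fromSpecStalk _ =
        Spec.map (CommRingCat.ofHom (algebraMap A K)) := by
  have : IsDominant (X := Spec (CommRingCat.of K)) (Y := (affineVariety k A).X)
    (Spec.map (CommRingCat.ofHom (algebraMap A K))) := isDominant_algebraMap K
  refine Model.exists_iso_functionField (affineVariety k A).X _ fun τ hτ z => ?_
  have : (PrimeSpectrum.asIdeal (R := A) (genericPoint (affineVariety k A).X)).IsPrime :=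
    PrimeSpectrum.isPrime (R := A) _
  have h1 := range_eq_localSubring K (genericPoint (affineVariety k A).X) τ hτ
  suffices h2 : z ∈ localSubring K (A := A)
      (PrimeSpectrum.asIdeal (genericPoint (affineVariety k A).X)) by
    exact (SetLike.ext_iff.1 h1 z).2 h2
  · rw [mem_localSubring]
    obtain ⟨a, b, hb, rfl⟩ := IsFractionRing.div_surjective A z
    refine ⟨a, b, ?_, rfl⟩
    have h3 : (genericPoint (affineVariety k A).X : Spec (CommRingCat.of A)).asIdeal = ⊥ := by
      have := genericPoint_eq_bot_of_affine (CommRingCat.of A)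
      exact congrArg PrimeSpectrum.asIdeal this
    rw [h3]
    exact nonZeroDivisors.ne_zero hb

variable (k A) in
/-- An integral domain of finite type over `k` as a model of its field of fractions. -/
def affineModel : Model k K where
  V := affineVariety k A
  e := (exists_iso_functionField_affine k A K).choose
  map_e_str := by
    rw [(exists_iso_functionField_affine k A K).choose_spec]
    change _ ≫ Spec.map (CommRingCat.ofHom (algebraMap k A)) = _
    rw [← Spec.map_comp, ← CommRingCat.ofHom_comp, ← IsScalarTower.algebraMap_eq]

lemma affineModel_ξ : (affineModel k A K).ξ = Spec.map (CommRingCat.ofHom (algebraMap A K)) :=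
  (exists_iso_functionField_affine k A K).choose_spec

lemma affineModel_localRing (x : PrimeSpectrum A) :
    (affineModel k A K).localRing x = localSubring K x.asIdeal :=
  range_eq_localSubring K x _ (((affineModel k A K).map_germ_fromSpecStalk x).trans
    (affineModel_ξ K))

lemma exists_affineModel_localRing_eq {p : A} (hp : Prime p) :
    ∃ x : (affineModel k A K).V.X, (affineModel k A K).localRing x = primeRing K p hp :=
  ⟨(⟨Ideal.span {p}, (Ideal.span_singleton_prime hp.ne_zero).2 hp⟩ : PrimeSpectrum A),
    affineModel_localRing K _⟩

/-- A nonzero prime ideal of a factorial ring contains a prime element p. The ideal (p) is then a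
non-generic generization of the given point, hence equal to it. -/
lemma affineModel_localRing_mem [UniqueFactorizationMonoid A] {x : (affineModel k A K).V.X}
    (hx : IsPrimeDivisor x) : (affineModel k A K).localRing x ∈ primeRings A K := by
  let P : PrimeSpectrum A := x
  have hgen : genericPoint (affineModel k A K).V.X = (⟨⊥, Ideal.isPrime_bot⟩ : PrimeSpectrum A) :=
    genericPoint_eq_bot_of_affine (CommRingCat.of A)
  have hP : P.asIdeal ≠ ⊥ := fun h => hx.1 (by
    rw [hgen]
    exact PrimeSpectrum.ext h)
  obtain ⟨p, hpP, hp⟩ := Ideal.IsPrime.exists_mem_prime_of_ne_bot P.2 hP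
  let Q : PrimeSpectrum A := ⟨Ideal.span {p}, (Ideal.span_singleton_prime hp.ne_zero).2 hp⟩
  have hQP : Q ⤳ P := by
    rw [← PrimeSpectrum.le_iff_specializes]
    exact (Ideal.span_singleton_le_iff_mem _).2 hpP
  have hQ : Q = P := by
    rcases hx.2 Q hQP with h | h
    · exact h
    · have h1 : Q.asIdeal = ⊥ := congrArg PrimeSpectrum.asIdeal (h.trans hgen)
      exact absurd (Ideal.span_singleton_eq_bot.1 h1) hp.ne_zero
  refine ⟨⟨p, hp⟩, ?_⟩
  change primeRing K p hp = (affineModel k A K).localRing P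
  rw [← hQ]
  exact (affineModel_localRing (k := k) K Q).symm

end Affine

namespace Model

variable {k K : Type u} [Field k] [Field K] [Algebra k K]

lemma exists_iso_functionField_of_isOpenImmersion (N : Model k K) (X : Scheme.{u}) [IsIntegral X]
    (i : N.V.X ⟶ X) [IsOpenImmersion i] :
    ∃ e : X.functionField ≅ CommRingCat.of K, Spec.map e.hom ≫ X.fromSpecStalk _ = N.ξ ≫ i := by
  have : IsDominant i := by
    constructor
    exact i.isOpenEmbedding.isOpen_range.dense ⟨_, ⟨genericPoint N.V.X, rfl⟩⟩
  refine exists_iso_functionField X (N.ξ ≫ i) ?_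
  have key : ∀ v : X, v = i (genericPoint N.V.X) → ∀ τ : X.presheaf.stalk v ⟶ CommRingCat.of K,
      Spec.map τ ≫ X.fromSpecStalk v = N.ξ ≫ i → Function.Surjective τ.hom := by
    rintro _ rfl τ hτ z
    have h1 : τ = i.stalkMap (genericPoint N.V.X) ≫ N.germ (genericPoint N.V.X) := by
      apply Spec.map_injective
      rw [← cancel_mono (X.fromSpecStalk _), hτ, Spec.map_comp, Category.assoc,
        Scheme.SpecMap_stalkMap_fromSpecStalk, ← Category.assoc, map_germ_fromSpecStalk]
    have h2 : z ∈ N.localRing (genericPoint N.V.X) := by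
      rw [localRing_genericPoint]
      trivial
    obtain ⟨s, hs⟩ := h2
    obtain ⟨t, rfl⟩ := ((ConcreteCategory.isIso_iff_bijective
      (i.stalkMap (genericPoint N.V.X))).1 inferInstance).2 s
    exact ⟨t, by rw [h1]; exact hs⟩
  exact key _ (genericPoint_eq_of_isOpenImmersion i).symm

end Model

section Projective

open MvPolynomial

variable (k : Type u) [Field k] (d : ℕ)

/-- The standard affine chart of projective space. -/
def chart : Spec (CommRingCat.of (MvPolynomial (Fin d) k)) ⟶ projScheme k d :=
  Spec.map (RingEquiv.ofBijective _ (awayDehom_bijective (k := k) (d := d))).toCommRingCatIso.hom ≫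
    Proj.awayι (grading k d) (X 0) (X_mem_grading 0) Nat.one_pos

instance : IsOpenImmersion (chart k d) := by
  unfold chart
  infer_instance

lemma chart_str : chart k d ≫ projStr k d =
    Spec.map (CommRingCat.ofHom (algebraMap k (MvPolynomial (Fin d) k))) := by
  rw [chart, projStr, Category.assoc, Proj.awayι_toSpecZero_assoc, ← Spec.map_comp, ← Spec.map_comp]
  congr 1
  refine CommRingCat.hom_ext (RingHom.ext fun r => ?_)
  change awayDehom k d (HomogeneousLocalization.fromZeroRingHom _ _ (algebraMap k (grading k d 0) r)) = _
  have h1 : HomogeneousLocalization.fromZeroRingHom (grading k d) (.powers (X 0))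
      (algebraMap k (grading k d 0) r) = HomogeneousLocalization.Away.mk _ (X_mem_grading 0) 0 (C r)
        ((mem_homogeneousSubmodule _ _).2 (by simpa using isHomogeneous_C _ r)) := by
    apply HomogeneousLocalization.val_injective
    rw [HomogeneousLocalization.Away.val_mk]
    rfl
  rw [h1, awayDehom_mk, ← algebraMap_eq, AlgHom.commutes]
  rfl

variable (K : Type u) [Field K] [Algebra (MvPolynomial (Fin d) k) K]
  [IsFractionRing (MvPolynomial (Fin d) k) K] [Algebra k K]
  [IsScalarTower k (MvPolynomial (Fin d) k) K]

lemma exists_iso_functionField_proj :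
    ∃ e : (projScheme k d).functionField ≅ CommRingCat.of K,
      Spec.map e.hom ≫ (projScheme k d).fromSpecStalk _ =
        Spec.map (CommRingCat.ofHom (algebraMap (MvPolynomial (Fin d) k) K)) ≫ chart k d := by
  have : IsOpenImmersion (X := (affineModel k (MvPolynomial (Fin d) k) K).V.X)
    (Y := projScheme k d) (chart k d) := inferInstanceAs (IsOpenImmersion (chart k d))
  obtain ⟨e, he⟩ := (affineModel k (MvPolynomial (Fin d) k) K).exists_iso_functionField_of_isOpenImmersion
    (projScheme k d) (chart k d)
  exact ⟨e, he.trans (congrArg (· ≫ chart k d) (affineModel_ξ (k := k) K))⟩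

/-- Projective space as a model of the field of fractions of `k[X₀, …, X_{d-1}]`. -/
def projModel : Model k K where
  V := projSpace k d
  e := (exists_iso_functionField_proj k d K).choose
  map_e_str := by
    have h := (exists_iso_functionField_proj k d K).choose_spec
    refine (congrArg (· ≫ projStr k d) h).trans ?_
    rw [Category.assoc, chart_str, ← Spec.map_comp, ← CommRingCat.ofHom_comp,
      ← IsScalarTower.algebraMap_eq]

lemma projModel_ξ : (projModel k d K).ξ =
    Spec.map (CommRingCat.ofHom (algebraMap (MvPolynomial (Fin d) k) K)) ≫ chart k d :=
  (exists_iso_functionField_proj k d K).choose_spec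

instance : IsProper (projModel k d K).V.str := by
  change IsProper (projStr k d)
  unfold projStr
  infer_instance

lemma affineModel_ξ_chart : (affineModel k (MvPolynomial (Fin d) k) K).ξ ≫ chart k d =
    (projModel k d K).ξ :=
  (congrArg (· ≫ chart k d) (affineModel_ξ (k := k) K)).trans (projModel_ξ k d K).symm

lemma projModel_localRing_chart (x : (affineModel k (MvPolynomial (Fin d) k) K).V.X) :
    (projModel k d K).localRing (chart k d x) =
      (affineModel k (MvPolynomial (Fin d) k) K).localRing x := by
  have : IsOpenImmersion (X := (affineModel k (MvPolynomial (Fin d) k) K).V.X)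
    (Y := (projModel k d K).V.X) (chart k d) := inferInstanceAs (IsOpenImmersion (chart k d))
  exact (affineModel k (MvPolynomial (Fin d) k) K).localRing_map_eq (projModel k d K) (chart k d)
    (affineModel_ξ_chart k d K) x

lemma exists_projModel_localRing_eq {R : Subring K} (hR : R ∈ primeRings (MvPolynomial (Fin d) k) K) :
    ∃ x, (projModel k d K).localRing x = R := by
  obtain ⟨⟨p, hp⟩, rfl⟩ := hR
  obtain ⟨x, hx⟩ := exists_affineModel_localRing_eq (k := k) K hp
  exact ⟨chart k d x, (projModel_localRing_chart k d K x).trans hx⟩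

lemma projModel_localRing_mem {x : (projModel k d K).V.X} (hx : x ∈ (chart k d).opensRange)
    (h : IsPrimeDivisor x) : (projModel k d K).localRing x ∈ primeRings (MvPolynomial (Fin d) k) K := by
  obtain ⟨y, rfl⟩ := hx
  have : IsOpenImmersion (X := (affineModel k (MvPolynomial (Fin d) k) K).V.X)
    (Y := (projModel k d K).V.X) (chart k d) := inferInstanceAs (IsOpenImmersion (chart k d))
  have hy : IsPrimeDivisor (X := (affineModel k (MvPolynomial (Fin d) k) K).V.X) y :=
    IsPrimeDivisor.of_map (X := (affineModel k (MvPolynomial (Fin d) k) K).V.X)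
      (Y := (projModel k d K).V.X) (chart k d) h
  have h2 := affineModel_localRing_mem (k := k) K hy
  exact (projModel_localRing_chart k d K y).symm ▸ h2

lemma genericPoint_mem_opensRange_chart :
    genericPoint (projModel k d K).V.X ∈ (chart k d).opensRange :=
  ⟨_, genericPoint_eq_of_isOpenImmersion (chart k d)⟩

end Projective

end Cremona

end

/-! ### Morphisms given by forms and the automorphisms they induce -/

section

open AlgebraicGeometry CategoryTheory MvPolynomial HomogeneousLocalization

namespace Cremona

variable {k : Type u} [Field k] {d : ℕ} (K : Type u) [Field K] [Algebra (MvPolynomial (Fin d) k) K]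
  [IsFractionRing (MvPolynomial (Fin d) k) K] [Algebra k K]
  [IsScalarTower k (MvPolynomial (Fin d) k) K]

lemma genericPoint_mem_basicOpen {F : MvPolynomial (Fin (d + 1)) k} (hF : F ≠ 0) :
    genericPoint (projScheme k d) ∈ Proj.basicOpen (grading k d) F :=
  (genericPoint_specializes (projGeneric k d)).mem_open (Proj.basicOpen (grading k d) F).2
    (projGeneric_mem_basicOpen k d hF)

variable (k d) in
/-- The identification of the local ring at the generic point with `K`. -/
def projEval : (Proj (grading k d)).presheaf.stalk (genericPoint (projScheme k d)) ⟶
    CommRingCat.of K := (projModel k d K).e.hom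

variable (k d) in
lemma projEval_ξ : Spec.map (projEval k d K) ≫ (Proj (grading k d)).fromSpecStalk _ =
    (projModel k d K).ξ := rfl

/-- The generic point of projective space as a `K`-valued point of `D₊(F)`. -/
def liftBasicOpen {F : MvPolynomial (Fin (d + 1)) k} (hF : F ≠ 0) :
    Spec (CommRingCat.of K) ⟶ (Proj.basicOpen (grading k d) F).toScheme :=
  Spec.map (projEval k d K) ≫ (Proj.basicOpen (grading k d) F).fromSpecStalkOfMem
    (genericPoint (projScheme k d)) (genericPoint_mem_basicOpen hF)

lemma liftBasicOpen_ι {F : MvPolynomial (Fin (d + 1)) k} (hF : F ≠ 0) :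
    liftBasicOpen K hF ≫ (Proj.basicOpen (grading k d) F).ι = (projModel k d K).ξ := by
  rw [liftBasicOpen, Category.assoc, Scheme.Opens.fromSpecStalkOfMem_ι, projEval_ξ]

/-- The value of a fraction at the generic point. -/
def evalAway {F : MvPolynomial (Fin (d + 1)) k} (hF : F ≠ 0) :
    CommRingCat.of (Away (grading k d) F) ⟶ CommRingCat.of K :=
  Proj.awayToSection (grading k d) F ≫ (projScheme k d).presheaf.germ _
    (genericPoint (projScheme k d)) (genericPoint_mem_basicOpen hF) ≫ projEval k d K

lemma liftBasicOpen_basicOpenToSpec {F : MvPolynomial (Fin (d + 1)) k} (hF : F ≠ 0) :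
    liftBasicOpen K hF ≫ Proj.basicOpenToSpec (grading k d) F = Spec.map (evalAway K hF) := by
  rw [liftBasicOpen, Proj.basicOpenToSpec, Category.assoc,
    Scheme.Opens.fromSpecStalkOfMem_toSpecΓ_assoc, evalAway, Spec.map_comp, Spec.map_comp,
    Category.assoc]

lemma evalAway_X_zero (z : Away (grading k d) (X 0)) :
    evalAway K (X_ne_zero (R := k) (0 : Fin (d + 1))) z =
      algebraMap (MvPolynomial (Fin d) k) K (awayDehom k d z) := by
  have h1 : liftBasicOpen K (X_ne_zero (R := k) (0 : Fin (d + 1))) =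
      Spec.map (CommRingCat.ofHom (algebraMap (MvPolynomial (Fin d) k) K)) ≫
        Spec.map (RingEquiv.ofBijective _ (awayDehom_bijective (k := k) (d := d))).toCommRingCatIso.hom ≫
          (Proj.basicOpenIsoSpec (grading k d) (X 0) (X_mem_grading 0) Nat.one_pos).inv := by
    rw [← cancel_mono (Proj.basicOpen (grading k d) (X 0)).ι, liftBasicOpen_ι, projModel_ξ, chart]
    simp only [Category.assoc]
    rfl
  have h2 := liftBasicOpen_basicOpenToSpec K (X_ne_zero (R := k) (0 : Fin (d + 1)))
  rw [h1, Category.assoc, Category.assoc, ← Proj.basicOpenIsoSpec_hom _ _ (X_mem_grading 0) Nat.one_pos,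
    Iso.inv_hom_id, Category.comp_id, ← Spec.map_comp] at h2
  exact congrArg (fun f => f.hom z) (Spec.map_injective h2).symm

/-- The evaluations on the various D₊(F) all factor through the homogeneous localization at the
generic point; this permits comparing D₊(F) with the chart D₊(x₀). -/
lemma exists_evalAway_eq : ∃ (P : Ideal (MvPolynomial (Fin (d + 1)) k)) (_ : P.IsPrime)
    (h : AtPrime (grading k d) P →+* K),
      ∀ (F : MvPolynomial (Fin (d + 1)) k) (hF : F ≠ 0), ∃ hFP : Submonoid.powers F ≤ P.primeCompl,
        ∀ z, evalAway K hF z = h (mapId (grading k d) hFP z) := by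
  let x : ProjectiveSpectrum (grading k d) := genericPoint (projScheme k d)
  refine ⟨x.asHomogeneousIdeal.toIdeal, x.isPrime,
    ((Proj.stalkIso' (grading k d) x).toCommRingCatIso.inv ≫ projEval k d K).hom, fun F hF =>
      ⟨Submonoid.powers_le.2 (genericPoint_mem_basicOpen hF), fun z => ?_⟩⟩
  have h1 := ProjectiveSpectrum.Proj.awayToSection_germ (grading k d) F x (genericPoint_mem_basicOpen hF)
  have h2 := congrArg (fun f => projEval k d K (f.hom z)) h1
  exact h2

lemma algebraMap_dehom_ne_zero {F : MvPolynomial (Fin (d + 1)) k} {n : ℕ} (h : F.IsHomogeneous n)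
    (hF : F ≠ 0) : algebraMap (MvPolynomial (Fin d) k) K (dehom k d F) ≠ 0 :=
  algebraMap_ne_zero' fun h0 => hF (dehom_injective h h0)

lemma evalAway_mk {F : MvPolynomial (Fin (d + 1)) k} (hF : F ≠ 0)
    (c : NumDenSameDeg (grading k d) (.powers F)) :
    evalAway K hF (mk c) * algebraMap (MvPolynomial (Fin d) k) K (dehom k d c.den) =
      algebraMap (MvPolynomial (Fin d) k) K (dehom k d c.num) := by
  obtain ⟨P, hP, h, H⟩ := exists_evalAway_eq (k := k) (d := d) K
  obtain ⟨h1, H1⟩ := H F hF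
  obtain ⟨h2, H2⟩ := H (X 0) (X_ne_zero 0)
  have hmem : ∀ {G : MvPolynomial (Fin (d + 1)) k}, G ∈ grading k d c.deg →
      G ∈ grading k d (c.deg • 1) := fun h => by simpa using h
  -- In the common localization, (num/den) · (den/x₀ⁿ) = num/x₀ⁿ, and on D₊(x₀) evaluation is
  -- dehomogenization.
  have key : mapId (grading k d) h1 (mk c) *
      mapId (grading k d) h2 (Away.mk _ (X_mem_grading 0) c.deg c.den (hmem c.den.2)) =
        mapId (grading k d) h2 (Away.mk _ (X_mem_grading 0) c.deg c.num (hmem c.num.2)) := by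
    apply val_injective
    rw [val_mul]
    change Localization.mk c.num.1 (⟨c.den.1, h1 c.den_mem⟩ : P.primeCompl) *
      Localization.mk c.den.1 (⟨X 0 ^ c.deg, h2 ⟨_, rfl⟩⟩ : P.primeCompl) =
      Localization.mk c.num.1 (⟨X 0 ^ c.deg, h2 ⟨_, rfl⟩⟩ : P.primeCompl)
    rw [Localization.mk_mul, Localization.mk_eq_mk_iff, Localization.r_iff_exists]
    refine ⟨1, ?_⟩
    simp only [OneMemClass.coe_one, one_mul, Submonoid.coe_mul]
    ring
  have h3 := congrArg h key
  rw [map_mul, ← H1, ← H2, ← H2, evalAway_X_zero, evalAway_X_zero, awayDehom_mk, awayDehom_mk] at h3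
  exact h3

lemma evalAway_algebraMap {F : MvPolynomial (Fin (d + 1)) k} (hF : F ≠ 0) (r : k) :
    evalAway K hF (algebraMap (grading k d 0) (Away (grading k d) F) (algebraMap k (grading k d 0) r)) =
      algebraMap k K r := by
  have h1 := evalAway_mk K hF ⟨0, algebraMap k (grading k d 0) r, 1, one_mem _⟩
  change evalAway K hF _ * algebraMap _ K (dehom k d 1) =
    algebraMap _ K (dehom k d (algebraMap k _ r)) at h1
  rw [map_one, map_one, mul_one, AlgHom.commutes, ← IsScalarTower.algebraMap_apply] at h1
  exact h1

section GlobalSections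

variable {L : Type u} [Field L] {Y : Scheme.{u}}

lemma mem_basicOpen_iff {φ : Γ(Y, ⊤) ⟶ CommRingCat.of L} {l : Spec (CommRingCat.of L) ⟶ Y}
    (hl : l ≫ Y.toSpecΓ = Spec.map φ) (t : Spec (CommRingCat.of L)) (s : Γ(Y, ⊤)) :
    l t ∈ Y.basicOpen s ↔ φ s ≠ 0 := by
  have h1 : l t ∈ Y.basicOpen s ↔ Spec.map φ t ∈ PrimeSpectrum.basicOpen s := by
    rw [← Y.toSpecΓ_preimage_basicOpen s, ← hl]
    rfl
  rw [h1]
  let t' : PrimeSpectrum L := t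
  change φ s ∉ t'.asIdeal ↔ _
  rw [Ideal.eq_bot_of_prime t'.asIdeal, Ideal.mem_bot]

variable (f : MvPolynomial (Fin (d + 1)) k →+* Γ(Y, ⊤))
  (hf : (HomogeneousIdeal.irrelevant (grading k d)).toIdeal.map f = ⊤)
  {φ : Γ(Y, ⊤) ⟶ CommRingCat.of L} {l : Spec (CommRingCat.of L) ⟶ Y}
  (hl : l ≫ Y.toSpecΓ = Spec.map φ)

include hl in
lemma ne_zero_of_mem_basicOpen {T : MvPolynomial (Fin (d + 1)) k} {n : ℕ} (hn : 0 < n)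
    (hT : T ∈ grading k d n) (t : Spec (CommRingCat.of L))
    (h : (l ≫ Proj.fromOfGlobalSections (grading k d) f hf) t ∈ Proj.basicOpen (grading k d) T) :
    φ (f T) ≠ 0 := by
  rw [← mem_basicOpen_iff hl t, ← Proj.fromOfGlobalSections_preimage_basicOpen _ f hf hn hT]
  exact h

-- The map defined by the sections f sends an L-valued point where f(T) does not vanish to the point
-- of D₊(T) with coordinates G/Tᵐ ↦ f(G)/f(T)ᵐ.
include hl in
lemma exists_comp_fromOfGlobalSections_eq {T : MvPolynomial (Fin (d + 1)) k} {n : ℕ} (hn : 0 < n)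
    (hT : T ∈ grading k d n) (h : φ (f T) ≠ 0) :
    ∃ θ : Away (grading k d) T →+* L,
      (∀ m G hG, θ (Away.mk (grading k d) hT m G hG) * φ (f T) ^ m = φ (f G)) ∧
      l ≫ Proj.fromOfGlobalSections (grading k d) f hf =
        Spec.map (CommRingCat.ofHom θ) ≫ Proj.awayι (grading k d) T hT hn := by
  let l' : Spec (CommRingCat.of L) ⟶ (Y.basicOpen (f T)).toScheme :=
    IsOpenImmersion.lift (Y.basicOpen (f T)).ι l (by
      rintro _ ⟨t, rfl⟩
      rw [Scheme.Opens.range_ι]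
      exact (mem_basicOpen_iff hl t _).2 h)
  have hl' : l' ≫ (Y.basicOpen (f T)).ι = l := IsOpenImmersion.lift_fac _ _ _
  let ψ : Localization.Away (f T) →+* L := IsLocalization.Away.lift (f T) (g := φ.hom) h.isUnit
  let W : (Spec Γ(Y, ⊤)).Opens := PrimeSpectrum.basicOpen (f T)
  have hψ : l' ≫ (Y.isoOfEq (Y.toSpecΓ_preimage_basicOpen (f T))).inv ≫ Y.toSpecΓ ∣_ _ ≫
      (basicOpenIsoSpecAway (f T)).hom = Spec.map (CommRingCat.ofHom ψ) := by
    rw [← cancel_mono (Spec.map (CommRingCat.ofHom (algebraMap Γ(Y, ⊤) (Localization.Away (f T))))),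
      ← Spec.map_comp, ← CommRingCat.ofHom_comp]
    have h1 : ψ.comp (algebraMap Γ(Y, ⊤) (Localization.Away (f T))) = φ.hom :=
      IsLocalization.Away.lift_comp _ _
    rw [h1]
    simp only [Category.assoc, basicOpenIsoSpecAway_hom_SpecMap]
    have h2 : (Y.isoOfEq (Y.toSpecΓ_preimage_basicOpen (f T))).inv ≫ Y.toSpecΓ ∣_ W ≫ W.ι =
        (Y.basicOpen (f T)).ι ≫ Y.toSpecΓ := by
      rw [morphismRestrict_ι, Scheme.isoOfEq_inv_ι_assoc]
    refine (congrArg (l' ≫ ·) h2).trans ?_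
    rw [← Category.assoc, hl', hl]
    rfl
  let μ : Localization.Away T →+* Localization.Away (f T) :=
    IsLocalization.map (M := .powers T) (T := .powers (f T)) _ f (by
      rw [← Submonoid.map_le_iff_le_comap, Submonoid.map_powers])
  refine ⟨ψ.comp (μ.comp (algebraMap _ (Localization.Away T))), fun m G hG => ?_, ?_⟩
  · have hμ : ∀ a, μ (algebraMap _ (Localization.Away T) a) = algebraMap _ _ (f a) := fun a =>
      IsLocalization.map_eq _ a
    have h1 : μ (algebraMap _ (Localization.Away T) (Away.mk (grading k d) hT m G hG)) *
        algebraMap _ _ (f (T ^ m)) = algebraMap _ _ (f G) := by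
      rw [HomogeneousLocalization.algebraMap_apply, Away.val_mk, ← hμ, ← hμ, ← map_mul]
      congr 1
      rw [Localization.mk_eq_mk']
      exact IsLocalization.mk'_spec _ _ (⟨T ^ m, ⟨m, rfl⟩⟩ : Submonoid.powers T)
    have h2 : ∀ s, ψ (algebraMap Γ(Y, ⊤) (Localization.Away (f T)) s) = φ s := fun s =>
      IsLocalization.Away.lift_eq _ _ s
    have h3 := congrArg ψ h1
    rw [map_mul, h2, h2, map_pow, map_pow] at h3
    exact h3
  · have h1 := Proj.fromOfGlobalSections_resLE (grading k d) f hf hn hT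
    have h2 : (Y.basicOpen (f T)).ι ≫ Proj.fromOfGlobalSections (grading k d) f hf =
        Proj.toBasicOpenOfGlobalSections (grading k d) f rfl hn hT ≫
          (Proj.basicOpen (grading k d) T).ι := by
      rw [← h1, Scheme.Hom.resLE_comp_ι]
    rw [CommRingCat.ofHom_comp, Spec.map_comp, ← hψ, ← hl', Category.assoc, h2,
      Proj.toBasicOpenOfGlobalSections]
    simp only [Category.assoc, Proj.basicOpenIsoSpec_inv_ι]

end GlobalSections

section PolyMap

variable {n : ℕ} {F : Fin (d + 1) → MvPolynomial (Fin (d + 1)) k}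

/-- The value of a section over `D₊(F)` at the generic point. -/
def evalSection {F : MvPolynomial (Fin (d + 1)) k} (hF : F ≠ 0) :
    Γ((Proj.basicOpen (grading k d) F).toScheme, ⊤) ⟶ CommRingCat.of K :=
  (Proj.basicOpen (grading k d) F).topIso.hom ≫ (projScheme k d).presheaf.germ _
    (genericPoint (projScheme k d)) (genericPoint_mem_basicOpen hF) ≫ projEval k d K

lemma liftBasicOpen_toSpecΓ {F : MvPolynomial (Fin (d + 1)) k} (hF : F ≠ 0) :
    liftBasicOpen K hF ≫ (Proj.basicOpen (grading k d) F).toScheme.toSpecΓ =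
      Spec.map (evalSection K hF) := by
  have h1 : (Proj.basicOpen (grading k d) F).toScheme.toSpecΓ =
      (Proj.basicOpen (grading k d) F).toSpecΓ ≫
        Spec.map (Proj.basicOpen (grading k d) F).topIso.hom := by
    rw [Scheme.Opens.toSpecΓ, Category.assoc, ← Spec.map_comp, Iso.hom_inv_id, Spec.map_id,
      Category.comp_id]
  rw [h1, liftBasicOpen, Category.assoc, Scheme.Opens.fromSpecStalkOfMem_toSpecΓ_assoc, evalSection,
    Spec.map_comp, Spec.map_comp, Category.assoc]

lemma evalSection_ratioSections (hF : ∀ i, F i ∈ grading k d n) {j : Fin (d + 1)} (hj : F j ≠ 0)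
    (G : MvPolynomial (Fin (d + 1)) k) :
    evalSection K hj (ratioSections F hF j G) = evalAway K hj (ratioHom F hF j G) := by
  have h1 : (Proj.awayToSection (grading k d) (F j) ≫
      (Proj.basicOpen (grading k d) (F j)).topIso.inv) ≫ evalSection K hj = evalAway K hj := by
    rw [evalSection, evalAway, Category.assoc, Iso.inv_hom_id_assoc]
  rw [← h1]
  rfl

lemma evalSection_X (hF : ∀ i, F i ∈ grading k d n) {j : Fin (d + 1)} (hj : F j ≠ 0)
    (i : Fin (d + 1)) :
    evalSection K hj (ratioSections F hF j (X i)) * algebraMap _ K (dehom k d (F j)) =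
      algebraMap _ K (dehom k d (F i)) := by
  rw [evalSection_ratioSections, ratioHom, coe_eval₂Hom, eval₂_X]
  exact evalAway_mk K hj _

lemma evalSection_C (hF : ∀ i, F i ∈ grading k d n) {j : Fin (d + 1)} (hj : F j ≠ 0)
    (r : k) : evalSection K hj (ratioSections F hF j (C r)) = algebraMap k K r := by
  rw [evalSection_ratioSections, ratioHom, coe_eval₂Hom, eval₂_C]
  exact evalAway_algebraMap K hj r

lemma map_projModel_ξ (σ : K ≃ₐ[k] K) :
    Spec.map (CommRingCat.ofHom (σ : K →+* K)) ≫ (projModel k d K).ξ =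
      Spec.map (CommRingCat.ofHom ((σ : K →+* K).comp
        ((algebraMap (MvPolynomial (Fin d) k) K).comp (awayDehom k d)))) ≫
          Proj.awayι (grading k d) (X 0) (X_mem_grading 0) Nat.one_pos := by
  have h1 : (projModel k d K).ξ = Spec.map (CommRingCat.ofHom
      ((algebraMap (MvPolynomial (Fin d) k) K).comp (awayDehom k d))) ≫
        Proj.awayι (grading k d) (X 0) (X_mem_grading 0) Nat.one_pos := by
    rw [projModel_ξ, chart, CommRingCat.ofHom_comp, Spec.map_comp, Category.assoc]
    rfl
  rw [h1, CommRingCat.ofHom_comp _ (σ : K →+* K), Spec.map_comp, Category.assoc]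
  rfl

lemma isGivenBy_of_polyMap_eq (hF : ∀ i, F i ∈ grading k d n) {j : Fin (d + 1)} (hj : F j ≠ 0)
    (σ : K ≃ₐ[k] K) (h : liftBasicOpen K hj ≫ (polyMap F hF j hj).hom =
      Spec.map (CommRingCat.ofHom (σ : K →+* K)) ≫ (projModel k d K).ξ) :
    IsGivenBy σ fun i => dehom k d (F i) := by
  have hFj := algebraMap_dehom_ne_zero K ((mem_homogeneousSubmodule _ _).1 (hF j)) hj
  let t : Spec (CommRingCat.of K) := IsLocalRing.closedPoint K
  -- F₀/Fⱼ is nonzero because the image is again generic and so lies in D₊(x₀). This is what makes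
  -- a₀ ≠ 0 in `IsGivenBy`.
  have h0 : evalSection K hj (ratioSections F hF j (X 0)) ≠ 0 := by
    refine ne_zero_of_mem_basicOpen (ratioSections F hF j) (ratioSections_irrelevant F hF j)
      (liftBasicOpen_toSpecΓ K hj) Nat.one_pos (X_mem_grading 0) t ?_
    have h2 : (Spec.map (CommRingCat.ofHom (σ : K →+* K)) ≫ (projModel k d K).ξ) t ∈
        Proj.basicOpen (grading k d) (X 0) := by
      rw [Scheme.Hom.comp_apply]
      exact (projModel k d K).ξ_mem _ (U := Proj.basicOpen (grading k d) (X 0))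
        ⟨_, genericPoint_mem_basicOpen (X_ne_zero 0)⟩
    rw [← h] at h2
    exact h2
  obtain ⟨θ, hθ, hθ'⟩ := exists_comp_fromOfGlobalSections_eq (ratioSections F hF j)
    (ratioSections_irrelevant F hF j) (liftBasicOpen_toSpecΓ K hj) Nat.one_pos (X_mem_grading 0) h0
  have h1 : θ = (σ : K →+* K).comp ((algebraMap (MvPolynomial (Fin d) k) K).comp (awayDehom k d)) := by
    have h2 := (hθ'.symm.trans h).trans (map_projModel_ξ K σ)
    rw [cancel_mono] at h2
    exact congrArg (fun f => f.hom) (Spec.map_injective h2)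
  have h3 : ∀ i, evalSection K hj (ratioSections F hF j (X i)) =
      algebraMap _ K (dehom k d (F i)) / algebraMap _ K (dehom k d (F j)) := fun i => by
    rw [eq_div_iff hFj, evalSection_X]
  refine ⟨fun h4 => h0 ?_, fun i => ?_⟩
  · rw [h3]
    change _ / _ = _
    rw [show dehom k d (F 0) = 0 from h4, map_zero, zero_div]
  · have h4 := hθ 1 (X i.succ) (X_mem_grading (k := k) i.succ)
    have h5 : θ (Away.mk _ (X_mem_grading 0) 1 (X i.succ) (X_mem_grading (k := k) i.succ)) =
        σ (algebraMap (MvPolynomial (Fin d) k) K (X i)) := by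
      rw [h1, RingHom.comp_apply, RingHom.comp_apply, awayDehom_mk, dehom_X_succ]
      rfl
    rw [h5, h3, h3, pow_one] at h4
    field_simp at h4
    exact h4

lemma polyMap_eq_of_isGivenBy (hF : ∀ i, F i ∈ grading k d n) {j : Fin (d + 1)} (hj : F j ≠ 0)
    {σ : K ≃ₐ[k] K} (h : IsGivenBy σ fun i => dehom k d (F i)) :
    liftBasicOpen K hj ≫ (polyMap F hF j hj).hom =
      Spec.map (CommRingCat.ofHom (σ : K →+* K)) ≫ (projModel k d K).ξ := by
  have hFj := algebraMap_dehom_ne_zero K ((mem_homogeneousSubmodule _ _).1 (hF j)) hj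
  have hF0 : algebraMap _ K (dehom k d (F 0)) ≠ 0 := algebraMap_ne_zero' h.1
  have h3 : ∀ i, evalSection K hj (ratioSections F hF j (X i)) =
      algebraMap _ K (dehom k d (F i)) / algebraMap _ K (dehom k d (F j)) := fun i => by
    rw [eq_div_iff hFj, evalSection_X]
  have h0 : evalSection K hj (ratioSections F hF j (X 0)) ≠ 0 := by
    rw [h3]
    exact div_ne_zero hF0 hFj
  obtain ⟨θ, hθ, hθ'⟩ := exists_comp_fromOfGlobalSections_eq (ratioSections F hF j)
    (ratioSections_irrelevant F hF j) (liftBasicOpen_toSpecΓ K hj) Nat.one_pos (X_mem_grading 0) h0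
  have h1 : θ = (σ : K →+* K).comp ((algebraMap (MvPolynomial (Fin d) k) K).comp (awayDehom k d)) := by
    let E := RingEquiv.ofBijective _ (awayDehom_bijective (k := k) (d := d))
    have h4 : θ.comp (E.symm : MvPolynomial (Fin d) k →+* _) =
        (σ : K →+* K).comp (algebraMap (MvPolynomial (Fin d) k) K) := by
      apply ringHom_ext
      · intro r
        have hC : C r ∈ grading k d (0 • 1) :=
          (mem_homogeneousSubmodule _ _).2 (by simpa using isHomogeneous_C _ r)
        have h5 : E.symm (C r) = Away.mk _ (X_mem_grading 0) 0 (C r) hC := by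
          rw [RingEquiv.symm_apply_eq]
          refine Eq.trans ?_ (awayDehom_mk 0 (C r) hC).symm
          rw [← MvPolynomial.algebraMap_eq, ← MvPolynomial.algebraMap_eq, AlgHom.commutes]
        have h6 := hθ 0 (C r) hC
        rw [pow_zero, mul_one, evalSection_C] at h6
        change θ (E.symm (C r)) = σ (algebraMap _ K (C r))
        rw [h5, h6, ← MvPolynomial.algebraMap_eq, ← IsScalarTower.algebraMap_apply, AlgEquiv.commutes]
      · intro i
        have h5 : E.symm (X i) = Away.mk _ (X_mem_grading 0) 1 (X i.succ) (X_mem_grading i.succ) := by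
          rw [RingEquiv.symm_apply_eq]
          exact ((awayDehom_mk 1 (X i.succ) (X_mem_grading i.succ)).trans (dehom_X_succ i)).symm
        have h6 := hθ 1 (X i.succ) (X_mem_grading i.succ)
        change θ (E.symm (X i)) = σ (algebraMap _ K (X i))
        have h7 : σ (algebraMap _ K (X i)) * algebraMap _ K (dehom k d (F 0)) =
          algebraMap _ K (dehom k d (F i.succ)) := h.2 i
        rw [pow_one, h3, h3, ← h7] at h6
        rw [h5]
        field_simp at h6
        exact h6
    refine RingHom.ext fun z => ?_
    have h5 := congrArg (fun f => f (E z)) h4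
    change θ (E.symm (E z)) = _ at h5
    rw [RingEquiv.symm_apply_apply] at h5
    exact h5
  rw [map_projModel_ξ, ← h1]
  exact hθ'

end PolyMap

end Cremona

end

/-! ### Comparison with the degree -/

section

open AlgebraicGeometry CategoryTheory MvPolynomial

namespace Cremona

variable {k : Type u} [Field k] {d : ℕ} {K : Type u} [Field K] [Algebra (MvPolynomial (Fin d) k) K]
  [IsFractionRing (MvPolynomial (Fin d) k) K] [Algebra k K]
  [IsScalarTower k (MvPolynomial (Fin d) k) K]

lemma exists_isGivenBy (σ : K ≃ₐ[k] K) : ∃ a : Fin (d + 1) → MvPolynomial (Fin d) k, IsGivenBy σ a := by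
  obtain ⟨b, hb⟩ := IsLocalization.exist_integer_multiples_of_finite
    (nonZeroDivisors (MvPolynomial (Fin d) k))
    (fun i : Fin d => σ (algebraMap (MvPolynomial (Fin d) k) K (X i)))
  choose a ha using hb
  refine ⟨Fin.cons b.1 a, nonZeroDivisors.ne_zero b.2, fun i => ?_⟩
  rw [Fin.cons_zero, Fin.cons_succ, ha, mul_comm]
  exact (Algebra.smul_def b.1 _).symm

lemma sends_polyMap {n : ℕ} {F : Fin (d + 1) → MvPolynomial (Fin (d + 1)) k}
    (hF : ∀ i, F i ∈ grading k d n) {j : Fin (d + 1)} (hj : F j ≠ 0) :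
    (projModel k d K).Sends (polyMap F hF j hj).toRationalMap
      (liftBasicOpen K hj ≫ (polyMap F hF j hj).hom) :=
  (projModel k d K).sends_of_lift (polyMap F hF j hj) (liftBasicOpen K hj) (liftBasicOpen_ι K hj)

lemma isGivenBy_of_isGivenInDegree {g : Bir (projSpace k d)} {m : ℕ} (h : IsGivenInDegree g m)
    {σ : K ≃ₐ[k] K} (hσ : (projModel k d K).Sends g.map ((projModel k d K).twist σ).ξ) :
    ∃ a : Fin (d + 1) → MvPolynomial (Fin d) k, IsGivenBy σ a ∧ ∀ r, (a r).totalDegree ≤ m := by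
  obtain ⟨F, hF, hcop, hg⟩ := h
  obtain ⟨j, hj⟩ : ∃ j, F j ≠ 0 := by
    by_contra! h0
    exact not_isUnit_zero (hcop 0 fun i => by rw [h0])
  have h1 := sends_polyMap (K := K) hF hj
  rw [hg j hj] at h1
  refine ⟨_, isGivenBy_of_polyMap_eq K hF hj σ (h1.symm.trans (hσ.trans ?_)), fun r =>
    totalDegree_dehom_le ((mem_homogeneousSubmodule _ _).1 (hF r))⟩
  exact (projModel k d K).twist_ξ σ

lemma exists_isGivenInDegree {g : Bir (projSpace k d)} {σ : K ≃ₐ[k] K}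
    (hσ : (projModel k d K).Sends g.map ((projModel k d K).twist σ).ξ) :
    ∃ m, IsGivenInDegree g m := by
  classical
  -- Forms of the least possible degree are chosen. A common factor q is homogeneous and can be
  -- cancelled, so by minimality it has degree zero.
  have hex : ∃ (n : ℕ) (F : Fin (d + 1) → MvPolynomial (Fin (d + 1)) k), (∀ i, (F i).IsHomogeneous n) ∧
      IsGivenBy σ fun i => dehom k d (F i) := by
    obtain ⟨a, ha⟩ := exists_isGivenBy (d := d) σ
    obtain ⟨n, F, hF, hFa⟩ := exists_homogenization a
    exact ⟨n, F, hF, by simpa only [hFa] using ha⟩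
  obtain ⟨F, hF, hσF⟩ := Nat.find_spec hex
  refine ⟨Nat.find hex, F, fun i => (mem_homogeneousSubmodule _ _).2 (hF i), fun q hq => ?_,
    fun j hj => ?_⟩
  · choose G hG using hq
    have hF0 : F 0 ≠ 0 := fun h => hσF.1 (by simp only [h, map_zero])
    have hq0 : q ≠ 0 := fun h => hF0 (by rw [hG, h, zero_mul])
    have hG0 : G 0 ≠ 0 := fun h => hF0 (by rw [hG, h, mul_zero])
    have hom : ∀ i, G i ≠ 0 → ∃ a b, q.IsHomogeneous a ∧ (G i).IsHomogeneous b ∧ a + b = Nat.find hex :=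
      fun i hi => by
        have h1 : (q * G i).IsHomogeneous (Nat.find hex) := hG i ▸ hF i
        obtain ⟨a, ha⟩ := exists_isHomogeneous_of_mul h1 hq0 hi
        obtain ⟨b, hb⟩ := exists_isHomogeneous_of_mul (mul_comm q (G i) ▸ h1) hi hq0
        exact ⟨a, b, ha, hb, (ha.mul hb).inj_right h1 (mul_ne_zero hq0 hi)⟩
    obtain ⟨a, b, ha, -, hab⟩ := hom 0 hG0
    have hGb : ∀ i, (G i).IsHomogeneous b := fun i => by
      by_cases hi : G i = 0
      · rw [hi]
        exact isHomogeneous_zero _ _ _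
      · obtain ⟨a', b', ha', hb', hab'⟩ := hom i hi
        obtain rfl := ha'.inj_right ha hq0
        obtain rfl : b' = b := by lia
        exact hb'
    have hdq : algebraMap (MvPolynomial (Fin d) k) K (dehom k d q) ≠ 0 :=
      algebraMap_dehom_ne_zero K ha hq0
    have hmin : Nat.find hex ≤ b := Nat.find_min' hex ⟨G, hGb, fun h => hG0 (dehom_injective (hGb 0) h),
      fun i => by
        have h1 := hσF.2 i
        simp only [hG, map_mul] at h1
        apply mul_left_cancel₀ hdq
        rw [← h1]
        ring⟩
    obtain rfl : a = 0 := by lia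
    obtain ⟨c, rfl⟩ : ∃ c, q = C c := ⟨_, totalDegree_eq_zero_iff_eq_C.1 (Nat.le_zero.1 ha.totalDegree_le)⟩
    have hc : c ≠ 0 := by
      rintro rfl
      exact hq0 C_0
    exact hc.isUnit.map C
  · refine (projModel k d K).sends_injective (sends_polyMap _ hj) ?_
    rw [polyMap_eq_of_isGivenBy K _ hj hσF]
    exact hσ.trans ((projModel k d K).twist_ξ σ)

lemma exists_isGivenBy_totalDegree_le_deg {g : Bir (projSpace k d)} {σ : K ≃ₐ[k] K}
    (hσ : (projModel k d K).Sends g.map ((projModel k d K).twist σ).ξ) :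
    ∃ a : Fin (d + 1) → MvPolynomial (Fin d) k, IsGivenBy σ a ∧ ∀ r, (a r).totalDegree ≤ deg g := by
  -- `deg` is an infimum of natural numbers, equal to 0 on the empty set, so it is attained only
  -- because some degree is known to occur.
  have h : IsGivenInDegree g (deg g) := Nat.sInf_mem (exists_isGivenInDegree hσ)
  exact isGivenBy_of_isGivenInDegree h hσ

end Cremona

end

/-! ### Linear bound for the number of lost divisors -/

section

open MvPolynomial

namespace Cremona

variable {k : Type u} [Field k] {d : ℕ} {K : Type u} [Field K] [Algebra (MvPolynomial (Fin d) k) K]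
  [IsFractionRing (MvPolynomial (Fin d) k) K]

local notation "𝔸" => MvPolynomial (Fin d) k

lemma one_le_totalDegree_of_prime {p : 𝔸} (hp : Prime p) : 1 ≤ p.totalDegree := by
  by_contra! h
  obtain ⟨c, rfl⟩ : ∃ c, p = C c := ⟨_, totalDegree_eq_zero_iff_eq_C.1 (Nat.lt_one_iff.1 h)⟩
  have hc : c ≠ 0 := by
    rintro rfl
    exact hp.ne_zero C_0
  exact hp.not_isUnit (hc.isUnit.map C)

variable (K) in
/-- The prime divisors contained in a hypersurface. -/
def primeRingsOf (F : 𝔸) : Set (Subring K) := {R | ∃ p, ∃ hp : Prime p, R = primeRing K p hp ∧ p ∣ F}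

lemma encard_primeRingsOf_le {F : 𝔸} (hF : F ≠ 0) :
    (primeRingsOf K F).encard ≤ (F.totalDegree : ℕ∞) := by
  induction F using UniqueFactorizationMonoid.induction_on_prime with
  | h₁ => exact absurd rfl hF
  | h₂ x hx =>
    have h : primeRingsOf K x = ∅ := by
      rw [Set.eq_empty_iff_forall_notMem]
      rintro R ⟨p, hp, -, hpx⟩
      exact hp.not_isUnit (isUnit_of_dvd_unit hpx hx)
    rw [h, Set.encard_empty]
    exact zero_le
  | h₃ a p ha hp ih =>
    have h : primeRingsOf K (p * a) ⊆ insert (primeRing K p hp) (primeRingsOf K a) := by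
      rintro R ⟨q, hq, rfl, hqa⟩
      rcases hq.dvd_or_dvd hqa with h | h
      · exact Or.inl (primeRing_eq_of_associated hq hp (hq.associated_of_dvd hp h))
      · exact Or.inr ⟨q, hq, rfl, h⟩
    rw [totalDegree_mul_of_isDomain hp.ne_zero ha, add_comm, Nat.cast_add]
    refine (Set.encard_le_encard h).trans ((Set.encard_insert_le _ _).trans ?_)
    gcongr
    · exact ih ha
    · exact_mod_cast one_le_totalDegree_of_prime hp

lemma finite_primeRingsOf {F : 𝔸} (hF : F ≠ 0) : (primeRingsOf K F).Finite :=
  Set.finite_of_encard_le_coe (encard_primeRingsOf_le hF)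

variable [Algebra k K] [IsScalarTower k (MvPolynomial (Fin d) k) K]

/-- Cancellation of the common factors. -/
lemma IsGivenBy.exists_forall_prime {σ : K ≃ₐ[k] K} {a : Fin (d + 1) → 𝔸} {m : ℕ}
    (hσ : IsGivenBy σ a) (hm : ∀ r, (a r).totalDegree ≤ m) :
    ∃ b : Fin (d + 1) → 𝔸, IsGivenBy σ b ∧ (∀ r, (b r).totalDegree ≤ m) ∧
      ∀ p, Prime p → ∃ i, ¬ p ∣ b i := by
  -- a₀ is nonzero, so cancelling a common prime factor strictly lowers its degree.
  induction hn : (a 0).totalDegree using Nat.strong_induction_on generalizing a with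
  | _ n ih =>
    by_cases hp : ∀ p, Prime p → ∃ i, ¬ p ∣ a i
    · exact ⟨a, hσ, hm, hp⟩
    push Not at hp
    obtain ⟨p, hp, hpa⟩ := hp
    choose b hb using hpa
    obtain rfl : a = fun i => p * b i := funext hb
    have hb0 : b 0 ≠ 0 := fun h => hσ.1 (by simp only [h, mul_zero])
    have hdeg : ∀ i, b i ≠ 0 → (p * b i).totalDegree = p.totalDegree + (b i).totalDegree :=
      fun i hi => totalDegree_mul_of_isDomain hp.ne_zero hi
    have h1 := one_le_totalDegree_of_prime hp
    have h0 := hdeg 0 hb0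
    refine ih (b 0).totalDegree (by simp only at hn; lia) ⟨hb0, fun i => ?_⟩ (fun r => ?_) rfl
    · have h2 := hσ.2 i
      simp only [map_mul] at h2
      apply mul_left_cancel₀ (algebraMap_ne_zero' (K := K) hp.ne_zero)
      rw [← h2]
      ring
    · by_cases hr : b r = 0
      · rw [hr, totalDegree_zero]
        exact zero_le
      · have := hm r
        simp only [hdeg r hr] at this
        lia

/-- A lost divisor lies in the hypersurface a₀ · Jacobian = 0. The bound is not uniform in terms of
the degree of the map, but it needs no change of chart. -/
lemma finite_primeRings_diff (σ : K ≃ₐ[k] K) :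
    (primeRings 𝔸 K \ mapSubring σ '' primeRings 𝔸 K).Finite := by
  obtain ⟨a, ha⟩ := exists_isGivenBy (d := d) σ
  refine (finite_primeRingsOf (K := K) (mul_ne_zero ha.1 (jacobian_ne_zero ha))).subset ?_
  rintro _ ⟨⟨⟨p, hp⟩, rfl⟩, hR⟩
  refine ⟨p, hp, rfl, ?_⟩
  by_contra h
  obtain ⟨q, hq, hqp⟩ := exists_mapSubring_primeRing_eq ha hp
    (fun h' => h (h'.mul_right _)) (fun h' => h (h'.mul_left _))
  exact hR ⟨_, ⟨⟨q, hq⟩, rfl⟩, hqp⟩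

lemma finite_image_diff_primeRings (σ : K ≃ₐ[k] K) :
    (mapSubring σ '' primeRings 𝔸 K \ primeRings 𝔸 K).Finite := by
  refine ((finite_primeRings_diff (d := d) σ⁻¹).image (mapSubring σ)).subset ?_
  rintro _ ⟨⟨R, hR, rfl⟩, hR'⟩
  refine ⟨R, ⟨hR, ?_⟩, rfl⟩
  rintro ⟨R', hR'', rfl⟩
  rw [← mapSubring_mul, mul_inv_cancel, mapSubring_one] at hR'
  exact hR' hR''

/-- The exchange of the homogeneous coordinates `0` and `i + 1`. -/
lemma exists_algEquiv_swap (i : Fin d) : ∃ τ : K ≃ₐ[k] K,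
    ∀ j, τ (algebraMap 𝔸 K (X j)) = if j = i then (algebraMap 𝔸 K (X i))⁻¹ else
      algebraMap 𝔸 K (X j) / algebraMap 𝔸 K (X i) := by
  let x : Fin d → K := fun j => algebraMap 𝔸 K (X j)
  have hx : ∀ j, x j ≠ 0 := fun j => algebraMap_ne_zero' (X_ne_zero j)
  let y : Fin d → K := fun j => if j = i then (x i)⁻¹ else x j / x i
  let φ : 𝔸 →ₐ[k] K := aeval y
  have hφ : Function.Injective φ := by
    rw [injective_iff_map_eq_zero]
    intro f hf
    by_contra hf0
    -- Injectivity is checked on forms: applying φ to f gives xᵢ⁻ⁿ times the dehomogenization of F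
    -- with coordinates 0 and i + 1 exchanged.
    obtain ⟨n, F, hF, hFf⟩ := exists_homogenization (fun _ : Fin (d + 1) => f)
    have hF0 : rename (Equiv.swap 0 i.succ) (F 0) ≠ 0 := fun h => hf0 (by
      rw [← hFf 0, rename_injective _ (Equiv.injective _) (h.trans (map_zero _).symm), map_zero])
    have h1 := algebraMap_dehom_ne_zero K ((hF 0).rename_isHomogeneous (f := Equiv.swap 0 i.succ)) hF0
    let v : Fin (d + 1) → K := fun r => algebraMap 𝔸 K (dehom k d (X (Equiv.swap 0 i.succ r)))
    have h2 : φ.comp (dehom k d) =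
        (aeval fun r => (x i)⁻¹ * v r : MvPolynomial (Fin (d + 1)) k →ₐ[k] K) := by
      apply algHom_ext
      intro r
      rw [aeval_X, AlgHom.comp_apply]
      refine Fin.cases ?_ (fun j => ?_) r
      · simp only [v, dehom_X_zero, Equiv.swap_apply_left, dehom_X_succ, map_one]
        exact (inv_mul_cancel₀ (hx i)).symm
      · simp only [v, dehom_X_succ]
        have h3 : φ (X j) = y j := aeval_X _ _
        rw [h3]
        by_cases hj : j = i
        · subst hj
          simp [y]
        · rw [Equiv.swap_apply_of_ne_of_ne (Fin.succ_ne_zero j) (by simpa using hj), dehom_X_succ]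
          simp only [y, hj, if_false]
          rw [div_eq_inv_mul]
    have h3 : (aeval v : MvPolynomial (Fin (d + 1)) k →ₐ[k] K) =
        (IsScalarTower.toAlgHom k 𝔸 K).comp ((dehom k d).comp (rename (Equiv.swap 0 i.succ))) := by
      apply algHom_ext
      intro r
      simp [v]
    have h4 := congrArg (fun f => f (F 0)) h2
    simp only [AlgHom.comp_apply, hFf, hf] at h4
    rw [aeval_def, eval₂_mul_of_isHomogeneous (hF 0), ← aeval_def, h3] at h4
    exact mul_ne_zero (pow_ne_zero n (inv_ne_zero (hx i))) h1 h4.symm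
  let τ : K →ₐ[k] K := IsFractionRing.liftAlgHom (g := φ) hφ
  have hτ : ∀ j, τ (x j) = y j := fun j => by
    have : τ (x j) = φ (X j) :=
      (IsFractionRing.liftAlgHom_apply (g := φ) hφ _).trans (IsFractionRing.lift_algebraMap hφ _)
    rw [this]
    exact aeval_X _ _
  have hττ : τ.comp τ = AlgHom.id k K := by
    have h1 : (τ.comp τ).comp (IsScalarTower.toAlgHom k 𝔸 K) = IsScalarTower.toAlgHom k 𝔸 K := by
      apply algHom_ext
      intro j
      change τ (τ (x j)) = x j
      have hi : τ (x i) = (x i)⁻¹ := by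
        rw [hτ]
        exact if_pos rfl
      by_cases hj : j = i
      · subst hj
        rw [hi, map_inv₀, hi, inv_inv]
      · have hj' : τ (x j) = x j / x i := by
          rw [hτ]
          exact if_neg hj
        rw [hj', map_div₀, hi, hj']
        have := hx i
        field_simp
    apply AlgHom.ext
    intro z
    obtain ⟨a, b, -, rfl⟩ := IsFractionRing.div_surjective 𝔸 z
    have h2 : ∀ a, (τ.comp τ) (algebraMap 𝔸 K a) = algebraMap 𝔸 K a := fun a =>
      congrArg (fun f => f a) h1
    rw [map_div₀, h2, h2]
    rfl
  exact ⟨AlgEquiv.ofAlgHom τ τ hττ hττ, hτ⟩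

lemma jacobian_comp_perm (a : Fin (d + 1) → 𝔸) (e : Equiv.Perm (Fin (d + 1))) :
    jacobian (a ∘ e) = (Equiv.Perm.sign e : ℤ) * jacobian a := by
  unfold jacobian
  rw [← Matrix.det_permute]
  rfl

/-- Composing with a coordinate exchange lets aᵢ₊₁ play the role of a₀, so a divisor on which a₀
vanishes can be studied in another chart. The Jacobian changes only by a sign. -/
lemma IsGivenBy.mul_swap {σ τ : K ≃ₐ[k] K} {i : Fin d} {a : Fin (d + 1) → 𝔸} (hσ : IsGivenBy σ a)
    (hτ : ∀ j, τ (algebraMap 𝔸 K (X j)) = if j = i then (algebraMap 𝔸 K (X i))⁻¹ else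
      algebraMap 𝔸 K (X j) / algebraMap 𝔸 K (X i)) (hi : a i.succ ≠ 0) :
    IsGivenBy (σ * τ) (a ∘ Equiv.swap 0 i.succ) := by
  have h0 : algebraMap 𝔸 K (a 0) ≠ 0 := algebraMap_ne_zero' hσ.1
  have h1 : ∀ j, σ (algebraMap 𝔸 K (X j)) = algebraMap 𝔸 K (a j.succ) / algebraMap 𝔸 K (a 0) :=
    fun j => by rw [eq_div_iff h0, hσ.2]
  have h2 : algebraMap 𝔸 K (a i.succ) ≠ 0 := algebraMap_ne_zero' hi
  refine ⟨by simpa using hi, fun j => ?_⟩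
  rw [AlgEquiv.mul_apply, hτ, Function.comp_apply, Function.comp_apply, Equiv.swap_apply_left]
  by_cases hj : j = i
  · subst hj
    rw [if_pos rfl, map_inv₀, h1, Equiv.swap_apply_right]
    field_simp
  · rw [if_neg hj, map_div₀, h1, h1,
      Equiv.swap_apply_of_ne_of_ne (Fin.succ_ne_zero j) (by simpa using hj)]
    field_simp

variable (k d K) in
/-- The number of prime divisors contracted by the inverse of a birational map grows at most
linearly in the degree. -/
theorem exists_encard_primeRings_diff_le : ∃ C : ℕ, ∀ (σ : K ≃ₐ[k] K) (a : Fin (d + 1) → 𝔸) (m : ℕ),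
    IsGivenBy σ a → (∀ r, (a r).totalDegree ≤ m) →
      (primeRings 𝔸 K \ mapSubring σ '' primeRings 𝔸 K).encard ≤ (((d + 1) * m + C : ℕ) : ℕ∞) := by
  choose τ hτ using exists_algEquiv_swap (k := k) (d := d) (K := K)
  -- B collects what the coordinate exchanges move out of the chart, geometrically the hyperplane at
  -- infinity. It does not depend on σ and its size is the constant C.
  let B : Set (Subring K) := ⋃ i, mapSubring (τ i) '' primeRings 𝔸 K \ primeRings 𝔸 K
  have hB : B.Finite := Set.finite_iUnion fun i => finite_image_diff_primeRings (τ i)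
  refine ⟨B.ncard, fun σ a' m ha' hm' => ?_⟩
  obtain ⟨a, ha, hm, hcop⟩ := ha'.exists_forall_prime hm'
  have hsub : primeRings 𝔸 K \ mapSubring σ '' primeRings 𝔸 K ⊆
      primeRingsOf K (jacobian a) ∪ mapSubring σ '' B := by
    rintro _ ⟨⟨⟨p, hp⟩, rfl⟩, hR⟩
    by_cases hJ : p ∣ jacobian a
    · exact Or.inl ⟨p, hp, rfl, hJ⟩
    right
    obtain ⟨i, hi⟩ := hcop p hp
    refine Fin.cases (fun h0 => ?_) (fun i hi => ?_) i hi
    · obtain ⟨q, hq, hqp⟩ := exists_mapSubring_primeRing_eq ha hp h0 hJ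
      exact absurd ⟨_, ⟨⟨q, hq⟩, rfl⟩, hqp⟩ hR
    · have hi0 : a i.succ ≠ 0 := fun h => hi (h ▸ dvd_zero p)
      obtain ⟨q, hq, hqp⟩ := exists_mapSubring_primeRing_eq (ha.mul_swap (hτ i) hi0) hp
        (by simpa using hi) (fun h => hJ (by
          rw [jacobian_comp_perm] at h
          rcases Int.units_eq_one_or (Equiv.Perm.sign (Equiv.swap 0 i.succ)) with h1 | h1 <;>
            simpa [h1] using h))
      rw [mapSubring_mul] at hqp
      -- The ring at p is σ(τᵢ(A_(q))). Were τᵢ(A_(q)) in S, p would not be lost, so τᵢ(A_(q)) is in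
      -- B.
      refine ⟨_, Set.mem_iUnion.2 ⟨i, ⟨_, ⟨⟨q, hq⟩, rfl⟩, rfl⟩, fun h => hR ⟨_, h, hqp⟩⟩, hqp⟩
  refine (Set.encard_le_encard hsub).trans ((Set.encard_union_le _ _).trans ?_)
  rw [Nat.cast_add, hB.cast_ncard_eq]
  refine add_le_add ((encard_primeRingsOf_le (jacobian_ne_zero ha)).trans ?_) (Set.encard_image_le _ _)
  exact_mod_cast totalDegree_jacobian_le hm

end Cremona

end

/-! ### Linear growth of the degrees -/

section

open AlgebraicGeometry CategoryTheory

namespace Cremona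

lemma encard_image_diff_eq {α : Type*} (e : Equiv.Perm α) (S : Set α) :
    (e '' S \ S).encard = (S \ (e⁻¹ : Equiv.Perm α) '' S).encard := by
  rw [← e.injective.encard_image (S \ (e⁻¹ : Equiv.Perm α) '' S), Set.image_sdiff e.injective, ← Set.image_comp, ← Equiv.Perm.coe_mul,
    mul_inv_cancel, Equiv.Perm.coe_one, Set.image_id]

open Pointwise in
lemma image_zpow_eq {α : Type*} {e : Equiv.Perm α} {S : Set α} (h : e '' S = S) (j : ℤ) :
    (e ^ j) '' S = S := by
  have h1 : e ∈ MulAction.stabilizer (Equiv.Perm α) S := h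
  exact zpow_mem h1 j

variable {k K : Type u} [Field k] [Field K] [Algebra k K]

variable (k K) in
/-- The action of field automorphisms on subrings. -/
def subringPerm : (K ≃ₐ[k] K) →* Equiv.Perm (Subring K) :=
  MonoidHom.toHomPerm
    { toFun := fun σ => (mapSubring σ : Function.End (Subring K))
      map_one' := funext mapSubring_one
      map_mul' := fun σ τ => funext (mapSubring_mul σ τ) }

lemma coe_subringPerm (σ : K ≃ₐ[k] K) : ⇑(subringPerm k K σ) = mapSubring σ := rfl

/-- For n > 0 the hypothesis gives D(n)/n ≥ (1 − C/n)/(d + 1), and the right side converges to the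
claimed bound. -/
lemma le_liminf_div {D : ℕ → ℕ} {d C : ℕ} (h : ∀ n, n ≤ (d + 1) * D n + C) :
    1 / ((d : ENNReal) + 1) ≤
      Filter.liminf (fun n : ℕ => (D n : ENNReal) / (n : ENNReal)) Filter.atTop := by
  have h1 : Filter.Tendsto (fun n : ℕ => ENNReal.ofReal ((1 - (C : ℝ) / n) / (d + 1))) Filter.atTop
      (nhds (1 / ((d : ENNReal) + 1))) := by
    have h2 : 1 / ((d : ENNReal) + 1) = ENNReal.ofReal ((1 - 0) / ((d : ℝ) + 1)) := by
      rw [ENNReal.ofReal_div_of_pos (by positivity), ENNReal.ofReal_add (by positivity) zero_le_one]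
      simp
    rw [h2]
    exact ENNReal.tendsto_ofReal (((tendsto_const_div_atTop_nhds_zero_nat (C : ℝ)).const_sub 1).div_const _)
  rw [← h1.liminf_eq]
  refine Filter.liminf_le_liminf ?_
  filter_upwards [Filter.eventually_gt_atTop 0] with n hn
  have hn' : (0 : ℝ) < n := by exact_mod_cast hn
  have h3 : (D n : ENNReal) / (n : ENNReal) = ENNReal.ofReal ((D n : ℝ) / n) := by
    rw [ENNReal.ofReal_div_of_pos hn', ENNReal.ofReal_natCast, ENNReal.ofReal_natCast]
  rw [h3]
  refine ENNReal.ofReal_le_ofReal ?_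
  have h4 : (n : ℝ) ≤ (d + 1) * D n + C := by exact_mod_cast h n
  have h5 : (1 - (C : ℝ) / n) = (n - C) / n := by field_simp
  rw [h5, div_div, div_le_div_iff₀ (by positivity) hn']
  nlinarith

/-- If `g` is not pseudo-regularizable, then the degrees of its powers grow at least linearly. -/
theorem exists_le_deg_pow (d : ℕ) (g : Bir (projSpace k d))
    (hg : ¬ IsPseudoRegularizable (Subgroup.zpowers g)) :
    ∃ C : ℕ, ∀ n, n ≤ (d + 1) * deg (g ^ n) + C := by
  let A := MvPolynomial (Fin d) k
  let K := FractionRing A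
  let M : Model k K := projModel k d K
  let S : Set (Subring K) := primeRings A K
  obtain ⟨σ, h1, h2⟩ := M.exists_algEquiv_sends g
  obtain ⟨C, hC⟩ := exists_encard_primeRings_diff_le k d K
  refine ⟨C, ?_⟩
  -- The comparison of the two defects is applied to τ⁻¹: τ carries S \ τ⁻¹(S) to τ(S) \ S and
  -- τ⁻¹(S) \ S to S \ τ(S). Both kinds of growth are thus controlled by `hbound`.
  have hle : ∀ τ : K ≃ₐ[k] K, (subringPerm k K τ '' S \ S).encard ≤
      (S \ subringPerm k K τ '' S).encard := fun τ => by
    rw [encard_image_diff_eq, ← map_inv]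
    refine (encard_primeRings_diff_le τ⁻¹).trans ?_
    rw [← coe_subringPerm, encard_image_diff_eq, ← map_inv, inv_inv]
  have hbound : ∀ n : ℕ, (S \ subringPerm k K (σ ^ n) '' S).encard ≤
      (((d + 1) * deg (g ^ n) + C : ℕ) : ℕ∞) := fun n => by
    obtain ⟨a, ha, hdeg⟩ := exists_isGivenBy_totalDegree_le_deg (K := K) (M.sends_pow h1 n)
    exact hC (σ ^ n) a _ ha hdeg
  rcases exists_invariant_or_growth (subringPerm k K σ) (S := S) (finite_primeRings_diff σ)
    (finite_image_diff_primeRings σ) with ⟨S', hS', hf1, hf2, hret⟩ | h | h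
  · refine absurd ?_ hg
    have hinv : ∀ j : ℤ, (subringPerm k K σ ^ j) '' S' = S' := image_zpow_eq hS'
    exact M.isPseudoRegularizable_of_invariant (S := S) (S' := S') (σ := σ)
      (U := (chart k d).opensRange)
      (fun R hR => exists_projModel_localRing_eq k d K hR)
      (by
        rintro _ ⟨⟨p, hp⟩, rfl⟩ z
        exact mem_or_inv_mem_primeRing hp z)
      (by
        rintro _ ⟨⟨p, hp⟩, rfl⟩ T hT hT'
        exact eq_of_primeRing_le hp hT hT')
      (genericPoint_mem_opensRange_chart k d K)
      (fun x hx hx' => projModel_localRing_mem k d K hx hx') hf1 hf2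
      (fun R hR => by
        obtain ⟨j, hj⟩ := hret R hR
        refine ⟨j, ?_⟩
        rw [← map_zpow] at hj
        exact hj)
      (fun j R hR => by
        have h3 : (subringPerm k K σ ^ j) R ∈ S' := hinv j ▸ Set.mem_image_of_mem _ hR
        rw [← map_zpow] at h3
        exact h3) h1 h2
  · intro n
    have h3 := h n
    rw [← map_pow] at h3
    exact_mod_cast h3.trans (hbound n)
  · intro n
    have h3 := h n
    rw [← map_pow] at h3
    exact_mod_cast (h3.trans (hle _)).trans (hbound n)

end Cremona

end

end

theorem theorem1p6 (k : Type u) [Field k] (d : ℕ) (g : Cremona.Bir (Cremona.projSpace k d))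
    (hg : ¬ Cremona.IsPseudoRegularizable (Subgroup.zpowers g)) :
    (1 / ((d : ENNReal) + 1)) ≤
      Filter.liminf (fun n : ℕ => (Cremona.deg (g ^ n) : ENNReal) / (n : ENNReal)) Filter.atTop := by
  obtain ⟨C, hC⟩ := Cremona.exists_le_deg_pow d g hg
  exact Cremona.le_liminf_div hC
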